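/- Let $n \ge 0$ be an integer and let $\phi$ be a norm on $\mathbf{R}^{n+1}$ that is of class $C^2$ on $\mathbf{R}^{n+1}\setminus\{0\}$ and uniformly convex, i.e. there is $\gamma>0$ with $D^2\phi(u)(v,v)\ge\gamma|v|^2$ whenever $|u|=1$ and $v\perp u$. Let $\mathbf{G}$ be the Grassmannian of $n$-dimensional linear subspaces of $\mathbf{R}^{n+1}$; for $T\in\mathbf{G}$ let $T_\natural$ be the orthogonal projection onto $T$, let $\nu(T)$ be a unit normal of $T$, and set $F(T)=\phi(\nu(T))$. Let $\Omega\subseteq\mathbf{R}^{n+1}$ be open. An $n$-dimensional varifold in $\Omega$ is a Radon measure $V$ on $\Omega\times\mathbf{G}$, with weight $\|V\|(A)=V(A\times\mathbf{G})$; it is integral if it is a countable sum, with nonnegative integer coefficients, of measures $A\mapsto\mathscr{H}^n\{x\in S:(x,\mathrm{Tan}(N,x))\in A\}$, where $N$ is an $n$-dimensional $C^1$ submanifold of $\mathbf{R}^{n+1}$ and $S\subseteq N\cap\Omega$ is a Borel set. For a smooth vector field $g$ with compact support in $\Omega$ put $$\delta_FV(g)=\int B_F(T)\bullet Dg(x)\,dV(x,T),\qquad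 B_F(T)\bullet L=\left.\tfrac{d}{dt}\right|_{t=0}F(L_t[T])\,\bigl|{\textstyle\bigwedge}_n(L_t\circ T_\natural)\bigr|,\quad L_t=\mathrm{id}+tL .$$ Let $\|\delta_FV\|$ be the largest Borel regular measure over $\Omega$ whose value on each open $U\subseteq\Omega$ is $\sup\{\delta_FV(g):\operatorname{spt}g\subseteq U,\ |g|\le1\}$. If $\|\delta_FV\|$ is a Radon measure, $h_F(V,\cdot)$ denotes any $\|V\|$-measurable, locally $\|V\|$-integrable $\mathbf{R}^{n+1}$-valued function such that, for some $\|\delta_FV\|$-measurable $\eta$ with $|\eta|=1$ $\|\delta_FV\|$-almost everywhere, $$\delta_FV(g)=-\int h_F(V,x)\bullet g(x)\,F(T)\,dV(x,T)+\int\eta\bullet g\,d\|\delta_FV\|_{\mathrm{sing}}=\int\eta\bullet g\,d\|\delta_FV\|$$ for all such $g$, where $\|\delta_FV\|_{\mathrm{sing}}$ is the singular part of $\|\delta_FV\|$ with respect to $\|V\|$. For an $n$-dimensional embedded $C^2$ submanifold $M$, $h_F(M,\cdot)$ denotes any function that near each point of $M$ is such a mean curvature of the unit density varifold $A\mapsto\mathscr{H}^n\{x\in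 M:(x,\mathrm{Tan}(M,x))\in A\}$ of $M$. Let $\mathrm{Tan}^n(\|V\|,a)$ be the cone of $(\|V\|,n)$ approximate tangent vectors at $a$, i.e. the intersection of the tangent cones $\mathrm{Tan}(S,a)$ over all sets $S$ with $\lim_{r\to0^+}r^{-n}\|V\|(B(a,r)\setminus S)=0$, where $B(a,r)$ is the closed ball. **Theorem.** Let $V$ be an $n$-dimensional integral varifold in $\Omega$ such that $\|\delta_FV\|$ is a Radon measure over $\Omega$, and let $M\subseteq\Omega$ be an $n$-dimensional embedded submanifold of class $C^2$ with $\mathscr{H}^n(M)<\infty$. Let $A$ be the set of all $a\in M$ such that $T_a=\mathrm{Tan}^n(\|V\|,a)$ belongs to $\mathbf{G}$, $h_F(V,a)\perp T_a$, and $$\limsup_{r\to0^+}\,r^{-n-2}\int_{B(a,r)\times\mathbf{G}}\|S_\natural-(T_a)_\natural\|^2\,dV(x,S)<\infty .$$ Then $h_F(V,a)=h_F(M,a)$ for $\|V\|$-almost every $a\in A$. -/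

import Mathlib

open MeasureTheory Set Filter Topology
open scoped ENNReal ContDiff RealInnerProductSpace

namespace AnisotropicVarifold

noncomputable section

/-! ### The ambient space, the Grassmannian of hyperplanes -/

/-- The Euclidean space `ℝ^(n+1)`. -/
abbrev E (n : ℕ) : Type := EuclideanSpace ℝ (Fin (n + 1))

/-- The Grassmannian `G(n+1, n)` of `n`-dimensional linear subspaces of `ℝ^(n+1)`. -/
@[ext]
structure Gr (n : ℕ) : Type where
  carrier : Submodule ℝ (E n)
  finrank_eq : Module.finrank ℝ carrier = n

/-- The orthogonal projection of `ℝ^(n+1)` onto the plane `T`. -/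
def Gr.proj {n : ℕ} (T : Gr n) : E n →L[ℝ] E n := T.carrier.starProjection

/-- The Grassmannian is identified with the set of orthogonal projections, and carries the
topology induced by the space of endomorphisms. -/
instance (n : ℕ) : TopologicalSpace (Gr n) := TopologicalSpace.induced Gr.proj inferInstance

instance (n : ℕ) : MeasurableSpace (Gr n) := borel (Gr n)

instance (n : ℕ) : BorelSpace (Gr n) := ⟨rfl⟩

instance (n : ℕ) : Nonempty (Gr n) := by
  have h0 : (EuclideanSpace.single (0 : Fin (n + 1)) (1 : ℝ) : E n) ≠ 0 := by
    intro h
    have := congrArg (fun v : E n => v 0) h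
    simp at this
  have : Fact (Module.finrank ℝ (E n) = n + 1) := ⟨by simp⟩
  exact ⟨⟨_, Submodule.finrank_orthogonal_span_singleton (n := n) h0⟩⟩

/-- The image plane `L[T]`; if `L` collapses `T`, it is `T` by convention (this case is
always multiplied by a vanishing Jacobian). -/
def Gr.map {n : ℕ} (L : E n →L[ℝ] E n) (T : Gr n) : Gr n :=
  open Classical in
  if h : Module.finrank ℝ (T.carrier.map (L : E n →ₗ[ℝ] E n)) = n then ⟨_, h⟩ else T

/-- The Jacobian `|⋀ₙ (L ∘ T)|`: the factor by which `L` changes the `n`-dimensional measure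
on the plane `T`. -/
def Gr.jacobian {n : ℕ} (L : E n →L[ℝ] E n) (T : Gr n) : ℝ :=
  ((L : E n →ₗ[ℝ] E n) ∘ₗ T.carrier.subtype).normDet

/-! ### Uniformly convex norms and the associated integrands -/

/-- `φ` is a norm on `ℝ^(n+1)`, of class `C²` away from the origin, and uniformly convex. -/
structure IsUniformlyConvexNorm {n : ℕ} (φ : E n → ℝ) : Prop where
  pos : ∀ x, x ≠ 0 → 0 < φ x
  smul : ∀ (t : ℝ) (x : E n), φ (t • x) = |t| * φ x
  add_le : ∀ x y, φ (x + y) ≤ φ x + φ y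
  contDiffOn : ContDiffOn ℝ 2 φ {0}ᶜ
  elliptic : ∃ γ : ℝ, 0 < γ ∧ ∀ u v : E n, ‖u‖ = 1 → ⟪u, v⟫ = 0 →
    γ * ‖v‖ ^ 2 ≤ iteratedFDeriv ℝ 2 φ u ![v, v]

theorem Gr.exists_unit_normal {n : ℕ} (T : Gr n) : ∃ u : E n, u ∈ T.carrierᗮ ∧ ‖u‖ = 1 := by
  have h1 := T.carrier.finrank_add_finrank_orthogonal
  rw [T.finrank_eq] at h1
  have h2 : Module.finrank ℝ (E n) = n + 1 := by simp
  have h3 : 0 < Module.finrank ℝ (T.carrierᗮ) := by omega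
  have := Module.finrank_pos_iff.1 h3
  obtain ⟨u, hu⟩ := exists_norm_eq (T.carrierᗮ) (zero_le_one' ℝ)
  exact ⟨u, u.2, by simpa using hu⟩

/-- A choice `ν(T)` of a unit normal of `T`. -/
def Gr.unitNormal {n : ℕ} (T : Gr n) : E n := T.exists_unit_normal.choose

/-- The autonomous integrand `F(T) = φ(ν(T))` associated with the norm `φ`. As `φ` is even, it
does not depend on the choice of `ν`. -/
def integrand {n : ℕ} (φ : E n → ℝ) (T : Gr n) : ℝ := φ T.unitNormal

/-! ### Submanifolds, tangent cones -/

/-- The tangent cone `Tan(S, a)` of a set `S` at `a`. -/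
def tangentCone {n : ℕ} (S : Set (E n)) (a : E n) : Set (E n) :=
  {v | ∀ ε > 0, ∃ x ∈ S, ∃ r > (0 : ℝ), ‖x - a‖ < ε ∧ ‖r • (x - a) - v‖ < ε}

/-- `M` is an (embedded) `n`-dimensional submanifold of `ℝ^(n+1)` of class `C^j`: near each of
its points it is a regular level set of a function of class `C^j`. -/
def IsHypersurface {n : ℕ} (j : ℕ) (M : Set (E n)) : Prop :=
  ∀ a ∈ M, ∃ (U : Set (E n)) (f : E n → ℝ), IsOpen U ∧ a ∈ U ∧ ContDiffOn ℝ j f U ∧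
    (∀ x ∈ U, fderiv ℝ f x ≠ 0) ∧ M ∩ U = {x ∈ U | f x = 0}

/-- The tangent plane `Tan(M, x)` as a point of the Grassmannian (an arbitrary plane if the
tangent cone is not an `n`-dimensional subspace). -/
def tangentPlane {n : ℕ} (M : Set (E n)) (x : E n) : Gr n :=
  open Classical in
  if h : ∃ T : Gr n, (T.carrier : Set (E n)) = tangentCone M x then h.choose
  else Classical.arbitrary _

/-- The cone `Tan^n(μ, a)` of `(μ, n)` approximate tangent vectors at `a`: the intersection of
the cones `Tan(S, a)` over all sets `S` whose complement has vanishing `n`-dimensional `μ`-density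
at `a`. -/
def approxTangentCone {n : ℕ} (μ : Measure (E n)) (a : E n) : Set (E n) :=
  {v | ∀ S : Set (E n),
    Tendsto (fun r : ℝ => μ (Metric.closedBall a r \ S) / ENNReal.ofReal (r ^ n))
      (𝓝[>] 0) (𝓝 0) → v ∈ tangentCone S a}

/-! ### Varifolds -/

/-- `μ` is a Radon measure over the open set `Ω`, regarded as a measure on the whole space which
vanishes outside `Ω`. -/
structure IsRadonOn {n : ℕ} (Ω : Set (E n)) (μ : Measure (E n)) : Prop where
  compl : μ Ωᶜ = 0
  compact : ∀ K : Set (E n), IsCompact K → K ⊆ Ω → μ K < ⊤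

/-- The weight measure `‖V‖`. -/
def weight {n : ℕ} (V : Measure (E n × Gr n)) : Measure (E n) := V.map Prod.fst

/-- `V` is an `n`-dimensional varifold in `Ω`, i.e. a Radon measure over `Ω × G(n+1, n)`. As the
Grassmannian is compact this is a condition on `‖V‖`. -/
def IsVarifold {n : ℕ} (Ω : Set (E n)) (V : Measure (E n × Gr n)) : Prop :=
  IsRadonOn Ω (weight V)

/-- The varifold of a measurable part `S` of a hypersurface `M`:
`A ↦ ℋ^n {x ∈ S | (x, Tan(M, x)) ∈ A}`. -/
def pieceVarifold {n : ℕ} (M S : Set (E n)) : Measure (E n × Gr n) :=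
  ((Measure.euclideanHausdorffMeasure n).restrict S).map fun x => (x, tangentPlane M x)

/-- The varifold of a hypersurface `M`, with unit density. -/
def surfaceVarifold {n : ℕ} (M : Set (E n)) : Measure (E n × Gr n) := pieceVarifold M M

/-- `V` is an `n`-dimensional integral varifold in `Ω`: a countable sum, with nonnegative integer
coefficients, of the varifolds of measurable subsets of `C¹` hypersurfaces. -/
def IsIntegralVarifold {n : ℕ} (Ω : Set (E n)) (V : Measure (E n × Gr n)) : Prop :=
  IsVarifold Ω V ∧
    ∃ (N S : ℕ → Set (E n)) (c : ℕ → ℕ),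
      (∀ i, IsHypersurface 1 (N i) ∧ MeasurableSet (S i) ∧ S i ⊆ N i ∩ Ω) ∧
      V = Measure.sum fun i => (c i : ℝ≥0∞) • pieceVarifold (N i) (S i)

/-! ### First variation and mean curvature -/

/-- `B_F(T) • L`, the derivative at `t = 0` of `F(L_t[T]) |⋀ₙ (L_t ∘ T)|`, where
`L_t = id + t L`. -/
def stress {n : ℕ} (F : Gr n → ℝ) (T : Gr n) (L : E n →L[ℝ] E n) : ℝ :=
  deriv (fun t : ℝ => F (T.map (ContinuousLinearMap.id ℝ (E n) + t • L)) *
    T.jacobian (ContinuousLinearMap.id ℝ (E n) + t • L)) 0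

/-- Smooth vector fields with compact support contained in `U`. -/
structure IsTestField {n : ℕ} (U : Set (E n)) (g : E n → E n) : Prop where
  contDiff : ContDiff ℝ ∞ g
  hasCompactSupport : HasCompactSupport g
  tsupport_subset : tsupport g ⊆ U

/-- The first variation `δ_F V (g) = ∫ B_F(T) • Dg(x) dV(x, T)` with respect to the autonomous
integrand `F`. -/
def firstVariation {n : ℕ} (F : Gr n → ℝ) (V : Measure (E n × Gr n)) (g : E n → E n) : ℝ :=
  ∫ p, stress F p.2 (fderiv ℝ g p.1) ∂V

/-- The total variation `‖δ_F V‖` over `Ω`: the largest measure over `Ω` whose value on each open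
`U ⊆ Ω` is the supremum of `δ_F V (g)` over the test fields `g` supported in `U` with
`|g| ≤ 1`. -/
def totalVariation {n : ℕ} (F : Gr n → ℝ) (Ω : Set (E n)) (V : Measure (E n × Gr n)) :
    Measure (E n) :=
  sSup {μ | μ Ωᶜ = 0 ∧ ∀ U : Set (E n), IsOpen U → U ⊆ Ω →
    μ U = ⨆ (g : E n → E n) (_ : IsTestField U g) (_ : ∀ x, ‖g x‖ ≤ 1),
      ENNReal.ofReal (firstVariation F V g)}

/-- `V_F`, the measure `F V`. -/
def energy {n : ℕ} (F : Gr n → ℝ) (V : Measure (E n × Gr n)) : Measure (E n × Gr n) :=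
  V.withDensity fun p => ENNReal.ofReal (F p.2)

/-- `h` is (a representative of) the mean curvature `h_F(V, ·)` of the varifold `V` in `Ω`, for
`‖δ_F V‖` a Radon measure over `Ω`: for all test fields `g`,
`δ_F V (g) = - ∫ h • g d‖V_F‖ + ∫ η • g d‖δ_F V‖_sing = ∫ η • g d‖δ_F V‖`. -/
structure IsMeanCurvature {n : ℕ} (F : Gr n → ℝ) (Ω : Set (E n)) (V : Measure (E n × Gr n))
    (h : E n → E n) : Prop where
  radon : IsRadonOn Ω (totalVariation F Ω V)
  measurable : AEStronglyMeasurable h (weight V)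
  integrable : ∀ K : Set (E n), IsCompact K → K ⊆ Ω → IntegrableOn h K (weight V)
  representation : ∃ η : E n → E n,
    AEStronglyMeasurable η (totalVariation F Ω V) ∧
    (∀ᵐ x ∂(totalVariation F Ω V), ‖η x‖ = 1) ∧
    ∀ g, IsTestField Ω g →
      firstVariation F V g = -(∫ x, ⟪h x, g x⟫ ∂(weight (energy F V))) +
          ∫ x, ⟪η x, g x⟫ ∂((totalVariation F Ω V).singularPart (weight V)) ∧
      firstVariation F V g = ∫ x, ⟪η x, g x⟫ ∂(totalVariation F Ω V)

/-- `h` is (a representative of) the mean curvature `h_F(M, ·)` of the hypersurface `M`. This is a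
local notion: near each point of `M`, `h` is the mean curvature of the varifold of `M`. -/
def IsHypersurfaceMeanCurvature {n : ℕ} (F : Gr n → ℝ) (M : Set (E n)) (h : E n → E n) : Prop :=
  ∀ a ∈ M, ∃ U : Set (E n), IsOpen U ∧ a ∈ U ∧ IsMeanCurvature F U (surfaceVarifold (M ∩ U)) h

/-- The `n`-plane `T` is the approximate tangent plane `Tan^n(‖V‖, a)` of `V` at `a`. -/
def IsApproxTangentPlane {n : ℕ} (V : Measure (E n × Gr n)) (a : E n) (T : Gr n) : Prop :=
  (T.carrier : Set (E n)) = approxTangentCone (weight V) a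

/-- The quadratic tilt-excess `∫_{B(a,r) × G} ‖S - T‖² dV(x, S)` of `V` in the closed ball
`B(a, r)`, with respect to `T`. -/
def tiltExcess {n : ℕ} (V : Measure (E n × Gr n)) (a : E n) (r : ℝ) (T : Gr n) : ℝ≥0∞ :=
  ∫⁻ p in Metric.closedBall a r ×ˢ univ, ENNReal.ofReal (‖p.2.proj - T.proj‖ ^ 2) ∂V

end

end AnisotropicVarifold

open AnisotropicVarifold

/-!
The proof compares the first variations of `V` and of `M` on test fields which live at a small
scale `r` around `a` and are chosen so that only the mean curvature and the second order behaviour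
of the underlying sets contribute.

Let `T = T_a` with unit normal `u`, let `p = ∇φ(u)`, and write `y = (x - a) / r`. For the integrand
`F(S) = φ(ν(S))` the stress is `B_F(S) • L = φ(ν) tr L - ⟨ν, L ∇φ(ν)⟩` (`stress_eq_stressForm`),
with the derivative `dStress` with respect to the normal. The test field

  `g(x) = ψ(y) v + r β(⟨u, y⟩ / r) Λ(Dψ(y))`

consists of a cutoff in the direction `v` and of a tangential field, proportional to the height of
`x` over `a + T`, which is at most of order `r²` on `M`. The linear map `Λ` is chosen
(`exists_correction`) such that on `M`, where `β' = 1`, the terms of the stress which are linear in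
the tilt `t` of `S` against `T` cancel. The remaining error is a small multiple of `1 + t² / r²`
(`exists_abs_stress_testField_sub_le`). As the tilt-excess in `B(a, r)` is `O(r^(n + 2))` and the
part of the weight `μ` off `M` has density zero, this leaves the identity `curvature_isLittleO`: up
to `o(r^n)`, the number `F(T) ⟨h(a), v⟩ ∫ ψ(y) dμ(x)` is `-∫ mainTerm dμ`. Here the main term
involves the plane `T` and the points `x`, but no longer the planes `S`. For `v = p` its part of
order `1 / r` vanishes, because `φ(u) = ⟨u, p⟩`, and the rest is bounded.

At almost every `a ∈ M` the weight of `V` in `B(a, r)` is, up to `o(r^n)`, a positive multiple of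
the Hausdorff measure on `M`: the weight does not charge null sets of the Hausdorff measure, the
part off `M` has density zero, and the density on `M` has a Lebesgue point. This also forces
`T_a = Tan(M, a)`. So the identities for `V` and for `M` with `v = p` have proportional main terms,
and `⟨h_F(V, a), p⟩ = ⟨h_F(M, a), p⟩` (`curvature_eq`).

It remains to see that `h_F(M, a)` is normal to `T` (`inner_curvature_eq_zero`), as `h_F(V, a)` is
by assumption; since `⟨u, p⟩ = φ(u) > 0`, the vectors are then equal. For `v = e ∈ T` the part of
the main term which contains second derivatives of `ψ` vanishes by their symmetry, and the other
part is the integral of `φ(u) r⁻¹ D_e ψ(y)` over `M`. The projection of `M ∩ B(a, r)` to `a + T` is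
bi-Lipschitz with constants `1 + O(r²)` (`IsGraphAt.norm_sub_le`), so the integral of `D_e ψ(y)`
over `M` differs by `O(r^(n + 2))` from an integral of a derivative over `T`, which is zero.
-/

open Asymptotics

set_option maxSynthPendingDepth 3

namespace AnisotropicVarifold

/-! ### Hyperplanes and their unit normals -/

/-- `u` is a unit normal of the hyperplane `T`. -/
def Gr.IsNormal {n : ℕ} (T : Gr n) (u : E n) : Prop := u ∈ T.carrierᗮ ∧ ‖u‖ = 1

theorem Gr.isNormal_unitNormal {n : ℕ} (T : Gr n) : T.IsNormal T.unitNormal :=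
  T.exists_unit_normal.choose_spec

theorem Gr.IsNormal.neg {n : ℕ} {T : Gr n} {u : E n} (h : T.IsNormal u) : T.IsNormal (-u) :=
  ⟨T.carrierᗮ.neg_mem h.1, by rw [norm_neg, h.2]⟩

theorem Gr.finrank_orthogonal {n : ℕ} (T : Gr n) : Module.finrank ℝ T.carrierᗮ = 1 := by
  have h1 := T.carrier.finrank_add_finrank_orthogonal
  rw [T.finrank_eq] at h1
  have h2 : Module.finrank ℝ (E n) = n + 1 := by simp
  omega

theorem Gr.IsNormal.ne_zero {n : ℕ} {T : Gr n} {u : E n} (h : T.IsNormal u) : u ≠ 0 := by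
  rintro rfl
  simpa using h.2

theorem Gr.IsNormal.orthogonal_eq {n : ℕ} {T : Gr n} {u : E n} (h : T.IsNormal u) :
    T.carrierᗮ = ℝ ∙ u := by
  symm
  refine Submodule.eq_of_le_of_finrank_le ?_ ?_
  · rw [Submodule.span_singleton_le_iff_mem]
    exact h.1
  · rw [T.finrank_orthogonal, finrank_span_singleton h.ne_zero]

theorem Gr.IsNormal.mem_iff {n : ℕ} {T : Gr n} {u : E n} (h : T.IsNormal u) (x : E n) :
    x ∈ T.carrier ↔ ⟪u, x⟫ = 0 := by
  rw [← T.carrier.orthogonal_orthogonal, h.orthogonal_eq,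
    Submodule.mem_orthogonal_singleton_iff_inner_right]

theorem Gr.IsNormal.proj_apply {n : ℕ} {T : Gr n} {u : E n} (h : T.IsNormal u) (x : E n) :
    T.proj x = x - ⟪u, x⟫ • u := by
  refine Submodule.eq_starProjection_of_mem_orthogonal' ?_ (z := ⟪u, x⟫ • u)
    (T.carrierᗮ.smul_mem _ h.1) (by abel)
  rw [h.mem_iff, inner_sub_right, inner_smul_right, real_inner_self_eq_norm_sq, h.2]
  ring

theorem Gr.proj_mem {n : ℕ} (T : Gr n) (x : E n) : T.proj x ∈ T.carrier :=
  T.carrier.starProjection_apply_mem x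

theorem Gr.norm_proj_apply_le {n : ℕ} (T : Gr n) (x : E n) : ‖T.proj x‖ ≤ ‖x‖ :=
  T.carrier.norm_starProjection_apply_le x

theorem Gr.norm_proj_sub_le {n : ℕ} (S T : Gr n) : ‖S.proj - T.proj‖ ≤ 2 := by
  refine ContinuousLinearMap.opNorm_le_bound _ (by norm_num) fun x => ?_
  calc ‖S.proj x - T.proj x‖ ≤ ‖S.proj x‖ + ‖T.proj x‖ := norm_sub_le _ _
    _ ≤ 2 * ‖x‖ := by linarith [S.norm_proj_apply_le x, T.norm_proj_apply_le x]

theorem Gr.IsNormal.eq_or_eq_neg {n : ℕ} {T : Gr n} {u v : E n} (hu : T.IsNormal u)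
    (hv : T.IsNormal v) : v = u ∨ v = -u := by
  have h : v ∈ ℝ ∙ u := hu.orthogonal_eq ▸ hv.1
  obtain ⟨c, rfl⟩ := Submodule.mem_span_singleton.1 h
  have h1 := hv.2
  rw [norm_smul, hu.2, mul_one, Real.norm_eq_abs] at h1
  rcases (abs_eq zero_le_one).1 h1 with h | h <;> simp [h]

/-- Unit normals can be chosen to depend on the plane in a Lipschitz way near a given plane. -/
theorem Gr.exists_isNormal_near {n : ℕ} (S : Gr n) {T : Gr n} {v : E n} (hv : T.IsNormal v) :
    ∃ u, S.IsNormal u ∧ 0 ≤ ⟪u, v⟫ ∧ ‖u - v‖ ^ 2 ≤ 2 * ‖S.proj - T.proj‖ ^ 2 := by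
  obtain ⟨u, hu, huv⟩ : ∃ u, S.IsNormal u ∧ 0 ≤ ⟪u, v⟫ := by
    rcases le_total 0 ⟪S.unitNormal, v⟫ with h | h
    · exact ⟨_, S.isNormal_unitNormal, h⟩
    · exact ⟨_, S.isNormal_unitNormal.neg, by rw [inner_neg_left]; linarith⟩
  refine ⟨u, hu, huv, ?_⟩
  have h1 : (S.proj - T.proj) v = v - ⟪u, v⟫ • u := by
    rw [sub_apply, hu.proj_apply, hv.proj_apply, real_inner_self_eq_norm_sq,
      hv.2]
    simp
  have h2 : ‖v - ⟪u, v⟫ • u‖ ≤ ‖S.proj - T.proj‖ := by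
    rw [← h1]
    simpa [hv.2] using (S.proj - T.proj).le_opNorm v
  have h3 : ‖v - ⟪u, v⟫ • u‖ ^ 2 = 1 - ⟪u, v⟫ ^ 2 := by
    rw [norm_sub_sq_real, norm_smul, hu.2, hv.2, inner_smul_right, real_inner_comm, mul_one,
      Real.norm_eq_abs, sq_abs]
    ring
  have h4 : ‖u - v‖ ^ 2 = 2 - 2 * ⟪u, v⟫ := by
    rw [norm_sub_sq_real, hu.2, hv.2]
    ring
  have h5 : ⟪u, v⟫ ≤ 1 := by simpa [hu.2, hv.2] using real_inner_le_norm u v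
  have h6 := pow_le_pow_left₀ (norm_nonneg _) h2 2
  nlinarith

/-! ### The Jacobian of a linear map on a hyperplane -/

/-- The determinant of an endomorphism which preserves a hyperplane factorizes. -/
theorem det_eq_of_mapsTo {n : ℕ} {T : Gr n} {u : E n} (hu : T.IsNormal u) (A : E n →ₗ[ℝ] E n)
    (hA : ∀ x ∈ T.carrier, A x ∈ T.carrier) :
    LinearMap.det A = LinearMap.det (A.restrict hA) * ⟪u, A u⟫ := by
  rw [A.det_eq_det_mul_det T.carrier hA]
  congr 1
  have h1 : T.carrier.mapQ T.carrier A hA = ⟪u, A u⟫ • LinearMap.id := by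
    refine LinearMap.ext fun x => ?_
    induction x using Submodule.Quotient.induction_on with
    | _ x =>
      rw [Submodule.mapQ_apply, LinearMap.smul_apply, LinearMap.id_apply,
        ← Submodule.Quotient.mk_smul, Submodule.Quotient.eq, hu.mem_iff]
      have h2 : x = T.proj x + ⟪u, x⟫ • u := by rw [hu.proj_apply]; abel
      have h3 := (hu.mem_iff _).1 (hA _ (T.proj_mem x))
      conv_lhs => rw [h2]
      rw [map_add, map_smul, inner_sub_right, inner_add_right, h3, inner_smul_right,
        inner_smul_right, inner_add_right, inner_smul_right, real_inner_self_eq_norm_sq, hu.2,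
        (hu.mem_iff _).1 (T.proj_mem x)]
      ring
  have h4 : Module.finrank ℝ (E n ⧸ T.carrier) = 1 := by
    have := T.carrier.finrank_quotient_add_finrank
    rw [T.finrank_eq] at this
    simp at this
    omega
  rw [h1, LinearMap.det_smul, h4]
  simp

theorem normDet_isometry_comp {U V W : Type*} [NormedAddCommGroup U] [InnerProductSpace ℝ U]
    [FiniteDimensional ℝ U] [NormedAddCommGroup V] [InnerProductSpace ℝ V] [NormedAddCommGroup W]
    [InnerProductSpace ℝ W] (f : U →ₗ[ℝ] V) (R : V →ₗᵢ[ℝ] W) :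
    (R.toLinearMap ∘ₗ f).normDet = f.normDet := by
  rw [LinearMap.normDet_comp]
  have : (R.toLinearMap.domRestrict f.range).normDet = 1 :=
    (R.comp f.range.subtypeₗᵢ).normDet_eq_one
  rw [this, one_mul]

/-- An invertible `L` maps a hyperplane with unit normal `u` to the one with normal `w`, where
`Lᵗ w = u`; the Jacobian of `L` on the former is `|det L| |w|`. -/
theorem Gr.map_jacobian_of_adjoint {n : ℕ} {T : Gr n} {u w : E n} (hu : T.IsNormal u)
    (L : E n →L[ℝ] E n) (hL : Function.Injective L)
    (hw : ∀ x, ⟪w, L x⟫ = ⟪u, x⟫) :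
    (T.map L).IsNormal (‖w‖⁻¹ • w) ∧
      T.jacobian L = |LinearMap.det (L : E n →ₗ[ℝ] E n)| * ‖w‖ := by
  have hfr : Module.finrank ℝ (T.carrier.map (L : E n →ₗ[ℝ] E n)) = n := by
    rw [← (Submodule.equivMapOfInjective (L : E n →ₗ[ℝ] E n) hL T.carrier).finrank_eq]
    exact T.finrank_eq
  have hmap : (T.map L).carrier = T.carrier.map (L : E n →ₗ[ℝ] E n) := by
    rw [Gr.map, dif_pos hfr]
  have hw0 : w ≠ 0 := by
    rintro rfl
    have := hw u
    rw [inner_zero_left, real_inner_self_eq_norm_sq, hu.2] at this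
    norm_num at this
  have hw1 : 0 < ‖w‖ := norm_pos_iff.2 hw0
  have hN : (T.map L).IsNormal (‖w‖⁻¹ • w) := by
    refine ⟨?_, ?_⟩
    · rw [hmap, Submodule.mem_orthogonal]
      rintro _ ⟨x, hx, rfl⟩
      rw [real_inner_comm, inner_smul_left]
      have : ⟪w, L x⟫ = 0 := by rw [hw, (hu.mem_iff x).1 hx]
      simpa using Or.inr this
    · rw [norm_smul, norm_inv, norm_norm, inv_mul_cancel₀ hw1.ne']
  refine ⟨hN, ?_⟩
  -- An isometry `R` of the ambient space that carries `L[T]` back to `T`.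
  let e : (T.map L).carrier ≃ₗᵢ[ℝ] T.carrier :=
    (stdOrthonormalBasis ℝ (T.map L).carrier).equiv (stdOrthonormalBasis ℝ T.carrier)
      (finCongr ((T.map L).finrank_eq.trans T.finrank_eq.symm))
  let R : E n →ₗᵢ[ℝ] E n := (T.carrier.subtypeₗᵢ.comp e.toLinearIsometry).extend
  have hR : ∀ x ∈ (T.map L).carrier, R x ∈ T.carrier := by
    intro x hx
    have : R x = e ⟨x, hx⟩ := LinearIsometry.extend_apply _ (⟨x, hx⟩ : (T.map L).carrier)
    rw [this]
    exact (e ⟨x, hx⟩).2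
  let A : E n →ₗ[ℝ] E n := R.toLinearMap ∘ₗ (L : E n →ₗ[ℝ] E n)
  have hLT : ∀ x ∈ T.carrier, L x ∈ (T.map L).carrier := by
    intro x hx
    rw [hmap]
    exact ⟨x, hx, rfl⟩
  have hA : ∀ x ∈ T.carrier, A x ∈ T.carrier := fun x hx => hR _ (hLT x hx)
  have h1 : T.jacobian L = |LinearMap.det (A.restrict hA)| := by
    rw [← LinearMap.normDet_eq_abs_det, Gr.jacobian,
      ← normDet_isometry_comp ((L : E n →ₗ[ℝ] E n) ∘ₗ T.carrier.subtype) R,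
      ← normDet_isometry_comp (A.restrict hA) T.carrier.subtypeₗᵢ]
    rfl
  have h2 : |LinearMap.det A| = |LinearMap.det (L : E n →ₗ[ℝ] E n)| := by
    rw [← LinearMap.normDet_eq_abs_det, ← LinearMap.normDet_eq_abs_det]
    exact normDet_isometry_comp _ R
  have h3 := det_eq_of_mapsTo hu A hA
  -- `R` maps the unit normal of `L[T]` to `± u`.
  have h4 : T.IsNormal (R (‖w‖⁻¹ • w)) := by
    refine ⟨?_, by rw [R.norm_map, hN.2]⟩
    rw [Submodule.mem_orthogonal]
    intro x hx
    have h5 : x = R (e.symm ⟨x, hx⟩) := by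
      have : R (e.symm ⟨x, hx⟩) = e (e.symm ⟨x, hx⟩) := LinearIsometry.extend_apply _ _
      rw [this, e.apply_symm_apply]
    rw [h5, R.inner_map_map, hN.1 _ (e.symm ⟨x, hx⟩).2]
  have h6 : |⟪u, A u⟫| = ‖w‖⁻¹ := by
    have h7 : ⟪R (‖w‖⁻¹ • w), A u⟫ = ‖w‖⁻¹ := by
      change ⟪R (‖w‖⁻¹ • w), R (L u)⟫ = ‖w‖⁻¹
      rw [R.inner_map_map, inner_smul_left, hw, real_inner_self_eq_norm_sq, hu.2]
      simp
    rcases hu.eq_or_eq_neg h4 with h | h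
    · rw [h] at h7
      rw [h7, abs_of_pos (inv_pos.2 hw1)]
    · rw [h, inner_neg_left] at h7
      rw [← abs_neg, h7, abs_of_pos (inv_pos.2 hw1)]
  rw [h1, ← h2, h3, abs_mul, h6, mul_assoc, inv_mul_cancel₀ hw1.ne', mul_one]

/-! ### The stress of the integrand -/

theorem IsUniformlyConvexNorm.neg {n : ℕ} {φ : E n → ℝ} (hφ : IsUniformlyConvexNorm φ) (x : E n) :
    φ (-x) = φ x := by
  simpa using hφ.smul (-1) x

theorem IsUniformlyConvexNorm.integrand_eq {n : ℕ} {φ : E n → ℝ} (hφ : IsUniformlyConvexNorm φ)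
    {T : Gr n} {u : E n} (hu : T.IsNormal u) : integrand φ T = φ u := by
  rcases hu.eq_or_eq_neg T.isNormal_unitNormal with h | h
  · rw [integrand, h]
  · rw [integrand, h, hφ.neg]

theorem IsUniformlyConvexNorm.contDiffAt {n : ℕ} {φ : E n → ℝ} (hφ : IsUniformlyConvexNorm φ)
    {u : E n} (hu : u ≠ 0) : ContDiffAt ℝ 2 φ u :=
  hφ.contDiffOn.contDiffAt (isOpen_compl_singleton.mem_nhds hu)

theorem IsUniformlyConvexNorm.differentiableAt {n : ℕ} {φ : E n → ℝ}
    (hφ : IsUniformlyConvexNorm φ) {u : E n} (hu : u ≠ 0) : DifferentiableAt ℝ φ u :=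
  (hφ.contDiffAt hu).differentiableAt (by norm_num)

theorem hasDerivAt_det_one_add_smul {n : ℕ} (L : E n →L[ℝ] E n) :
    HasDerivAt (fun t : ℝ => LinearMap.det ((1 + t • L : E n →L[ℝ] E n) : E n →ₗ[ℝ] E n))
      (LinearMap.trace ℝ (E n) (L : E n →ₗ[ℝ] E n)) 0 := by
  set b := (EuclideanSpace.basisFun (Fin (n + 1)) ℝ).toBasis
  set N := LinearMap.toMatrix b b (L : E n →ₗ[ℝ] E n) with hN
  have h1 : (fun t : ℝ => LinearMap.det ((1 + t • L : E n →L[ℝ] E n) : E n →ₗ[ℝ] E n)) =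
      fun t : ℝ => Matrix.det (1 + t • N) := by
    funext t
    rw [← LinearMap.det_toMatrix b]
    congr 1
    have : ((1 + t • L : E n →L[ℝ] E n) : E n →ₗ[ℝ] E n) =
      LinearMap.id + t • (L : E n →ₗ[ℝ] E n) := rfl
    rw [this, map_add, map_smul, LinearMap.toMatrix_id]
  rw [h1, LinearMap.trace_eq_matrix_trace ℝ b, ← hN]
  set q := ((1 + (Polynomial.X : Polynomial ℝ) • N.map Polynomial.C).det).divX.divX
  have h2 : (fun t : ℝ => Matrix.det (1 + t • N)) =
      fun t : ℝ => 1 + N.trace * t + q.eval t * t ^ 2 :=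
    funext fun t => Matrix.det_one_add_smul t N
  rw [h2]
  have h3 : HasDerivAt (fun t : ℝ => 1 + N.trace * t + q.eval t * t ^ 2)
      (N.trace * 1 + (q.derivative.eval 0 * 0 ^ 2 + q.eval 0 * ((2 : ℕ) * 0 ^ 1))) 0 :=
    (((hasDerivAt_id (0 : ℝ)).const_mul N.trace).const_add 1).add
      ((q.hasDerivAt 0).mul (hasDerivAt_pow 2 (0 : ℝ)))
  convert h3 using 1
  simp

/-- The trace as a continuous linear functional. -/
noncomputable def traceL (n : ℕ) : (E n →L[ℝ] E n) →L[ℝ] ℝ :=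
  LinearMap.toContinuousLinearMap
    (LinearMap.trace ℝ (E n) ∘ₗ ContinuousLinearMap.coeLM (M := E n) (N₃ := E n) ℝ)

theorem traceL_apply {n : ℕ} (L : E n →L[ℝ] E n) :
    traceL n L = LinearMap.trace ℝ (E n) (L : E n →ₗ[ℝ] E n) := rfl

theorem traceL_smulRight {n : ℕ} (l : E n →L[ℝ] ℝ) (v : E n) :
    traceL n (l.smulRight v) = l v := by
  rw [traceL_apply]
  exact LinearMap.trace_smulRight _ _

/-- The stress as a function of a normal vector `u`, in closed form:
`L ↦ φ(u) tr L - ⟨u, L ∇φ(u)⟩`. -/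
noncomputable def stressForm {n : ℕ} (φ : E n → ℝ) (u : E n) : (E n →L[ℝ] E n) →L[ℝ] ℝ :=
  φ u • traceL n - (innerSL ℝ u) ∘L (ContinuousLinearMap.apply ℝ (E n) (gradient φ u))

theorem stressForm_apply {n : ℕ} (φ : E n → ℝ) (u : E n) (L : E n →L[ℝ] E n) :
    stressForm φ u L = φ u * traceL n L - ⟪u, L (gradient φ u)⟫ := rfl

theorem hasDerivAt_ringInverse_one_add_smul {R : Type*} [NormedRing R] [NormedAlgebra ℝ R]
    [CompleteSpace R] (B : R) :
    HasDerivAt (fun t : ℝ => Ring.inverse (1 + t • B)) (-B) 0 := by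
  have h1 := hasFDerivAt_ringInverse (𝕜 := ℝ) (1 : Rˣ)
  have h2 : HasDerivAt (fun t : ℝ => 1 + t • B) B 0 := by
    simpa using ((hasDerivAt_id (0 : ℝ)).smul_const B).const_add 1
  have h3 : HasFDerivAt Ring.inverse (-ContinuousLinearMap.mulLeftRight ℝ R
      (↑(1 : Rˣ)⁻¹) (↑(1 : Rˣ)⁻¹)) (1 + (0 : ℝ) • B) := by
    simpa using h1
  have h4 := h3.comp_hasDerivAt (0 : ℝ) h2
  simpa [Function.comp_def] using h4

theorem stress_eq_stressForm {n : ℕ} {φ : E n → ℝ} (hφ : IsUniformlyConvexNorm φ)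
    {T : Gr n} {u : E n} (hu : T.IsNormal u) (L : E n →L[ℝ] E n) :
    stress (integrand φ) T L = stressForm φ u L := by
  set B := ContinuousLinearMap.adjoint L with hB
  -- `w t` is the normal vector of the image plane whose length encodes the Jacobian
  set w : ℝ → E n := fun t => Ring.inverse (1 + t • B) u with hw
  have hBc : Continuous fun t : ℝ => (1 + t • B : E n →L[ℝ] E n) := by fun_prop
  have hLc : Continuous fun t : ℝ => (1 + t • L : E n →L[ℝ] E n) := by fun_prop
  have hB1 : ∀ᶠ t : ℝ in 𝓝 0, IsUnit (1 + t • B) := by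
    have : {x : E n →L[ℝ] E n | IsUnit x} ∈ 𝓝 (1 + (0 : ℝ) • B) :=
      Units.isOpen.mem_nhds (by simp)
    exact hBc.continuousAt.eventually this
  have hL1 : ∀ᶠ t : ℝ in 𝓝 0, IsUnit (1 + t • L) := by
    have h0 : (1 + (0 : ℝ) • L : E n →L[ℝ] E n) = 1 := by ext x; simp
    have : {x : E n →L[ℝ] E n | IsUnit x} ∈ 𝓝 (1 + (0 : ℝ) • L) := by
      rw [h0]
      exact Units.isOpen.mem_nhds isUnit_one
    exact hLc.continuousAt.eventually this
  have hdet := hasDerivAt_det_one_add_smul L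
  have hdet1 : ∀ᶠ t : ℝ in 𝓝 0,
      0 < LinearMap.det ((1 + t • L : E n →L[ℝ] E n) : E n →ₗ[ℝ] E n) := by
    refine hdet.continuousAt.eventually (lt_mem_nhds ?_)
    have : ((1 + (0 : ℝ) • L : E n →L[ℝ] E n) : E n →ₗ[ℝ] E n) = LinearMap.id := by
      ext; simp
    change 0 < LinearMap.det ((1 + (0 : ℝ) • L : E n →L[ℝ] E n) : E n →ₗ[ℝ] E n)
    rw [this, LinearMap.det_id]
    exact one_pos
  have hev : (fun t : ℝ => integrand φ (T.map (ContinuousLinearMap.id ℝ (E n) + t • L)) *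
      T.jacobian (ContinuousLinearMap.id ℝ (E n) + t • L)) =ᶠ[𝓝 0]
      fun t => LinearMap.det ((1 + t • L : E n →L[ℝ] E n) : E n →ₗ[ℝ] E n) * φ (w t) := by
    filter_upwards [hB1, hL1, hdet1] with t h1 h2 h3
    have hinj : Function.Injective (1 + t • L : E n →L[ℝ] E n) := by
      obtain ⟨g, hg⟩ := h2.exists_left_inv
      intro x y hxy
      have := congrArg g hxy
      change (g * (1 + t • L)) x = (g * (1 + t • L)) y at this
      rw [hg] at this
      exact this
    have hwt : ∀ x, ⟪w t, (1 + t • L : E n →L[ℝ] E n) x⟫ = ⟪u, x⟫ := by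
      intro x
      have h4 : (1 + t • B) (w t) = u := by
        change ((1 + t • B) * Ring.inverse (1 + t • B)) u = u
        rw [Ring.mul_inverse_cancel _ h1]
        rfl
      have h5 : ⟪w t, (1 + t • L : E n →L[ℝ] E n) x⟫ = ⟪(1 + t • B) (w t), x⟫ := by
        simp only [add_apply, smul_apply, one_apply_eq_self, inner_add_left,
          inner_add_right, inner_smul_left, inner_smul_right, hB,
          ContinuousLinearMap.adjoint_inner_left]
        simp
      rw [h5, h4]
    obtain ⟨hN, hJ⟩ := Gr.map_jacobian_of_adjoint hu (1 + t • L) hinj hwt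
    change integrand φ (T.map (1 + t • L)) * T.jacobian (1 + t • L) = _
    have hw0 : ‖w t‖ ≠ 0 := by
      intro h0
      have h4 := hN.2
      rw [h0, norm_eq_zero.1 h0] at h4
      simp at h4
    rw [hφ.integrand_eq hN, hJ, hφ.smul, abs_of_pos h3,
      abs_of_nonneg (inv_nonneg.2 (norm_nonneg _))]
    field_simp
  have hinv : HasDerivAt (fun t : ℝ => Ring.inverse (1 + t • B)) (-B) 0 :=
    hasDerivAt_ringInverse_one_add_smul B
  have hwd : HasDerivAt w (-(B u)) 0 := by
    have := hinv.clm_apply (hasDerivAt_const (0 : ℝ) u)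
    simpa using this
  have hw0 : w 0 = u := by simp [hw]
  have hφd : HasDerivAt (fun t => φ (w t)) (fderiv ℝ φ u (-(B u))) 0 := by
    have h1 : HasFDerivAt φ (fderiv ℝ φ u) (w 0) := by
      rw [hw0]
      exact (hφ.differentiableAt hu.ne_zero).hasFDerivAt
    exact h1.comp_hasDerivAt (0 : ℝ) hwd
  have hmain := hdet.mul hφd
  rw [stress, hev.deriv_eq]
  refine hmain.deriv.trans ?_
  have h6 : ((1 + (0 : ℝ) • L : E n →L[ℝ] E n) : E n →ₗ[ℝ] E n) = LinearMap.id := by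
    ext; simp
  rw [h6, hw0, LinearMap.det_id, stressForm_apply, traceL_apply, map_neg, one_mul,
    ← ContinuousLinearMap.adjoint_inner_left, ← hB]
  have h7 : ⟪B u, gradient φ u⟫ = fderiv ℝ φ u (B u) := by
    rw [real_inner_comm, gradient, InnerProductSpace.toDual_symm_apply]
  rw [h7]
  ring

/-! ### Linearization of the stress -/

theorem fderiv_apply_eq_inner_gradient {n : ℕ} (φ : E n → ℝ) (u w : E n) :
    fderiv ℝ φ u w = ⟪gradient φ u, w⟫ := by
  rw [gradient, InnerProductSpace.toDual_symm_apply]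

theorem IsUniformlyConvexNorm.differentiableAt_gradient {n : ℕ} {φ : E n → ℝ}
    (hφ : IsUniformlyConvexNorm φ) {u : E n} (hu : u ≠ 0) :
    DifferentiableAt ℝ (gradient φ) u := by
  have h1 : ContDiffAt ℝ 1 (fderiv ℝ φ) u := (hφ.contDiffAt hu).fderiv_right (by norm_num)
  have h2 : DifferentiableAt ℝ (fderiv ℝ φ) u := h1.differentiableAt (by norm_num)
  exact (InnerProductSpace.toDual ℝ (E n)).symm.differentiable.differentiableAt.comp u h2

/-- Euler's identity for a one-homogeneous function. -/
theorem IsUniformlyConvexNorm.inner_gradient_self {n : ℕ} {φ : E n → ℝ}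
    (hφ : IsUniformlyConvexNorm φ) {u : E n} (hu : u ≠ 0) : ⟪gradient φ u, u⟫ = φ u := by
  rw [← fderiv_apply_eq_inner_gradient]
  have h1 : HasDerivAt (fun t : ℝ => φ (u + t • u)) (fderiv ℝ φ u u) 0 := by
    have h2 : HasDerivAt (fun t : ℝ => u + t • u) u 0 := by
      simpa using ((hasDerivAt_id (0 : ℝ)).smul_const u).const_add u
    have h3 : HasFDerivAt φ (fderiv ℝ φ u) (u + (0 : ℝ) • u) := by
      simpa using (hφ.differentiableAt hu).hasFDerivAt
    exact h3.comp_hasDerivAt (0 : ℝ) h2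
  have h4 : (fun t : ℝ => φ (u + t • u)) =ᶠ[𝓝 0] fun t => (1 + t) * φ u := by
    filter_upwards [Ioi_mem_nhds (show (-1 : ℝ) < 0 by norm_num)] with t ht
    have h5 : u + t • u = (1 + t) • u := by rw [add_smul, one_smul]
    rw [h5, hφ.smul, abs_of_pos (by have : (-1 : ℝ) < t := ht; linarith)]
  have h6 : HasDerivAt (fun t : ℝ => (1 + t) * φ u) (1 * φ u) 0 :=
    ((hasDerivAt_id (0 : ℝ)).const_add 1).mul_const _
  rw [one_mul] at h6
  exact h1.unique (h6.congr_of_eventuallyEq h4)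

/-- The inner product `⟨u, L x⟩` as a continuous bilinear map of `u` and `x`, valued in the dual of
the space of endomorphisms. -/
noncomputable def innerApplyL (n : ℕ) : E n →L[ℝ] E n →L[ℝ] (E n →L[ℝ] E n) →L[ℝ] ℝ :=
  LinearMap.toContinuousLinearMap
    { toFun := fun u => LinearMap.toContinuousLinearMap
        { toFun := fun x => (innerSL ℝ u) ∘L (ContinuousLinearMap.apply ℝ (E n) x)
          map_add' := fun x y => by ext L; simp
          map_smul' := fun c x => by ext L; simp }
      map_add' := fun x y => by ext; simp
      map_smul' := fun c x => by ext; simp }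

theorem hasFDerivAt_stressForm {n : ℕ} {φ : E n → ℝ} (hφ : IsUniformlyConvexNorm φ) {u : E n}
    (hu : u ≠ 0) :
    HasFDerivAt (stressForm φ) ((fderiv ℝ φ u).smulRight (traceL n) -
      ((innerApplyL n u) ∘L (fderiv ℝ (gradient φ) u) +
        (innerApplyL n).flip (gradient φ u))) u := by
  have h1 := (hφ.differentiableAt hu).hasFDerivAt
  have h2 := (hφ.differentiableAt_gradient hu).hasFDerivAt
  have h3 := (innerApplyL n).hasFDerivAt (x := u)
  refine (h1.smul_const (traceL n)).sub ?_
  convert h3.clm_apply h2 using 1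
  rfl

/-- The derivative of the stress with respect to the normal. -/
noncomputable def dStress {n : ℕ} (φ : E n → ℝ) (u : E n) :
    E n →L[ℝ] (E n →L[ℝ] E n) →L[ℝ] ℝ := fderiv ℝ (stressForm φ) u

theorem dStress_apply {n : ℕ} {φ : E n → ℝ} (hφ : IsUniformlyConvexNorm φ) {u : E n}
    (hu : u ≠ 0) (w : E n) (L : E n →L[ℝ] E n) :
    dStress φ u w L = ⟪gradient φ u, w⟫ * traceL n L -
      (⟪u, L (fderiv ℝ (gradient φ) u w)⟫ + ⟪w, L (gradient φ u)⟫) := by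
  rw [dStress, (hasFDerivAt_stressForm hφ hu).fderiv, ← fderiv_apply_eq_inner_gradient]
  rfl

theorem continuousAt_stressForm {n : ℕ} {φ : E n → ℝ} (hφ : IsUniformlyConvexNorm φ) {u : E n}
    (hu : u ≠ 0) : ContinuousAt (stressForm φ) u :=
  (hasFDerivAt_stressForm hφ hu).continuousAt

theorem exists_norm_stressForm_le {n : ℕ} {φ : E n → ℝ} (hφ : IsUniformlyConvexNorm φ) :
    ∃ C, 0 ≤ C ∧ ∀ u, ‖u‖ = 1 → ‖stressForm φ u‖ ≤ C := by
  have h1 : ContinuousOn (stressForm φ) (Metric.sphere 0 1) := by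
    intro u hu
    exact (continuousAt_stressForm hφ (ne_zero_of_mem_unit_sphere ⟨u, hu⟩)).continuousWithinAt
  obtain ⟨C, hC⟩ := (isCompact_sphere (0 : E n) 1).exists_bound_of_continuousOn h1
  exact ⟨max C 0, le_max_right _ _, fun u hu =>
    (hC u (by simpa using hu)).trans (le_max_left _ _)⟩

/-- First order expansion of a function on the unit sphere: as `f` is only assumed to be
differentiable at `u`, the remainder is a small multiple of the distance, up to a quadratic term. -/
theorem exists_taylor_sphere {n : ℕ} {F : Type*} [NormedAddCommGroup F] [NormedSpace ℝ F]
    {f : E n → F} {f' : E n →L[ℝ] F} {u : E n} (hf : HasFDerivAt f f' u) (hu : ‖u‖ = 1) {C : ℝ}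
    (hC : ∀ v, ‖v‖ = 1 → ‖f v‖ ≤ C) {ε : ℝ} (hε : 0 < ε) :
    ∃ B, 0 ≤ B ∧ ∀ v, ‖v‖ = 1 → ‖f v - f u - f' (v - u)‖ ≤ ε * ‖v - u‖ + B * ‖v - u‖ ^ 2 := by
  have h1 := hf.isLittleO.bound hε
  obtain ⟨δ, hδ, h2⟩ := Metric.eventually_nhds_iff.1 h1
  have hC0 : 0 ≤ C := (norm_nonneg _).trans (hC u hu)
  set B := 2 * C + 2 * ‖f'‖ with hB
  have hB0 : 0 ≤ B := by positivity
  refine ⟨B / δ ^ 2, by positivity, fun v hv => ?_⟩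
  rcases lt_or_ge (dist v u) δ with h | h
  · have := h2 h
    have h3 : 0 ≤ B / δ ^ 2 * ‖v - u‖ ^ 2 := by positivity
    linarith
  · rw [dist_eq_norm] at h
    have h3 : ‖f v - f u - f' (v - u)‖ ≤ B := by
      have h4 : ‖v - u‖ ≤ 2 := (norm_sub_le _ _).trans (by rw [hu, hv]; norm_num)
      calc ‖f v - f u - f' (v - u)‖ ≤ ‖f v - f u‖ + ‖f' (v - u)‖ := norm_sub_le _ _
        _ ≤ (‖f v‖ + ‖f u‖) + ‖f'‖ * ‖v - u‖ :=
          add_le_add (norm_sub_le _ _) (f'.le_opNorm _)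
        _ ≤ (C + C) + ‖f'‖ * 2 := by
          gcongr
          · exact hC v hv
          · exact hC u hu
        _ = B := by rw [hB]; ring
    have h5 : B ≤ B / δ ^ 2 * ‖v - u‖ ^ 2 := by
      rw [div_mul_eq_mul_div, le_div_iff₀ (by positivity)]
      gcongr
    have : 0 ≤ ε * ‖v - u‖ := by positivity
    linarith

/-- Expansion of the stress of a plane `S` near `T`, in terms of a tilt vector `w ∈ T`. -/
theorem exists_stress_taylor {n : ℕ} {φ : E n → ℝ} (hφ : IsUniformlyConvexNorm φ)
    {T : Gr n} {u : E n} (hu : T.IsNormal u) {ε : ℝ} (hε : 0 < ε) :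
    ∃ C, 0 ≤ C ∧ ∀ S : Gr n, ∃ w ∈ T.carrier, ‖w‖ ≤ 2 * ‖S.proj - T.proj‖ ∧
      ∀ L : E n →L[ℝ] E n, |stress (integrand φ) S L - stressForm φ u L - dStress φ u w L| ≤
        (ε * ‖S.proj - T.proj‖ + C * ‖S.proj - T.proj‖ ^ 2) * ‖L‖ := by
  obtain ⟨C0, hC0, hb⟩ := exists_norm_stressForm_le hφ
  have hd := hasFDerivAt_stressForm hφ hu.ne_zero
  obtain ⟨B, hB0, hB⟩ := exists_taylor_sphere hd hu.2 hb (half_pos hε)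
  rw [← hd.fderiv] at hB
  refine ⟨2 * B + ‖dStress φ u‖, by positivity, fun S => ?_⟩
  obtain ⟨s, hs, -, hsu⟩ := S.exists_isNormal_near hu
  set t := ‖S.proj - T.proj‖ with ht
  have ht0 : 0 ≤ t := norm_nonneg _
  have h1 : ‖s - u‖ ≤ 2 * t := by
    refine abs_le_of_sq_le_sq' ?_ (by positivity) |>.2
    nlinarith
  -- the normal component of `s - u` is quadratic in the tilt
  have h2 : ⟪u, s - u⟫ = -(‖s - u‖ ^ 2 / 2) := by
    rw [norm_sub_sq_real, inner_sub_right, real_inner_self_eq_norm_sq, hu.2, hs.2,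
      real_inner_comm]
    ring
  refine ⟨T.proj (s - u), T.proj_mem _, (T.norm_proj_apply_le _).trans h1, fun L => ?_⟩
  have h3 : ‖(s - u) - T.proj (s - u)‖ ≤ t ^ 2 := by
    rw [hu.proj_apply, sub_sub_cancel, norm_smul, hu.2, mul_one, h2, Real.norm_eq_abs, abs_neg,
      abs_of_nonneg (by positivity)]
    linarith
  have h4 : stress (integrand φ) S L - stressForm φ u L - dStress φ u (T.proj (s - u)) L =
      (stressForm φ s - stressForm φ u - dStress φ u (s - u)) L +
        dStress φ u ((s - u) - T.proj (s - u)) L := by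
    rw [stress_eq_stressForm hφ hs, map_sub (dStress φ u) (s - u)]
    simp only [sub_apply]
    ring
  rw [h4]
  calc |(stressForm φ s - stressForm φ u - dStress φ u (s - u)) L +
        dStress φ u ((s - u) - T.proj (s - u)) L|
      ≤ ‖(stressForm φ s - stressForm φ u - dStress φ u (s - u)) L‖ +
        ‖dStress φ u ((s - u) - T.proj (s - u)) L‖ := abs_add_le _ _
    _ ≤ ‖stressForm φ s - stressForm φ u - dStress φ u (s - u)‖ * ‖L‖ +
        ‖dStress φ u‖ * ‖(s - u) - T.proj (s - u)‖ * ‖L‖ :=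
      add_le_add (ContinuousLinearMap.le_opNorm _ _) (ContinuousLinearMap.le_opNorm₂ _ _ _)
    _ ≤ (ε / 2 * ‖s - u‖ + B * ‖s - u‖ ^ 2) * ‖L‖ + ‖dStress φ u‖ * t ^ 2 * ‖L‖ := by
      gcongr
      exact hB s hs.2
    _ ≤ (ε / 2 * (2 * t) + B * (2 * t ^ 2)) * ‖L‖ + ‖dStress φ u‖ * t ^ 2 * ‖L‖ := by
      gcongr
    _ = (ε * t + (2 * B + ‖dStress φ u‖) * t ^ 2) * ‖L‖ := by ring

/-- The stress is a continuous function of the plane. -/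
theorem exists_continuous_stress {n : ℕ} {φ : E n → ℝ} (hφ : IsUniformlyConvexNorm φ) :
    ∃ G : Gr n → (E n →L[ℝ] E n) →L[ℝ] ℝ, Continuous G ∧
      ∀ S L, stress (integrand φ) S L = G S L := by
  refine ⟨fun S => stressForm φ S.unitNormal, ?_, fun S L =>
    stress_eq_stressForm hφ S.isNormal_unitNormal L⟩
  refine continuous_iff_continuousAt.2 fun T => ?_
  have hT := T.isNormal_unitNormal
  have hproj : Continuous (Gr.proj (n := n)) := continuous_induced_dom
  rw [ContinuousAt, Metric.tendsto_nhds]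
  intro ε hε
  obtain ⟨δ, hδ, h1⟩ := Metric.continuousAt_iff.1 (continuousAt_stressForm hφ hT.ne_zero) ε hε
  have h2 := Metric.tendsto_nhds.1 (hproj.tendsto T) (δ / 2) (half_pos hδ)
  filter_upwards [h2] with S hS
  obtain ⟨s, hs, -, hsu⟩ := S.exists_isNormal_near hT
  have h3 : stressForm φ S.unitNormal = stressForm φ s := by
    ext L
    rw [← stress_eq_stressForm hφ hs, ← stress_eq_stressForm hφ S.isNormal_unitNormal]
  rw [h3]
  refine h1 ?_
  rw [dist_eq_norm] at hS ⊢
  refine abs_lt_of_sq_lt_sq' ?_ hδ.le |>.2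
  nlinarith [norm_nonneg (S.proj - T.proj)]

theorem continuous_integrand {n : ℕ} {φ : E n → ℝ} (hφ : IsUniformlyConvexNorm φ) :
    Continuous (integrand φ : Gr n → ℝ) := by
  refine continuous_iff_continuousAt.2 fun T => ?_
  have hT := T.isNormal_unitNormal
  have hproj : Continuous (Gr.proj (n := n)) := continuous_induced_dom
  rw [ContinuousAt, Metric.tendsto_nhds]
  intro ε hε
  obtain ⟨δ, hδ, h1⟩ :=
    Metric.continuousAt_iff.1 (hφ.differentiableAt hT.ne_zero).continuousAt ε hε
  have h2 := Metric.tendsto_nhds.1 (hproj.tendsto T) (δ / 2) (half_pos hδ)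
  filter_upwards [h2] with S hS
  obtain ⟨s, hs, -, hsu⟩ := S.exists_isNormal_near hT
  rw [hφ.integrand_eq hs, hφ.integrand_eq hT]
  refine h1 ?_
  rw [dist_eq_norm] at hS ⊢
  refine abs_lt_of_sq_lt_sq' ?_ hδ.le |>.2
  nlinarith [norm_nonneg (S.proj - T.proj)]

theorem IsUniformlyConvexNorm.sub_le {n : ℕ} {φ : E n → ℝ} (hφ : IsUniformlyConvexNorm φ)
    (x y : E n) : φ x - φ y ≤ φ (x - y) := by
  have := hφ.add_le (x - y) y
  rw [sub_add_cancel] at this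
  linarith

theorem IsUniformlyConvexNorm.exists_le {n : ℕ} {φ : E n → ℝ} (hφ : IsUniformlyConvexNorm φ) :
    ∃ C, 0 ≤ C ∧ ∀ x, φ x ≤ C * ‖x‖ := by
  have h1 : ContinuousOn φ (Metric.sphere 0 1) := fun u hu =>
    (hφ.differentiableAt (ne_zero_of_mem_unit_sphere ⟨u, hu⟩)).continuousAt.continuousWithinAt
  obtain ⟨C, hC⟩ := (isCompact_sphere (0 : E n) 1).exists_bound_of_continuousOn h1
  refine ⟨max C 0, le_max_right _ _, fun x => ?_⟩
  rcases eq_or_ne x 0 with rfl | hx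
  · have := hφ.smul 0 0
    simp at this
    simp [this]
  · have h2 : x = ‖x‖ • (‖x‖⁻¹ • x) := by
      rw [smul_smul, mul_inv_cancel₀ (norm_ne_zero_iff.2 hx), one_smul]
    have h3 : ‖‖x‖⁻¹ • x‖ = 1 := by
      rw [norm_smul, norm_inv, norm_norm, inv_mul_cancel₀ (norm_ne_zero_iff.2 hx)]
    conv_lhs => rw [h2]
    rw [hφ.smul, abs_of_nonneg (norm_nonneg _), mul_comm]
    gcongr
    exact (le_abs_self _).trans ((hC _ (by simpa using h3)).trans (le_max_left _ _))

theorem IsUniformlyConvexNorm.integrand_pos {n : ℕ} {φ : E n → ℝ} (hφ : IsUniformlyConvexNorm φ)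
    (T : Gr n) : 0 < integrand φ T :=
  hφ.pos _ T.isNormal_unitNormal.ne_zero

/-- The integrand is Lipschitz on the Grassmannian. -/
theorem IsUniformlyConvexNorm.exists_abs_integrand_sub_le {n : ℕ} {φ : E n → ℝ}
    (hφ : IsUniformlyConvexNorm φ) :
    ∃ C, 0 ≤ C ∧ ∀ S T : Gr n, |integrand φ S - integrand φ T| ≤ C * ‖S.proj - T.proj‖ := by
  obtain ⟨C, hC0, hC⟩ := hφ.exists_le
  refine ⟨C * 2, by positivity, fun S T => ?_⟩
  have hT := T.isNormal_unitNormal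
  obtain ⟨s, hs, -, hsu⟩ := S.exists_isNormal_near hT
  rw [hφ.integrand_eq hs, hφ.integrand_eq hT]
  have h1 : ‖s - T.unitNormal‖ ≤ 2 * ‖S.proj - T.proj‖ := by
    refine abs_le_of_sq_le_sq' ?_ (by positivity) |>.2
    nlinarith [sq_nonneg ‖S.proj - T.proj‖]
  have h2 := hφ.sub_le s T.unitNormal
  have h3 := hφ.sub_le T.unitNormal s
  have h4 : φ (T.unitNormal - s) = φ (s - T.unitNormal) := by rw [← hφ.neg, neg_sub]
  have h5 := hC (s - T.unitNormal)
  have h6 : C * ‖s - T.unitNormal‖ ≤ C * (2 * ‖S.proj - T.proj‖) := by gcongr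
  rw [abs_le]
  constructor <;> linarith

/-- The tangential field which compensates, to first order in the tilt, the stress of
`ℓ ⊗ v`. -/
theorem exists_correction {n : ℕ} {φ : E n → ℝ} (hφ : IsUniformlyConvexNorm φ)
    {T : Gr n} {u : E n} (hu : T.IsNormal u) (v : E n) :
    ∃ Λ : (E n →L[ℝ] ℝ) →L[ℝ] E n, (∀ l, Λ l ∈ T.carrier) ∧
      ∀ w ∈ T.carrier, ∀ l : E n →L[ℝ] ℝ, dStress φ u w (l.smulRight v) = φ u * ⟪w, Λ l⟫ := by
  have hφu : φ u ≠ 0 := (hφ.pos u hu.ne_zero).ne'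
  set b := EuclideanSpace.basisFun (Fin (n + 1)) ℝ
  have key : ∃ Λ : (E n →L[ℝ] ℝ) →L[ℝ] E n, ∀ w l,
      ⟪w, Λ l⟫ = (φ u)⁻¹ * dStress φ u (T.proj w) (l.smulRight v) := by
    let Λ : (E n →L[ℝ] ℝ) →ₗ[ℝ] E n :=
      { toFun := fun l => ∑ i, ((φ u)⁻¹ * dStress φ u (T.proj (b i)) (l.smulRight v)) • b i
        map_add' := fun l m => by
          rw [← Finset.sum_add_distrib]
          refine Finset.sum_congr rfl fun i _ => ?_
          have : (l + m).smulRight v = l.smulRight v + m.smulRight v := by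
            ext x; simp [add_smul]
          rw [this, map_add, mul_add, add_smul]
        map_smul' := fun c l => by
          rw [Finset.smul_sum]
          refine Finset.sum_congr rfl fun i _ => ?_
          have : (c • l).smulRight v = c • l.smulRight v := by
            ext x; simp [mul_assoc]
          rw [this, map_smul, smul_smul, smul_eq_mul, RingHom.id_apply]
          congr 1
          ring }
    refine ⟨LinearMap.toContinuousLinearMap Λ, fun w l => ?_⟩
    change ⟪w, ∑ i, ((φ u)⁻¹ * dStress φ u (T.proj (b i)) (l.smulRight v)) • b i⟫ = _
    rw [inner_sum]
    have h1 : w = ∑ i, ⟪b i, w⟫ • b i := (b.sum_repr' w).symm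
    conv_rhs => rw [h1]
    rw [map_sum, map_sum, sum_apply, Finset.mul_sum]
    refine Finset.sum_congr rfl fun i _ => ?_
    rw [inner_smul_right, map_smul, map_smul, smul_apply, smul_eq_mul, real_inner_comm]
    ring
  obtain ⟨Λ, hΛ⟩ := key
  refine ⟨Λ, fun l => ?_, fun w hw l => ?_⟩
  · rw [hu.mem_iff, hΛ, hu.proj_apply, real_inner_self_eq_norm_sq, hu.2]
    simp
  · rw [hΛ, hu.proj_apply, (hu.mem_iff w).1 hw, ← mul_assoc, mul_inv_cancel₀ hφu]
    simp

/-! ### The rescaled test fields -/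

/-- The test field `ψ(y) v + r β(z / r) Λ(Dψ(y))`, where `y = (x - a) / r` and `z = ⟨u, y⟩` is the
rescaled height. The second term moves points tangentially, by the height truncated at the
scale `r²`. -/
noncomputable def testField {n : ℕ} (a u : E n) (ψ : E n → ℝ) (β : ℝ → ℝ)
    (Λ : (E n →L[ℝ] ℝ) →L[ℝ] E n) (v : E n) (r : ℝ) (x : E n) : E n :=
  ψ (r⁻¹ • (x - a)) • v +
    (r * β (r⁻¹ * ⟪u, r⁻¹ • (x - a)⟫)) • Λ (fderiv ℝ ψ (r⁻¹ • (x - a)))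

/-- The part of the stress of `testField` which remains when terms of higher order are
neglected, as a function of the rescaled variable `y`. -/
noncomputable def mainTerm {n : ℕ} (φ : E n → ℝ) (u : E n) (ψ : E n → ℝ) (β : ℝ → ℝ)
    (Λ : (E n →L[ℝ] ℝ) →L[ℝ] E n) (v : E n) (r : ℝ) (y : E n) : ℝ :=
  r⁻¹ * fderiv ℝ ψ y (φ u • v - ⟪u, v⟫ • gradient φ u) +
    φ u * β (r⁻¹ * ⟪u, y⟫) * traceL n (Λ ∘L fderiv ℝ (fderiv ℝ ψ) y)

theorem fderiv_testField {n : ℕ} (a u : E n) {ψ : E n → ℝ} {β : ℝ → ℝ} (hψ : ContDiff ℝ ∞ ψ)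
    (hβ : ContDiff ℝ ∞ β) (Λ : (E n →L[ℝ] ℝ) →L[ℝ] E n) (v : E n) {r : ℝ} (hr : 0 < r) (x : E n) :
    fderiv ℝ (testField a u ψ β Λ v r) x =
      r⁻¹ • (fderiv ℝ ψ (r⁻¹ • (x - a))).smulRight v +
      (r⁻¹ * deriv β (r⁻¹ * ⟪u, r⁻¹ • (x - a)⟫)) •
        (innerSL ℝ u).smulRight (Λ (fderiv ℝ ψ (r⁻¹ • (x - a)))) +
      β (r⁻¹ * ⟪u, r⁻¹ • (x - a)⟫) • (Λ ∘L fderiv ℝ (fderiv ℝ ψ) (r⁻¹ • (x - a))) := by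
  set y := r⁻¹ • (x - a) with hy
  have h1 : HasFDerivAt (fun x : E n => r⁻¹ • (x - a)) (r⁻¹ • ContinuousLinearMap.id ℝ (E n)) x :=
    ((hasFDerivAt_id x).sub_const a).const_smul r⁻¹
  have h2 : HasFDerivAt (fun x : E n => ψ (r⁻¹ • (x - a)))
      ((fderiv ℝ ψ y) ∘L (r⁻¹ • ContinuousLinearMap.id ℝ (E n))) x :=
    ((hψ.differentiable (by simp)).differentiableAt.hasFDerivAt (x := y)).comp x h1
  have hψ' : ContDiff ℝ ∞ (fderiv ℝ ψ) := hψ.fderiv_right (by simp)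
  have h3 : HasFDerivAt (fun x : E n => fderiv ℝ ψ (r⁻¹ • (x - a)))
      ((fderiv ℝ (fderiv ℝ ψ) y) ∘L (r⁻¹ • ContinuousLinearMap.id ℝ (E n))) x :=
    ((hψ'.differentiable (by simp)).differentiableAt.hasFDerivAt (x := y)).comp x h1
  have h4 : HasFDerivAt (fun x : E n => Λ (fderiv ℝ ψ (r⁻¹ • (x - a))))
      (Λ ∘L ((fderiv ℝ (fderiv ℝ ψ) y) ∘L (r⁻¹ • ContinuousLinearMap.id ℝ (E n)))) x :=
    Λ.hasFDerivAt.comp x h3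
  have h5 : HasFDerivAt (fun x : E n => r⁻¹ * ⟪u, r⁻¹ • (x - a)⟫)
      (r⁻¹ • ((innerSL ℝ u) ∘L (r⁻¹ • ContinuousLinearMap.id ℝ (E n)))) x :=
    (((innerSL ℝ u).hasFDerivAt (x := y)).comp x h1).const_mul r⁻¹
  have h6 : HasFDerivAt (fun x : E n => r * β (r⁻¹ * ⟪u, r⁻¹ • (x - a)⟫))
      (r • (deriv β (r⁻¹ * ⟪u, y⟫) •
        (r⁻¹ • ((innerSL ℝ u) ∘L (r⁻¹ • ContinuousLinearMap.id ℝ (E n)))))) x :=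
    (((hβ.differentiable (by simp)).differentiableAt.hasDerivAt
      (x := r⁻¹ * ⟪u, y⟫)).comp_hasFDerivAt x h5).const_mul r
  refine ((h2.smul_const v).add (h6.smul h4)).fderiv.trans ?_
  ext1 w
  simp only [add_apply, smul_apply, ContinuousLinearMap.smulRight_apply,
    ContinuousLinearMap.comp_apply, ContinuousLinearMap.id_apply, map_smul, smul_smul,
    smul_eq_mul, innerSL_apply_apply, ← hy]
  rw [add_assoc]
  congr 1
  rw [add_comm]
  congr 2
  · field_simp
  · field_simp

theorem notMem_tsupport_of_one_lt {n : ℕ} {ψ : E n → ℝ} (hψs : tsupport ψ ⊆ Metric.closedBall 0 1)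
    {y : E n} (hy : 1 < ‖y‖) : y ∉ tsupport ψ := fun h => by
  have := hψs h
  rw [mem_closedBall_zero_iff] at this
  linarith

theorem fderiv_eq_zero_of_one_lt {n : ℕ} {ψ : E n → ℝ}
    (hψs : tsupport ψ ⊆ Metric.closedBall 0 1) {y : E n} (hy : 1 < ‖y‖) : fderiv ℝ ψ y = 0 :=
  image_eq_zero_of_notMem_tsupport fun h =>
    notMem_tsupport_of_one_lt hψs hy (tsupport_fderiv_subset ℝ h)

theorem fderiv_fderiv_eq_zero_of_one_lt {n : ℕ} {ψ : E n → ℝ}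
    (hψs : tsupport ψ ⊆ Metric.closedBall 0 1) {y : E n} (hy : 1 < ‖y‖) :
    fderiv ℝ (fderiv ℝ ψ) y = 0 :=
  image_eq_zero_of_notMem_tsupport fun h =>
    notMem_tsupport_of_one_lt hψs hy (tsupport_fderiv_subset ℝ (tsupport_fderiv_subset ℝ h))

theorem one_lt_norm_of_notMem_closedBall {n : ℕ} {a x : E n} {r : ℝ} (hr : 0 < r)
    (hx : x ∉ Metric.closedBall a r) : 1 < ‖r⁻¹ • (x - a)‖ := by
  rw [Metric.mem_closedBall, dist_eq_norm, not_le] at hx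
  rw [norm_smul, norm_inv, Real.norm_of_nonneg hr.le, ← div_eq_inv_mul, one_lt_div hr]
  exact hx

theorem testField_eq_zero {n : ℕ} (a u : E n) {ψ : E n → ℝ} (β : ℝ → ℝ)
    (hψs : tsupport ψ ⊆ Metric.closedBall 0 1) (Λ : (E n →L[ℝ] ℝ) →L[ℝ] E n) (v : E n) {r : ℝ}
    (hr : 0 < r) {x : E n} (hx : x ∉ Metric.closedBall a r) : testField a u ψ β Λ v r x = 0 := by
  have h1 := one_lt_norm_of_notMem_closedBall hr hx
  rw [testField, fderiv_eq_zero_of_one_lt hψs h1,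
    image_eq_zero_of_notMem_tsupport (notMem_tsupport_of_one_lt hψs h1)]
  simp

theorem mainTerm_eq_zero {n : ℕ} (φ : E n → ℝ) (u : E n) {ψ : E n → ℝ} (β : ℝ → ℝ)
    (hψs : tsupport ψ ⊆ Metric.closedBall 0 1) (Λ : (E n →L[ℝ] ℝ) →L[ℝ] E n) (v : E n) (r : ℝ)
    {y : E n} (hy : 1 < ‖y‖) : mainTerm φ u ψ β Λ v r y = 0 := by
  rw [mainTerm, fderiv_eq_zero_of_one_lt hψs hy, fderiv_fderiv_eq_zero_of_one_lt hψs hy]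
  simp

theorem contDiff_testField {n : ℕ} (a u : E n) {ψ : E n → ℝ} {β : ℝ → ℝ} (hψ : ContDiff ℝ ∞ ψ)
    (hβ : ContDiff ℝ ∞ β) (Λ : (E n →L[ℝ] ℝ) →L[ℝ] E n) (v : E n) (r : ℝ) :
    ContDiff ℝ ∞ (testField a u ψ β Λ v r) := by
  have hψ' : ContDiff ℝ ∞ (fderiv ℝ ψ) := hψ.fderiv_right (by simp)
  have h1 : ContDiff ℝ ∞ fun x : E n => r⁻¹ • (x - a) :=
    (contDiff_id.sub contDiff_const).const_smul _
  have h2 : ContDiff ℝ ∞ fun x : E n => r⁻¹ * ⟪u, r⁻¹ • (x - a)⟫ :=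
    contDiff_const.mul ((innerSL ℝ u).contDiff.comp h1)
  exact ((hψ.comp h1).smul contDiff_const).add
    ((contDiff_const.mul (hβ.comp h2)).smul (Λ.contDiff.comp (hψ'.comp h1)))

theorem isTestField_testField {n : ℕ} (a u : E n) {ψ : E n → ℝ} {β : ℝ → ℝ} (hψ : ContDiff ℝ ∞ ψ)
    (hβ : ContDiff ℝ ∞ β) (hψs : tsupport ψ ⊆ Metric.closedBall 0 1)
    (Λ : (E n →L[ℝ] ℝ) →L[ℝ] E n) (v : E n) {r : ℝ} (hr : 0 < r) {U : Set (E n)}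
    (hU : Metric.closedBall a r ⊆ U) : IsTestField U (testField a u ψ β Λ v r) := by
  have h1 : tsupport (testField a u ψ β Λ v r) ⊆ Metric.closedBall a r := by
    refine closure_minimal (fun x hx => ?_) Metric.isClosed_closedBall
    by_contra h
    exact hx (testField_eq_zero a u β hψs Λ v hr h)
  exact ⟨contDiff_testField a u hψ hβ Λ v r,
    (isCompact_closedBall a r).of_isClosed_subset (isClosed_tsupport _) h1, h1.trans hU⟩

/-! ### The stress of the test fields -/

theorem stressForm_smulRight {n : ℕ} (φ : E n → ℝ) (u v : E n) (l : E n →L[ℝ] ℝ) :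
    stressForm φ u (l.smulRight v) = l (φ u • v - ⟪u, v⟫ • gradient φ u) := by
  rw [stressForm_apply, traceL_smulRight, map_sub, map_smul, map_smul,
    ContinuousLinearMap.smulRight_apply, inner_smul_right, smul_eq_mul, smul_eq_mul]
  ring

theorem stressForm_of_mem {n : ℕ} (φ : E n → ℝ) {T : Gr n} {u : E n} (hu : T.IsNormal u)
    {L : E n →L[ℝ] E n} (hL : ∀ x, L x ∈ T.carrier) : stressForm φ u L = φ u * traceL n L := by
  rw [stressForm_apply, (hu.mem_iff _).1 (hL _), sub_zero]

theorem dStress_innerSL_smulRight {n : ℕ} {φ : E n → ℝ} (hφ : IsUniformlyConvexNorm φ) {T : Gr n}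
    {u : E n} (hu : T.IsNormal u) {Y : E n} (hY : Y ∈ T.carrier) (w : E n) :
    dStress φ u w ((innerSL ℝ u).smulRight Y) = -(φ u * ⟪w, Y⟫) := by
  rw [dStress_apply hφ hu.ne_zero, traceL_smulRight, ContinuousLinearMap.smulRight_apply,
    ContinuousLinearMap.smulRight_apply, inner_smul_right, inner_smul_right, innerSL_apply_apply,
    innerSL_apply_apply, innerSL_apply_apply, (hu.mem_iff _).1 hY,
    ← hφ.inner_gradient_self hu.ne_zero,
    real_inner_comm u (gradient φ u)]
  ring

theorem exists_norm_fderiv_le {n : ℕ} {ψ : E n → ℝ} (hψ : ContDiff ℝ ∞ ψ)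
    (hψs : tsupport ψ ⊆ Metric.closedBall 0 1) :
    ∃ C, 0 ≤ C ∧ ∀ y, |ψ y| ≤ C ∧ ‖fderiv ℝ ψ y‖ ≤ C ∧ ‖fderiv ℝ (fderiv ℝ ψ) y‖ ≤ C := by
  have hc : HasCompactSupport ψ :=
    (isCompact_closedBall 0 1).of_isClosed_subset (isClosed_tsupport _) hψs
  have hψ' : ContDiff ℝ ∞ (fderiv ℝ ψ) := hψ.fderiv_right (by simp)
  obtain ⟨C1, h1⟩ := hc.exists_bound_of_continuous hψ.continuous
  obtain ⟨C2, h2⟩ := (hc.fderiv ℝ).exists_bound_of_continuous hψ'.continuous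
  obtain ⟨C3, h3⟩ := ((hc.fderiv ℝ).fderiv ℝ).exists_bound_of_continuous
    (hψ'.continuous_fderiv (by simp))
  exact ⟨max 0 (max C1 (max C2 C3)), le_max_left _ _, fun y =>
    ⟨(h1 y).trans (by simp), (h2 y).trans (by simp), (h3 y).trans (by simp)⟩⟩

theorem exists_abs_deriv_le {β : ℝ → ℝ} (hβ : ContDiff ℝ ∞ β) (hβs : HasCompactSupport β) :
    ∃ C, 0 ≤ C ∧ ∀ t, |β t| ≤ C ∧ |deriv β t| ≤ C := by
  obtain ⟨C1, h1⟩ := hβs.exists_bound_of_continuous hβ.continuous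
  obtain ⟨C2, h2⟩ := (hβs.deriv).exists_bound_of_continuous (hβ.continuous_deriv (by simp))
  exact ⟨max 0 (max C1 C2), le_max_left _ _, fun y =>
    ⟨(h1 y).trans (by simp), (h2 y).trans (by simp)⟩⟩

/-- An error term for points at which the truncation of the height is active. -/
noncomputable def truncError (β : ℝ → ℝ) (s : ℝ) : ℝ :=
  open Classical in if deriv β s = 1 then 0 else 1

theorem truncError_nonneg (β : ℝ → ℝ) (s : ℝ) : 0 ≤ truncError β s := by
  rw [truncError]; split_ifs <;> norm_num

theorem truncError_le_one (β : ℝ → ℝ) (s : ℝ) : truncError β s ≤ 1 := by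
  rw [truncError]; split_ifs <;> norm_num

theorem abs_one_sub_deriv_le {β : ℝ → ℝ} {C : ℝ} (hC : ∀ t, |deriv β t| ≤ C) (s : ℝ) :
    |1 - deriv β s| ≤ (1 + C) * truncError β s := by
  rw [truncError]
  split_ifs with h
  · simp [h]
  · rw [mul_one]
    calc |1 - deriv β s| ≤ |(1 : ℝ)| + |deriv β s| := abs_sub _ _
      _ ≤ 1 + C := by rw [abs_one]; gcongr; exact hC s

theorem le_mul_one_add_sq_div_sq (t : ℝ) {r : ℝ} (hr : 0 < r) :
    t ≤ r * (1 + t ^ 2 / r ^ 2) := by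
  have h2 : t / r ≤ 1 + t ^ 2 / r ^ 2 := by
    rw [← div_pow]
    nlinarith [sq_nonneg (1 - t / r), sq_nonneg (t / r)]
  calc t = r * (t / r) := by field_simp
    _ ≤ _ := by gcongr

theorem mul_inv_mul_le_young {χ t r lam : ℝ} (hχ0 : 0 ≤ χ) (hχ1 : χ ≤ 1) (hr : 0 < r)
    (hlam : 0 < lam) : χ * (r⁻¹ * t) ≤ χ / (4 * lam) + lam * (t ^ 2 / r ^ 2) := by
  have h1 : r⁻¹ * t ≤ 1 / (4 * lam) + lam * (t ^ 2 / r ^ 2) := by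
    have h2 : 0 ≤ (1 - 2 * lam * (t / r)) ^ 2 / (4 * lam) := by positivity
    have h3 : (1 - 2 * lam * (t / r)) ^ 2 / (4 * lam) =
        1 / (4 * lam) + lam * (t ^ 2 / r ^ 2) - r⁻¹ * t := by
      field_simp
      ring
    linarith
  calc χ * (r⁻¹ * t) ≤ χ * (1 / (4 * lam) + lam * (t ^ 2 / r ^ 2)) := by gcongr
    _ = χ / (4 * lam) + χ * (lam * (t ^ 2 / r ^ 2)) := by ring
    _ ≤ χ / (4 * lam) + 1 * (lam * (t ^ 2 / r ^ 2)) := by gcongr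
    _ = _ := by rw [one_mul]

/-- The error terms of the expansion of the stress are absorbed by means of Young's inequality. -/
theorem error_terms_le {η G C2 C3 B : ℝ} (hη : 0 < η) (hG0 : 0 ≤ G) (hC20 : 0 ≤ C2) (hC30 : 0 ≤ C3)
    (hB0 : 0 ≤ B) {t r χ : ℝ} (ht0 : 0 ≤ t) (hr : 0 < r) (hχ0 : 0 ≤ χ) (hχ1 : χ ≤ 1) :
    (η / (2 * (G + 1)) * t + B * t ^ 2) * (r⁻¹ * G) + C2 * (χ * (r⁻¹ * t)) + C3 * t ≤
      η * (1 + t ^ 2 / r ^ 2) + (C2 / (4 * (η / (2 * (C2 + 1)))) + C3 + B * G) *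
        (χ + r * (1 + t ^ 2 / r ^ 2)) := by
  set lam := η / (2 * (C2 + 1)) with hlam
  have hlam0 : 0 < lam := by positivity
  have htr := le_mul_one_add_sq_div_sq t hr
  have htr' : r⁻¹ * t ≤ 1 + t ^ 2 / r ^ 2 := by
    calc r⁻¹ * t ≤ r⁻¹ * (r * (1 + t ^ 2 / r ^ 2)) := by gcongr
      _ = _ := by field_simp
  have hyoung := mul_inv_mul_le_young (t := t) hχ0 hχ1 hr hlam0
  set Q := 1 + t ^ 2 / r ^ 2 with hQ
  have hQ0 : 0 ≤ t ^ 2 / r ^ 2 := by positivity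
  have hQ1 : t ^ 2 / r ^ 2 ≤ Q := by linarith
  have hQ2 : 0 ≤ Q := by linarith
  have h1 : η / (2 * (G + 1)) * t * (r⁻¹ * G) ≤ η / 2 * Q := by
    have h2 : η / (2 * (G + 1)) * G ≤ η / 2 := by
      rw [div_mul_eq_mul_div, div_le_div_iff₀ (by positivity) (by norm_num)]
      nlinarith
    calc η / (2 * (G + 1)) * t * (r⁻¹ * G) = (η / (2 * (G + 1)) * G) * (r⁻¹ * t) := by ring
      _ ≤ η / 2 * Q := mul_le_mul h2 htr' (by positivity) (by positivity)
  have h3 : B * t ^ 2 * (r⁻¹ * G) ≤ B * G * (r * Q) := by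
    have h4 : B * t ^ 2 * (r⁻¹ * G) = B * G * (r * (t ^ 2 / r ^ 2)) := by field_simp
    rw [h4]
    gcongr
  have hlamC : C2 * (lam * (t ^ 2 / r ^ 2)) ≤ η / 2 * Q := by
    have h2 : C2 * lam ≤ η / 2 := by
      rw [hlam, mul_div_assoc', div_le_div_iff₀ (by positivity) (by norm_num)]
      nlinarith
    calc C2 * (lam * (t ^ 2 / r ^ 2)) = (C2 * lam) * (t ^ 2 / r ^ 2) := by ring
      _ ≤ η / 2 * Q := mul_le_mul h2 hQ1 hQ0 (by positivity)
  have hC3t : C3 * t ≤ C3 * (r * Q) := mul_le_mul_of_nonneg_left htr hC30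
  have hC2y : C2 * (χ * (r⁻¹ * t)) ≤ C2 * (χ / (4 * lam) + lam * (t ^ 2 / r ^ 2)) :=
    mul_le_mul_of_nonneg_left hyoung hC20
  have hC2χ : C2 * (χ / (4 * lam)) = C2 / (4 * lam) * χ := by ring
  have hpos1 : 0 ≤ C2 / (4 * lam) * (r * Q) := by positivity
  have hpos2 : 0 ≤ (C3 + B * G) * χ := by positivity
  linarith

theorem norm_fderiv_testField_le {n : ℕ} (a : E n) {T : Gr n} {u : E n} (hu : T.IsNormal u)
    {ψ : E n → ℝ} {β : ℝ → ℝ} (hψ : ContDiff ℝ ∞ ψ) (hβ : ContDiff ℝ ∞ β)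
    (Λ : (E n →L[ℝ] ℝ) →L[ℝ] E n) (v : E n) {Cψ Cβ : ℝ}
    (hCψ : ∀ y, |ψ y| ≤ Cψ ∧ ‖fderiv ℝ ψ y‖ ≤ Cψ ∧ ‖fderiv ℝ (fderiv ℝ ψ) y‖ ≤ Cψ)
    (hCβ : ∀ t, |β t| ≤ Cβ ∧ |deriv β t| ≤ Cβ) {r : ℝ} (hr : 0 < r) (hr1 : r ≤ 1) (x : E n) :
    ‖fderiv ℝ (testField a u ψ β Λ v r) x‖ ≤
      r⁻¹ * (Cψ * ‖v‖ + Cβ * (‖Λ‖ * Cψ) + Cβ * (‖Λ‖ * Cψ)) := by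
  rw [fderiv_testField a u hψ hβ Λ v hr]
  set y := r⁻¹ • (x - a) with hy
  set s := r⁻¹ * ⟪u, y⟫ with hs
  have hCψ0 : 0 ≤ Cψ := (abs_nonneg _).trans (hCψ 0).1
  have hCβ0 : 0 ≤ Cβ := (abs_nonneg _).trans (hCβ 0).1
  have hri : 1 ≤ r⁻¹ := (one_le_inv₀ hr).2 hr1
  have hri0 : 0 < r⁻¹ := inv_pos.2 hr
  have hΛl : ‖Λ (fderiv ℝ ψ y)‖ ≤ ‖Λ‖ * Cψ :=
    (Λ.le_opNorm _).trans (mul_le_mul_of_nonneg_left (hCψ y).2.1 (norm_nonneg _))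
  have hHn : ‖Λ ∘L fderiv ℝ (fderiv ℝ ψ) y‖ ≤ ‖Λ‖ * Cψ :=
    (ContinuousLinearMap.opNorm_comp_le _ _).trans
      (mul_le_mul_of_nonneg_left (hCψ y).2.2 (norm_nonneg _))
  have h1 : ‖r⁻¹ • (fderiv ℝ ψ y).smulRight v‖ ≤ r⁻¹ * (Cψ * ‖v‖) := by
    rw [norm_smul, ContinuousLinearMap.norm_smulRight_apply, Real.norm_of_nonneg hri0.le]
    gcongr
    exact (hCψ y).2.1
  have h2 : ‖(r⁻¹ * deriv β s) • (innerSL ℝ u).smulRight (Λ (fderiv ℝ ψ y))‖ ≤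
      r⁻¹ * Cβ * (1 * (‖Λ‖ * Cψ)) := by
    rw [norm_smul, ContinuousLinearMap.norm_smulRight_apply, norm_mul,
      Real.norm_of_nonneg hri0.le, innerSL_apply_norm, hu.2]
    gcongr
    exact (hCβ s).2
  have h3 : ‖β s • (Λ ∘L fderiv ℝ (fderiv ℝ ψ) y)‖ ≤ Cβ * (‖Λ‖ * Cψ) := by
    rw [norm_smul]
    gcongr
    exact (hCβ s).1
  have h4 : Cβ * (‖Λ‖ * Cψ) ≤ r⁻¹ * (Cβ * (‖Λ‖ * Cψ)) :=
    le_mul_of_one_le_left (by positivity) hri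
  refine norm_add₃_le.trans ?_
  linarith

theorem stressForm_fderiv_testField {n : ℕ} (φ : E n → ℝ) (a : E n) {T : Gr n} {u : E n}
    (hu : T.IsNormal u) {ψ : E n → ℝ} {β : ℝ → ℝ} (hψ : ContDiff ℝ ∞ ψ) (hβ : ContDiff ℝ ∞ β)
    {Λ : (E n →L[ℝ] ℝ) →L[ℝ] E n} {v : E n} (hΛT : ∀ l, Λ l ∈ T.carrier) {r : ℝ} (hr : 0 < r)
    (x : E n) :
    stressForm φ u (fderiv ℝ (testField a u ψ β Λ v r) x) =
      mainTerm φ u ψ β Λ v r (r⁻¹ • (x - a)) := by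
  rw [fderiv_testField a u hψ hβ Λ v hr, map_add, map_add, map_smul, map_smul, map_smul,
    stressForm_smulRight,
    stressForm_of_mem φ hu (L := Λ ∘L fderiv ℝ (fderiv ℝ ψ) (r⁻¹ • (x - a))) (fun x => hΛT _),
    stressForm_of_mem φ hu (L := (innerSL ℝ u).smulRight (Λ (fderiv ℝ ψ (r⁻¹ • (x - a)))))
      (fun x => T.carrier.smul_mem _ (hΛT _)), traceL_smulRight, innerSL_apply_apply,
    (hu.mem_iff _).1 (hΛT _), mainTerm, smul_eq_mul, smul_eq_mul, smul_eq_mul]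
  ring

theorem dStress_fderiv_testField {n : ℕ} {φ : E n → ℝ} (hφ : IsUniformlyConvexNorm φ) (a : E n)
    {T : Gr n} {u : E n} (hu : T.IsNormal u) {ψ : E n → ℝ} {β : ℝ → ℝ} (hψ : ContDiff ℝ ∞ ψ)
    (hβ : ContDiff ℝ ∞ β) {Λ : (E n →L[ℝ] ℝ) →L[ℝ] E n} {v : E n} (hΛT : ∀ l, Λ l ∈ T.carrier)
    (hΛ : ∀ w ∈ T.carrier, ∀ l : E n →L[ℝ] ℝ, dStress φ u w (l.smulRight v) = φ u * ⟪w, Λ l⟫)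
    {r : ℝ} (hr : 0 < r) (x : E n) {w : E n} (hw : w ∈ T.carrier) :
    dStress φ u w (fderiv ℝ (testField a u ψ β Λ v r) x) =
      r⁻¹ * (1 - deriv β (r⁻¹ * ⟪u, r⁻¹ • (x - a)⟫)) *
        (φ u * ⟪w, Λ (fderiv ℝ ψ (r⁻¹ • (x - a)))⟫) +
      β (r⁻¹ * ⟪u, r⁻¹ • (x - a)⟫) *
        dStress φ u w (Λ ∘L fderiv ℝ (fderiv ℝ ψ) (r⁻¹ • (x - a))) := by
  rw [fderiv_testField a u hψ hβ Λ v hr, map_add, map_add, map_smul, map_smul, map_smul,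
    hΛ w hw, dStress_innerSL_smulRight hφ hu (hΛT _), smul_eq_mul, smul_eq_mul, smul_eq_mul]
  ring

theorem abs_dStress_apply_le {n : ℕ} (φ : E n → ℝ) (u w : E n) (L : E n →L[ℝ] E n) :
    |dStress φ u w L| ≤ ‖dStress φ u‖ * ‖w‖ * ‖L‖ :=
  (dStress φ u).le_opNorm₂ w L

/-- At a plane `S` with tilt `t = ‖S - T‖` the stress of the test field is its main term, up to an
error which is either a small multiple of `1 + t² / r²` or of higher order. The linear
terms in the tilt cancel except where the height is truncated. -/
theorem exists_abs_stress_testField_sub_le {n : ℕ} {φ : E n → ℝ} (hφ : IsUniformlyConvexNorm φ)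
    {T : Gr n} {u : E n} (hu : T.IsNormal u) {ψ : E n → ℝ} {β : ℝ → ℝ} (hψ : ContDiff ℝ ∞ ψ)
    (hψs : tsupport ψ ⊆ Metric.closedBall 0 1) (hβ : ContDiff ℝ ∞ β) (hβs : HasCompactSupport β)
    {Λ : (E n →L[ℝ] ℝ) →L[ℝ] E n} {v : E n} (hΛT : ∀ l, Λ l ∈ T.carrier)
    (hΛ : ∀ w ∈ T.carrier, ∀ l : E n →L[ℝ] ℝ, dStress φ u w (l.smulRight v) = φ u * ⟪w, Λ l⟫)
    {η : ℝ} (hη : 0 < η) :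
    ∃ C, 0 ≤ C ∧ ∀ (a : E n) (r : ℝ), 0 < r → r ≤ 1 → ∀ (x : E n) (S : Gr n),
      |stress (integrand φ) S (fderiv ℝ (testField a u ψ β Λ v r) x) -
          mainTerm φ u ψ β Λ v r (r⁻¹ • (x - a))| ≤
        η * (1 + ‖S.proj - T.proj‖ ^ 2 / r ^ 2) +
        C * (truncError β (r⁻¹ * ⟪u, r⁻¹ • (x - a)⟫) +
          r * (1 + ‖S.proj - T.proj‖ ^ 2 / r ^ 2)) := by
  obtain ⟨Cψ, hCψ0, hCψ⟩ := exists_norm_fderiv_le hψ hψs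
  obtain ⟨Cβ, hCβ0, hCβ⟩ := exists_abs_deriv_le hβ hβs
  have hφu := hφ.pos u hu.ne_zero
  set G := Cψ * ‖v‖ + Cβ * (‖Λ‖ * Cψ) + Cβ * (‖Λ‖ * Cψ) with hG
  have hG0 : 0 ≤ G := by positivity
  set C2 := φ u * (1 + Cβ) * (2 * (‖Λ‖ * Cψ)) with hC2
  have hC20 : 0 ≤ C2 := by positivity
  set C3 := Cβ * (‖dStress φ u‖ * 2 * (‖Λ‖ * Cψ)) with hC3
  have hC30 : 0 ≤ C3 := by positivity
  obtain ⟨B, hB0, hB⟩ := exists_stress_taylor hφ hu (ε := η / (2 * (G + 1))) (by positivity)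
  refine ⟨C2 / (4 * (η / (2 * (C2 + 1)))) + C3 + B * G, by positivity, fun a r hr hr1 x S => ?_⟩
  obtain ⟨w, hwT, hw, hrem⟩ := hB S
  have hrem := hrem (fderiv ℝ (testField a u ψ β Λ v r) x)
  have hLn := norm_fderiv_testField_le a hu hψ hβ Λ v hCψ hCβ hr hr1 x
  rw [← hG] at hLn
  rw [stressForm_fderiv_testField φ a hu hψ hβ hΛT hr x,
    dStress_fderiv_testField hφ a hu hψ hβ hΛT hΛ hr x hwT] at hrem
  set t := ‖S.proj - T.proj‖ with ht
  have ht0 : 0 ≤ t := norm_nonneg _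
  set y := r⁻¹ • (x - a) with hy
  set s := r⁻¹ * ⟪u, y⟫ with hs
  set χ := truncError β s with hχ
  have hri0 : 0 < r⁻¹ := inv_pos.2 hr
  have hA : |r⁻¹ * (1 - deriv β s) * (φ u * ⟪w, Λ (fderiv ℝ ψ y)⟫)| ≤ C2 * (χ * (r⁻¹ * t)) := by
    have hΛl : ‖Λ (fderiv ℝ ψ y)‖ ≤ ‖Λ‖ * Cψ :=
      (Λ.le_opNorm _).trans (mul_le_mul_of_nonneg_left (hCψ y).2.1 (norm_nonneg _))
    have h1 : |⟪w, Λ (fderiv ℝ ψ y)⟫| ≤ (2 * t) * (‖Λ‖ * Cψ) :=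
      (abs_real_inner_le_norm _ _).trans (mul_le_mul hw hΛl (norm_nonneg _) (by positivity))
    have h2 : |1 - deriv β s| ≤ (1 + Cβ) * χ := abs_one_sub_deriv_le (fun t => (hCβ t).2) s
    rw [abs_mul, abs_mul, abs_mul, abs_of_pos hri0, abs_of_pos hφu]
    calc r⁻¹ * |1 - deriv β s| * (φ u * |⟪w, Λ (fderiv ℝ ψ y)⟫|)
        ≤ r⁻¹ * ((1 + Cβ) * χ) * (φ u * ((2 * t) * (‖Λ‖ * Cψ))) := by
          have h0 : 0 ≤ (1 + Cβ) * χ := (abs_nonneg _).trans h2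
          exact mul_le_mul (mul_le_mul_of_nonneg_left h2 hri0.le)
            (mul_le_mul_of_nonneg_left h1 hφu.le) (by positivity) (by positivity)
      _ = C2 * (χ * (r⁻¹ * t)) := by rw [hC2]; ring
  have hBd : |β s * dStress φ u w (Λ ∘L fderiv ℝ (fderiv ℝ ψ) y)| ≤ C3 * t := by
    have hHn : ‖Λ ∘L fderiv ℝ (fderiv ℝ ψ) y‖ ≤ ‖Λ‖ * Cψ :=
      (ContinuousLinearMap.opNorm_comp_le _ _).trans
        (mul_le_mul_of_nonneg_left (hCψ y).2.2 (norm_nonneg _))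
    have h1 := abs_dStress_apply_le φ u w (Λ ∘L fderiv ℝ (fderiv ℝ ψ) y)
    have h2 : ‖dStress φ u‖ * ‖w‖ * ‖Λ ∘L fderiv ℝ (fderiv ℝ ψ) y‖ ≤
        ‖dStress φ u‖ * (2 * t) * (‖Λ‖ * Cψ) := by gcongr
    rw [abs_mul]
    calc |β s| * |dStress φ u w (Λ ∘L fderiv ℝ (fderiv ℝ ψ) y)|
        ≤ Cβ * (‖dStress φ u‖ * (2 * t) * (‖Λ‖ * Cψ)) :=
          mul_le_mul (hCβ s).1 (h1.trans h2) (abs_nonneg _) hCβ0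
      _ = C3 * t := by rw [hC3]; ring
  have hR := mul_le_mul_of_nonneg_left hLn
    (show 0 ≤ η / (2 * (G + 1)) * t + B * t ^ 2 by positivity)
  have hfin := error_terms_le hη hG0 hC20 hC30 hB0 ht0 hr (truncError_nonneg β s)
    (truncError_le_one β s)
  rw [← hχ] at hfin
  rw [abs_le] at hrem hA hBd ⊢
  constructor <;> linarith

/-! ### Integration over small balls -/

instance (n : ℕ) : SecondCountableTopology (Gr n) :=
  TopologicalSpace.secondCountableTopology_induced _ _ Gr.proj

theorem Gr.continuous_proj {n : ℕ} : Continuous (Gr.proj (n := n)) := continuous_induced_dom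

theorem Gr.continuous_norm_proj_sub {n : ℕ} (T : Gr n) :
    Continuous fun S : Gr n => ‖S.proj - T.proj‖ :=
  (Gr.continuous_proj.sub continuous_const).norm

theorem weight_apply {n : ℕ} (W : Measure (E n × Gr n)) {A : Set (E n)} (hA : MeasurableSet A) :
    weight W A = W (A ×ˢ univ) := by
  rw [weight, Measure.map_apply measurable_fst hA]
  congr 1
  ext p
  simp

/-- The cylinder of planes over a closed ball. -/
def cyl {n : ℕ} (a : E n) (r : ℝ) : Set (E n × Gr n) := Metric.closedBall a r ×ˢ univ

theorem measurableSet_cyl {n : ℕ} (a : E n) (r : ℝ) : MeasurableSet (cyl a r) :=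
  Metric.isClosed_closedBall.measurableSet.prod MeasurableSet.univ

theorem measureReal_cyl {n : ℕ} (W : Measure (E n × Gr n)) (a : E n) (r : ℝ) :
    W.real (cyl a r) = (weight W).real (Metric.closedBall a r) := by
  rw [Measure.real, Measure.real, weight_apply W Metric.isClosed_closedBall.measurableSet]
  rfl

theorem measure_cyl {n : ℕ} (W : Measure (E n × Gr n)) (a : E n) (r : ℝ) :
    W (cyl a r) = weight W (Metric.closedBall a r) :=
  (weight_apply W Metric.isClosed_closedBall.measurableSet).symm

theorem integrableOn_cyl_of_continuous {n : ℕ} {W : Measure (E n × Gr n)} {a : E n} {r : ℝ}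
    (hW : weight W (Metric.closedBall a r) < ⊤) {f : E n × Gr n → ℝ} (hf : Continuous f) {C : ℝ}
    (hC : ∀ p, |f p| ≤ C) : IntegrableOn f (cyl a r) W := by
  have : IsFiniteMeasure (W.restrict (cyl a r)) := ⟨by
    rw [Measure.restrict_apply_univ, measure_cyl]
    exact hW⟩
  exact Integrable.of_bound hf.measurable.aestronglyMeasurable C (Eventually.of_forall hC)

theorem integrable_of_integrableOn_cyl {n : ℕ} {W : Measure (E n × Gr n)} {a : E n} {r : ℝ}
    {f : E n × Gr n → ℝ} (hf : IntegrableOn f (cyl a r) W) (h0 : ∀ p ∉ cyl a r, f p = 0) :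
    Integrable f W := by
  rw [← integrable_indicator_iff (measurableSet_cyl a r)] at hf
  refine hf.congr (Eventually.of_forall fun p => ?_)
  by_cases hp : p ∈ cyl a r
  · rw [indicator_of_mem hp]
  · rw [indicator_of_notMem hp, h0 p hp]

theorem abs_integral_le_setIntegral {n : ℕ} {W : Measure (E n × Gr n)} {a : E n} {r : ℝ}
    {f b : E n × Gr n → ℝ} (h0 : ∀ p ∉ cyl a r, f p = 0) (hb : IntegrableOn b (cyl a r) W)
    (hfb : ∀ p ∈ cyl a r, |f p| ≤ b p) : |∫ p, f p ∂W| ≤ ∫ p in cyl a r, b p ∂W := by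
  rw [← setIntegral_eq_integral_of_forall_compl_eq_zero h0]
  have h : ∀ p ∈ cyl a r, ‖f p‖ ≤ b p := hfb
  exact norm_integral_le_of_norm_le hb (ae_restrict_of_forall_mem (measurableSet_cyl a r) h)

/-- The quadratic tilt-excess as a real number. -/
noncomputable def tilt {n : ℕ} (W : Measure (E n × Gr n)) (a : E n) (r : ℝ) (T : Gr n) : ℝ :=
  ∫ p in cyl a r, ‖p.2.proj - T.proj‖ ^ 2 ∂W

theorem continuous_tilt_integrand {n : ℕ} (T : Gr n) :
    Continuous fun p : E n × Gr n => ‖p.2.proj - T.proj‖ ^ 2 :=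
  ((Gr.continuous_norm_proj_sub T).comp continuous_snd).pow 2

theorem integrableOn_tilt {n : ℕ} {W : Measure (E n × Gr n)} {a : E n} {r : ℝ}
    (hW : weight W (Metric.closedBall a r) < ⊤) (T : Gr n) :
    IntegrableOn (fun p : E n × Gr n => ‖p.2.proj - T.proj‖ ^ 2) (cyl a r) W := by
  refine integrableOn_cyl_of_continuous hW (continuous_tilt_integrand T) (C := 4) fun p => ?_
  rw [abs_of_nonneg (by positivity)]
  nlinarith [p.2.norm_proj_sub_le T, norm_nonneg (p.2.proj - T.proj)]

theorem tilt_eq_toReal {n : ℕ} (W : Measure (E n × Gr n)) (a : E n) (r : ℝ) (T : Gr n) :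
    tilt W a r T = (tiltExcess W a r T).toReal := by
  rw [tilt, tiltExcess, integral_eq_lintegral_of_nonneg_ae]
  · rfl
  · exact Eventually.of_forall fun p => by positivity
  · exact (continuous_tilt_integrand T).measurable.aestronglyMeasurable

theorem tilt_nonneg {n : ℕ} (W : Measure (E n × Gr n)) (a : E n) (r : ℝ) (T : Gr n) :
    0 ≤ tilt W a r T := by
  rw [tilt_eq_toReal]
  exact ENNReal.toReal_nonneg

/-- The plane `T` is, to second order, the tangent plane of `W` at `a`: the mass ratios of `W` at
`a` are bounded, most of `W` lies on `M`, and the tilt-excess decays like that of a surface of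
class `C²`. -/
structure IsSecondOrderPoint {n : ℕ} (W : Measure (E n × Gr n)) (M : Set (E n)) (a : E n)
    (T : Gr n) : Prop where
  finite : ∃ ρ > 0, weight W (Metric.closedBall a ρ) < ⊤
  growth : (fun r => (weight W).real (Metric.closedBall a r)) =O[𝓝[>] 0] fun r => r ^ n
  tilt : (fun r => tilt W a r T) =O[𝓝[>] 0] fun r => r ^ (n + 2)
  off : (fun r => (weight W).real (Metric.closedBall a r \ M)) =o[𝓝[>] 0] fun r => r ^ n

/-- The measure of a ball and the scaled tilt-excess, the two quantities of order `r ^ n`. -/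
theorem IsSecondOrderPoint.isBigO {n : ℕ} {W : Measure (E n × Gr n)} {M : Set (E n)} {a : E n}
    {T : Gr n} (hW : IsSecondOrderPoint W M a T) :
    (fun r => (weight W).real (Metric.closedBall a r) + AnisotropicVarifold.tilt W a r T / r ^ 2)
      =O[𝓝[>] 0] fun r => r ^ n := by
  refine hW.growth.add ?_
  have h1 : (fun r : ℝ => (r ^ 2)⁻¹) =O[𝓝[>] 0] fun r : ℝ => (r ^ 2)⁻¹ := isBigO_refl _ _
  refine ((hW.tilt.mul h1).congr' ?_ ?_)
  · exact Eventually.of_forall fun r => (div_eq_mul_inv _ _).symm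
  · filter_upwards [self_mem_nhdsWithin] with r hr
    have : r ≠ 0 := ne_of_gt hr
    field_simp
    ring

theorem eventually_small {n : ℕ} {W : Measure (E n × Gr n)} {M : Set (E n)} {a : E n}
    {T : Gr n} (hW : IsSecondOrderPoint W M a T) :
    ∀ᶠ r : ℝ in 𝓝[>] 0, 0 < r ∧ r ≤ 1 ∧ weight W (Metric.closedBall a r) < ⊤ := by
  obtain ⟨ρ, hρ, hfin⟩ := hW.finite
  filter_upwards [self_mem_nhdsWithin, Ioc_mem_nhdsGT (zero_lt_one' ℝ), Ioc_mem_nhdsGT hρ]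
    with r h1 h2 h3
  exact ⟨h1, h2.2, (measure_mono (Metric.closedBall_subset_closedBall h3.2)).trans_lt hfin⟩

theorem setIntegral_one_add_tilt {n : ℕ} {W : Measure (E n × Gr n)} {a : E n} {r : ℝ}
    (hW : weight W (Metric.closedBall a r) < ⊤) (T : Gr n) :
    IntegrableOn (fun p : E n × Gr n => 1 + ‖p.2.proj - T.proj‖ ^ 2 / r ^ 2) (cyl a r) W ∧
    ∫ p in cyl a r, (1 + ‖p.2.proj - T.proj‖ ^ 2 / r ^ 2) ∂W =
      (weight W).real (Metric.closedBall a r) + tilt W a r T / r ^ 2 := by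
  have h1 : IntegrableOn (fun _ : E n × Gr n => (1 : ℝ)) (cyl a r) W :=
    integrableOn_cyl_of_continuous hW continuous_const (C := 1) fun p => by simp
  have h2 := (integrableOn_tilt hW T).div_const (r ^ 2)
  refine ⟨h1.add h2, ?_⟩
  rw [integral_add h1 h2, integral_div, setIntegral_const, smul_eq_mul, mul_one, measureReal_cyl]
  rfl

theorem abs_stress_le {n : ℕ} {φ : E n → ℝ} (hφ : IsUniformlyConvexNorm φ) :
    ∃ C, 0 ≤ C ∧ ∀ (S : Gr n) (L : E n →L[ℝ] E n), |stress (integrand φ) S L| ≤ C * ‖L‖ := by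
  obtain ⟨C, hC0, hC⟩ := exists_norm_stressForm_le hφ
  refine ⟨C, hC0, fun S L => ?_⟩
  rw [stress_eq_stressForm hφ S.isNormal_unitNormal]
  exact ((stressForm φ S.unitNormal).le_opNorm L).trans
    (mul_le_mul_of_nonneg_right (hC _ S.isNormal_unitNormal.2) (norm_nonneg _))

theorem continuous_stress_fderiv {n : ℕ} {φ : E n → ℝ} (hφ : IsUniformlyConvexNorm φ)
    {g : E n → E n} (hg : ContDiff ℝ ∞ g) :
    Continuous fun p : E n × Gr n => stress (integrand φ) p.2 (fderiv ℝ g p.1) := by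
  obtain ⟨G, hG, h⟩ := exists_continuous_stress hφ
  simp only [h]
  exact (hG.comp continuous_snd).clm_apply ((hg.continuous_fderiv (by simp)).comp continuous_fst)

theorem continuous_mainTerm {n : ℕ} (φ : E n → ℝ) (u : E n) {ψ : E n → ℝ} {β : ℝ → ℝ}
    (hψ : ContDiff ℝ ∞ ψ) (hβ : ContDiff ℝ ∞ β) (Λ : (E n →L[ℝ] ℝ) →L[ℝ] E n) (v : E n) (r : ℝ) :
    Continuous (mainTerm φ u ψ β Λ v r) := by
  have hψ' : ContDiff ℝ ∞ (fderiv ℝ ψ) := hψ.fderiv_right (by simp)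
  have h1 := hψ.continuous_fderiv (by simp)
  have h2 := hψ'.continuous_fderiv (by simp)
  have h3 : Continuous fun y => Λ ∘L fderiv ℝ (fderiv ℝ ψ) y := continuous_const.clm_comp h2
  have h4 : Continuous fun y : E n => β (r⁻¹ * ⟪u, y⟫) :=
    hβ.continuous.comp (continuous_const.mul (continuous_const.inner continuous_id))
  exact (continuous_const.mul (h1.clm_apply continuous_const)).add
    ((continuous_const.mul h4).mul ((traceL n).continuous.comp h3))

theorem continuous_rescale {n : ℕ} (a : E n) (r : ℝ) : Continuous fun x : E n => r⁻¹ • (x - a) := by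
  fun_prop

/-- The height truncated by the test field is not truncated at points of `M` near `a`. -/
def IsAdmissibleCutoff {n : ℕ} (β : ℝ → ℝ) (M : Set (E n)) (a u : E n) : Prop :=
  ∀ᶠ r : ℝ in 𝓝[>] 0, ∀ x ∈ Metric.closedBall a r ∩ M, deriv β (r⁻¹ * ⟪u, r⁻¹ • (x - a)⟫) = 1

theorem integral_weight_eq {n : ℕ} (W : Measure (E n × Gr n)) {f : E n → ℝ} (hf : Continuous f) :
    ∫ x, f x ∂(weight W) = ∫ p, f p.1 ∂W :=
  integral_map measurable_fst.aemeasurable hf.aestronglyMeasurable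

/-- Asymptotics of the first variation on the test fields. -/
theorem firstVariation_testField_isLittleO {n : ℕ} {φ : E n → ℝ} (hφ : IsUniformlyConvexNorm φ)
    {W : Measure (E n × Gr n)} {M : Set (E n)} (hM : MeasurableSet M) {a : E n} {T : Gr n}
    (hW : IsSecondOrderPoint W M a T) {u : E n} (hu : T.IsNormal u) {ψ : E n → ℝ} {β : ℝ → ℝ}
    (hψ : ContDiff ℝ ∞ ψ) (hψs : tsupport ψ ⊆ Metric.closedBall 0 1) (hβ : ContDiff ℝ ∞ β)
    (hβs : HasCompactSupport β) (hβM : IsAdmissibleCutoff β M a u)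
    {Λ : (E n →L[ℝ] ℝ) →L[ℝ] E n} {v : E n} (hΛT : ∀ l, Λ l ∈ T.carrier)
    (hΛ : ∀ w ∈ T.carrier, ∀ l : E n →L[ℝ] ℝ, dStress φ u w (l.smulRight v) = φ u * ⟪w, Λ l⟫) :
    (fun r => firstVariation (integrand φ) W (testField a u ψ β Λ v r) -
      ∫ x, mainTerm φ u ψ β Λ v r (r⁻¹ • (x - a)) ∂(weight W)) =o[𝓝[>] 0] fun r => r ^ n := by
  rw [isLittleO_iff]
  intro c hc
  obtain ⟨A, hA0, hA⟩ := hW.isBigO.exists_pos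
  set η := c / (4 * A) with hη
  have hη0 : 0 < η := by positivity
  obtain ⟨C, hC0, hC⟩ :=
    exists_abs_stress_testField_sub_le hφ hu hψ hψs hβ hβs hΛT hΛ hη0
  obtain ⟨Cs, hCs0, hCs⟩ := abs_stress_le hφ
  have hoff := hW.off.def (c := c / (4 * (C + 1))) (by positivity)
  have hrsmall : ∀ᶠ r : ℝ in 𝓝[>] 0, C * r * A ≤ c / 4 := by
    have h1 : Tendsto (fun r : ℝ => C * r * A) (𝓝 0) (𝓝 (C * 0 * A)) :=
      (tendsto_id.const_mul C).mul_const A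
    rw [mul_zero, zero_mul] at h1
    exact (h1.mono_left nhdsWithin_le_nhds).eventually (ge_mem_nhds (by positivity))
  filter_upwards [hA.bound, hoff, hrsmall, eventually_small hW, hβM] with r hAr hoffr hrs hr hβr
  obtain ⟨hr0, hr1, hfin⟩ := hr
  have hrn : 0 < r ^ n := by positivity
  rw [Real.norm_of_nonneg hrn.le] at hAr hoffr ⊢
  have htilt := tilt_nonneg W a r T
  rw [Real.norm_of_nonneg (by positivity)] at hAr hoffr
  set g := testField a u ψ β Λ v r with hg
  set N := fun x : E n => mainTerm φ u ψ β Λ v r (r⁻¹ • (x - a)) with hN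
  have hNc : Continuous N := (continuous_mainTerm φ u hψ hβ Λ v r).comp (continuous_rescale a r)
  have hgt : IsTestField univ g :=
    isTestField_testField a u hψ hβ hψs Λ v hr0 (subset_univ _)
  -- both integrands vanish outside the cylinder
  have hN0 : ∀ x ∉ Metric.closedBall a r, N x = 0 := fun x hx =>
    mainTerm_eq_zero φ u β hψs Λ v r (one_lt_norm_of_notMem_closedBall hr0 hx)
  have hDg0 : ∀ x ∉ Metric.closedBall a r, fderiv ℝ g x = 0 := by
    intro x hx
    have hy := one_lt_norm_of_notMem_closedBall hr0 hx
    rw [hg, fderiv_testField a u hψ hβ Λ v hr0, fderiv_eq_zero_of_one_lt hψs hy,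
      fderiv_fderiv_eq_zero_of_one_lt hψs hy]
    ext; simp
  have hcyl : ∀ p : E n × Gr n, p ∉ cyl a r → p.1 ∉ Metric.closedBall a r := fun p hp h =>
    hp ⟨h, mem_univ _⟩
  obtain ⟨CN, hCN⟩ : ∃ C, ∀ x, ‖N x‖ ≤ C := by
    have : HasCompactSupport N :=
      HasCompactSupport.of_support_subset_isCompact (isCompact_closedBall a r) fun x hx => by
        by_contra h
        exact hx (hN0 x h)
    exact this.exists_bound_of_continuous hNc
  obtain ⟨CD, hCD⟩ := (hgt.hasCompactSupport.fderiv ℝ).exists_bound_of_continuous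
    (hgt.contDiff.continuous_fderiv (by simp))
  have hi1 : Integrable (fun p : E n × Gr n => stress (integrand φ) p.2 (fderiv ℝ g p.1)) W := by
    refine integrable_of_integrableOn_cyl (a := a) (r := r)
      (integrableOn_cyl_of_continuous hfin (continuous_stress_fderiv hφ hgt.contDiff)
        (C := Cs * CD) fun p => ?_) fun p hp => ?_
    · exact (hCs _ _).trans (mul_le_mul_of_nonneg_left (hCD _) hCs0)
    · rw [hDg0 _ (hcyl p hp)]
      have := hCs p.2 (0 : E n →L[ℝ] E n)
      rw [norm_zero, mul_zero] at this
      exact abs_nonpos_iff.1 this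
  have hi2 : Integrable (fun p : E n × Gr n => N p.1) W :=
    integrable_of_integrableOn_cyl (a := a) (r := r)
      (integrableOn_cyl_of_continuous hfin (hNc.comp continuous_fst) (C := CN) fun p => hCN p.1)
      fun p hp => hN0 _ (hcyl p hp)
  have hdiff : firstVariation (integrand φ) W g - ∫ x, N x ∂(weight W) =
      ∫ p, (stress (integrand φ) p.2 (fderiv ℝ g p.1) - N p.1) ∂W := by
    rw [integral_weight_eq W hNc, integral_sub hi1 hi2]
    rfl
  obtain ⟨hti, hte⟩ := setIntegral_one_add_tilt hfin T
  set D : Set (E n × Gr n) := (Metric.closedBall a r \ M) ×ˢ univ with hD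
  have hDm : MeasurableSet D :=
    (Metric.isClosed_closedBall.measurableSet.diff hM).prod MeasurableSet.univ
  have hDW : W.real D = (weight W).real (Metric.closedBall a r \ M) := by
    rw [Measure.real, Measure.real,
      weight_apply W (Metric.isClosed_closedBall.measurableSet.diff hM)]
  have hDfin : IntegrableOn (D.indicator fun _ => (1 : ℝ)) (cyl a r) W := by
    have h1 : IntegrableOn (fun _ : E n × Gr n => (1 : ℝ)) (cyl a r) W :=
      integrableOn_cyl_of_continuous hfin continuous_const (C := 1) fun p => by simp
    exact h1.indicator hDm
  have hDint : ∫ p in cyl a r, D.indicator (fun _ => (1 : ℝ)) p ∂W =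
      (weight W).real (Metric.closedBall a r \ M) := by
    rw [setIntegral_indicator hDm, setIntegral_const, smul_eq_mul, mul_one, ← hDW]
    congr 1
    exact inter_eq_self_of_subset_right (prod_mono sdiff_subset subset_rfl)
  have hbint : IntegrableOn (fun p : E n × Gr n =>
      (η + C * r) * (1 + ‖p.2.proj - T.proj‖ ^ 2 / r ^ 2) + C * D.indicator (fun _ => (1 : ℝ)) p)
      (cyl a r) W := (hti.const_mul _).add (hDfin.const_mul _)
  have hbound := abs_integral_le_setIntegral (W := W) (a := a) (r := r)
    (f := fun p => stress (integrand φ) p.2 (fderiv ℝ g p.1) - N p.1) (fun p hp => by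
      rw [hDg0 _ (hcyl p hp), hN0 _ (hcyl p hp)]
      have := hCs p.2 (0 : E n →L[ℝ] E n)
      rw [norm_zero, mul_zero] at this
      rw [abs_nonpos_iff.1 this, sub_zero]) hbint (fun p hp => by
      refine (hC a r hr0 hr1 p.1 p.2).trans ?_
      have hχ : truncError β (r⁻¹ * ⟪u, r⁻¹ • (p.1 - a)⟫) ≤ D.indicator (fun _ => (1 : ℝ)) p := by
        by_cases hpM : p.1 ∈ M
        · rw [truncError, if_pos (hβr p.1 ⟨hp.1, hpM⟩)]
          exact indicator_nonneg (fun _ _ => zero_le_one) _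
        · rw [indicator_of_mem (show p ∈ D from ⟨⟨hp.1, hpM⟩, mem_univ _⟩)]
          exact truncError_le_one _ _
      have := mul_le_mul_of_nonneg_left hχ hC0
      linarith)
  rw [integral_add (hti.const_mul _) (hDfin.const_mul _), integral_const_mul, integral_const_mul,
    hte, hDint, ← hdiff] at hbound
  rw [Real.norm_eq_abs]
  refine hbound.trans ?_
  have h1 : (η + C * r) * ((weight W).real (Metric.closedBall a r) + tilt W a r T / r ^ 2) ≤
      (η + C * r) * (A * r ^ n) := by gcongr
  have h2 : (η + C * r) * (A * r ^ n) = (c / 4 + C * r * A) * r ^ n := by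
    rw [hη]
    field_simp
  have h3 : C * (weight W).real (Metric.closedBall a r \ M) ≤ c / 4 * r ^ n := by
    calc C * (weight W).real (Metric.closedBall a r \ M)
        ≤ (C + 1) * (c / (4 * (C + 1)) * r ^ n) := by
          refine mul_le_mul (by linarith) hoffr (by positivity) (by positivity)
      _ = c / 4 * r ^ n := by field_simp
  have h4 : C * r * A * r ^ n ≤ c / 4 * r ^ n := by gcongr
  nlinarith [mul_pos hc hrn]

theorem weight_energy {n : ℕ} {φ : E n → ℝ} (hφ : IsUniformlyConvexNorm φ)
    (W : Measure (E n × Gr n)) {h g : E n → E n} (hh : AEStronglyMeasurable h (weight W))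
    (hg : Continuous g) :
    ∫ x, ⟪h x, g x⟫ ∂(weight (energy (integrand φ) W)) =
      ∫ p, integrand φ p.2 * ⟪h p.1, g p.1⟫ ∂W := by
  have hac : weight (energy (integrand φ) W) ≪ weight W :=
    (withDensity_absolutelyContinuous _ _).map measurable_fst
  have hm : AEStronglyMeasurable (fun x => ⟪h x, g x⟫) (weight (energy (integrand φ) W)) :=
    (hh.mono_ac hac).inner hg.aestronglyMeasurable
  have hF : Measurable fun p : E n × Gr n => integrand φ p.2 :=
    (continuous_integrand hφ).measurable.comp measurable_snd
  rw [weight, integral_map measurable_fst.aemeasurable hm, energy]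
  have hnn : (fun p : E n × Gr n => ENNReal.ofReal (integrand φ p.2)) =
      fun p => ((Real.toNNReal (integrand φ p.2) : NNReal) : ℝ≥0∞) := rfl
  rw [hnn, integral_withDensity_eq_integral_smul hF.real_toNNReal]
  refine integral_congr_ae (Eventually.of_forall fun p => ?_)
  simp only [NNReal.smul_def, smul_eq_mul]
  rw [Real.coe_toNNReal _ (hφ.integrand_pos p.2).le]

theorem exists_abs_testField_sub_le {n : ℕ} (u : E n) {ψ : E n → ℝ} {β : ℝ → ℝ}
    (hψ : ContDiff ℝ ∞ ψ) (hψs : tsupport ψ ⊆ Metric.closedBall 0 1) (hβ : ContDiff ℝ ∞ β)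
    (hβs : HasCompactSupport β) (Λ : (E n →L[ℝ] ℝ) →L[ℝ] E n) (v : E n) :
    ∃ C, 0 ≤ C ∧ ∀ (a : E n) (r : ℝ), 0 < r → r ≤ 1 → ∀ x,
      ‖testField a u ψ β Λ v r x - ψ (r⁻¹ • (x - a)) • v‖ ≤ C * r ∧
      ‖testField a u ψ β Λ v r x‖ ≤ C := by
  obtain ⟨Cψ, hCψ0, hCψ⟩ := exists_norm_fderiv_le hψ hψs
  obtain ⟨Cβ, hCβ0, hCβ⟩ := exists_abs_deriv_le hβ hβs
  refine ⟨Cβ * (‖Λ‖ * Cψ) + Cψ * ‖v‖, by positivity, fun a r hr hr1 x => ?_⟩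
  set y := r⁻¹ • (x - a) with hy
  have h1 : ‖testField a u ψ β Λ v r x - ψ y • v‖ ≤ r * (Cβ * (‖Λ‖ * Cψ)) := by
    rw [testField, add_sub_cancel_left, norm_smul, norm_mul, Real.norm_of_nonneg hr.le, mul_assoc]
    have h2 : ‖Λ (fderiv ℝ ψ y)‖ ≤ ‖Λ‖ * Cψ :=
      (Λ.le_opNorm _).trans (mul_le_mul_of_nonneg_left (hCψ y).2.1 (norm_nonneg _))
    exact mul_le_mul_of_nonneg_left (mul_le_mul (hCβ _).1 h2 (norm_nonneg _) hCβ0) hr.le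
  have h3 : ‖ψ y • v‖ ≤ Cψ * ‖v‖ := by
    rw [norm_smul]
    exact mul_le_mul_of_nonneg_right (hCψ y).1 (norm_nonneg _)
  have h4 : 0 ≤ Cβ * (‖Λ‖ * Cψ) := by positivity
  have h5 : 0 ≤ r * (Cψ * ‖v‖) := by positivity
  constructor
  · nlinarith
  · have h6 := norm_add_le (testField a u ψ β Λ v r x - ψ y • v) (ψ y • v)
    rw [sub_add_cancel] at h6
    nlinarith

/-- Asymptotics of the mean curvature term on the test fields. -/
theorem integral_inner_testField_isLittleO {n : ℕ} {φ : E n → ℝ} (hφ : IsUniformlyConvexNorm φ)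
    {W : Measure (E n × Gr n)} {M : Set (E n)} {a : E n} {T : Gr n}
    (hW : IsSecondOrderPoint W M a T) {u : E n} {ψ : E n → ℝ} {β : ℝ → ℝ}
    (hψ : ContDiff ℝ ∞ ψ) (hψs : tsupport ψ ⊆ Metric.closedBall 0 1) (hβ : ContDiff ℝ ∞ β)
    (hβs : HasCompactSupport β) (Λ : (E n →L[ℝ] ℝ) →L[ℝ] E n) (v : E n) {h : E n → E n}
    (hh : AEStronglyMeasurable h (weight W))
    (hint : ∃ ρ > 0, IntegrableOn h (Metric.closedBall a ρ) (weight W))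
    (hleb : (fun r => ∫ x in Metric.closedBall a r, ‖h x - h a‖ ∂(weight W))
      =o[𝓝[>] 0] fun r => r ^ n) :
    (fun r => ∫ x, ⟪h x, testField a u ψ β Λ v r x⟫ ∂(weight (energy (integrand φ) W)) -
      integrand φ T * ⟪h a, v⟫ * ∫ x, ψ (r⁻¹ • (x - a)) ∂(weight W)) =o[𝓝[>] 0]
        fun r => r ^ n := by
  obtain ⟨Cψ, hCψ0, hCψ⟩ := exists_norm_fderiv_le hψ hψs
  obtain ⟨Cg, hCg0, hCg⟩ := exists_abs_testField_sub_le u hψ hψs hβ hβs Λ v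
  obtain ⟨CF, hCF0, hCF⟩ := hφ.exists_abs_integrand_sub_le
  set F0 := integrand φ T with hF0
  have hF0pos : 0 < F0 := hφ.integrand_pos T
  set Fm := F0 + CF * 2 with hFm
  have hFm0 : 0 ≤ Fm := by positivity
  have hFle : ∀ S : Gr n, |integrand φ S| ≤ Fm := by
    intro S
    have h1 := hCF S T
    have h2 := S.norm_proj_sub_le T
    have h3 : CF * ‖S.proj - T.proj‖ ≤ CF * 2 := by gcongr
    have h4 := (abs_le.1 (h1.trans h3)).2
    rw [abs_of_pos (hφ.integrand_pos S)]
    linarith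
  set C1 := Fm * ‖h a‖ * Cg + CF * ‖h a‖ * ‖v‖ * Cψ with hC1
  have hC10 : 0 ≤ C1 := by positivity
  rw [isLittleO_iff]
  intro c hc
  obtain ⟨A, hA0, hA⟩ := hW.isBigO.exists_pos
  have hl := hleb.def (c := c / (2 * (Fm * Cg + 1))) (by positivity)
  have hrsmall : ∀ᶠ r : ℝ in 𝓝[>] 0, C1 * r * A ≤ c / 2 := by
    have h1 : Tendsto (fun r : ℝ => C1 * r * A) (𝓝 0) (𝓝 (C1 * 0 * A)) :=
      (tendsto_id.const_mul C1).mul_const A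
    rw [mul_zero, zero_mul] at h1
    exact (h1.mono_left nhdsWithin_le_nhds).eventually (ge_mem_nhds (by positivity))
  obtain ⟨ρ, hρ, hintρ⟩ := hint
  filter_upwards [hA.bound, hl, hrsmall, eventually_small hW, Ioc_mem_nhdsGT hρ]
    with r hAr hlr hrs hr hrρ
  obtain ⟨hr0, hr1, hfin⟩ := hr
  have hrn : 0 < r ^ n := by positivity
  rw [Real.norm_of_nonneg hrn.le] at hAr hlr ⊢
  have htilt := tilt_nonneg W a r T
  rw [Real.norm_of_nonneg (by positivity)] at hAr
  rw [Real.norm_of_nonneg (integral_nonneg fun _ => norm_nonneg _)] at hlr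
  set g := testField a u ψ β Λ v r with hg
  have hgt : IsTestField univ g :=
    isTestField_testField a u hψ hβ hψs Λ v hr0 (subset_univ _)
  have hgc : Continuous g := hgt.contDiff.continuous
  have hψc : Continuous fun x : E n => ψ (r⁻¹ • (x - a)) :=
    hψ.continuous.comp (continuous_rescale a r)
  have hcyl : ∀ p : E n × Gr n, p ∉ cyl a r → p.1 ∉ Metric.closedBall a r := fun p hp h =>
    hp ⟨h, mem_univ _⟩
  have hg0 : ∀ x ∉ Metric.closedBall a r, g x = 0 := fun x hx =>
    testField_eq_zero a u β hψs Λ v hr0 hx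
  have hψ0 : ∀ x ∉ Metric.closedBall a r, ψ (r⁻¹ • (x - a)) = 0 := fun x hx =>
    image_eq_zero_of_notMem_tsupport
      (notMem_tsupport_of_one_lt hψs (one_lt_norm_of_notMem_closedBall hr0 hx))
  have hrestr : (W.restrict (cyl a r)).map Prod.fst =
      (weight W).restrict (Metric.closedBall a r) := by
    rw [weight, Measure.restrict_map measurable_fst Metric.isClosed_closedBall.measurableSet]
    congr 2
    ext p
    simp [cyl]
  have hhr : IntegrableOn h (Metric.closedBall a r) (weight W) :=
    hintρ.mono_set (Metric.closedBall_subset_closedBall hrρ.2)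
  have hfr : weight W (Metric.closedBall a r) ≠ ⊤ := hfin.ne
  have hlebI : IntegrableOn (fun x => ‖h x - h a‖) (Metric.closedBall a r) (weight W) :=
    (hhr.sub (integrableOn_const hfr)).norm
  have hhi : IntegrableOn (fun p : E n × Gr n => h p.1) (cyl a r) W := by
    rw [IntegrableOn, ← hrestr] at hhr
    exact hhr.comp_measurable measurable_fst
  have hlebW : IntegrableOn (fun p : E n × Gr n => ‖h p.1 - h a‖) (cyl a r) W := by
    rw [IntegrableOn, ← hrestr] at hlebI
    exact hlebI.comp_measurable measurable_fst
  have hlebE : ∫ p in cyl a r, ‖h p.1 - h a‖ ∂W =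
      ∫ x in Metric.closedBall a r, ‖h x - h a‖ ∂(weight W) := by
    rw [IntegrableOn, ← hrestr] at hlebI
    rw [← hrestr, integral_map measurable_fst.aemeasurable hlebI.aestronglyMeasurable]
  have hFm' : Measurable fun p : E n × Gr n => integrand φ p.2 :=
    (continuous_integrand hφ).measurable.comp measurable_snd
  -- integrability of the two integrands
  have hi1 : Integrable (fun p : E n × Gr n => integrand φ p.2 * ⟪h p.1, g p.1⟫) W := by
    refine integrable_of_integrableOn_cyl (a := a) (r := r) ?_ fun p hp => ?_
    · have h1 : IntegrableOn (fun p : E n × Gr n => ⟪h p.1, g p.1⟫) (cyl a r) W := by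
        refine Integrable.mono' (hhi.norm.mul_const Cg) ?_ (Eventually.of_forall fun p => ?_)
        · exact hhi.aestronglyMeasurable.inner
            (hgc.comp continuous_fst).measurable.aestronglyMeasurable
        · exact (norm_inner_le_norm _ _).trans
            (mul_le_mul_of_nonneg_left (hCg a r hr0 hr1 p.1).2 (norm_nonneg _))
      exact h1.bdd_mul hFm'.aestronglyMeasurable (c := Fm)
        (Eventually.of_forall fun p => hFle p.2)
    · rw [hg0 _ (hcyl p hp), inner_zero_right, mul_zero]
  have hi2 : Integrable (fun p : E n × Gr n => F0 * ⟪h a, v⟫ * ψ (r⁻¹ • (p.1 - a))) W := by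
    refine Integrable.const_mul ?_ _
    exact integrable_of_integrableOn_cyl (a := a) (r := r)
      (integrableOn_cyl_of_continuous hfin (hψc.comp continuous_fst) (C := Cψ)
        fun p => (hCψ _).1) fun p hp => hψ0 _ (hcyl p hp)
  have hdiff : ∫ x, ⟪h x, g x⟫ ∂(weight (energy (integrand φ) W)) -
      F0 * ⟪h a, v⟫ * ∫ x, ψ (r⁻¹ • (x - a)) ∂(weight W) =
      ∫ p, (integrand φ p.2 * ⟪h p.1, g p.1⟫ - F0 * ⟪h a, v⟫ * ψ (r⁻¹ • (p.1 - a))) ∂W := by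
    rw [weight_energy hφ W hh hgc, integral_weight_eq W hψc, integral_sub hi1 hi2,
      integral_const_mul]
  obtain ⟨hti, hte⟩ := setIntegral_one_add_tilt hfin T
  have hbint : IntegrableOn (fun p : E n × Gr n =>
      Fm * Cg * ‖h p.1 - h a‖ + C1 * r * (1 + ‖p.2.proj - T.proj‖ ^ 2 / r ^ 2)) (cyl a r) W :=
    (hlebW.const_mul _).add (hti.const_mul _)
  have hbound := abs_integral_le_setIntegral (W := W) (a := a) (r := r)
    (f := fun p => integrand φ p.2 * ⟪h p.1, g p.1⟫ - F0 * ⟪h a, v⟫ * ψ (r⁻¹ • (p.1 - a)))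
    (b := fun p => Fm * Cg * ‖h p.1 - h a‖ + C1 * r * (1 + ‖p.2.proj - T.proj‖ ^ 2 / r ^ 2))
    (fun p hp => by
      rw [hg0 _ (hcyl p hp), hψ0 _ (hcyl p hp)]
      simp) hbint (fun p hp => by
      set y := r⁻¹ • (p.1 - a) with hy
      have hsplit : integrand φ p.2 * ⟪h p.1, g p.1⟫ - F0 * ⟪h a, v⟫ * ψ y =
          integrand φ p.2 * ⟪h p.1 - h a, g p.1⟫ + integrand φ p.2 * ⟪h a, g p.1 - ψ y • v⟫ +
            (integrand φ p.2 - F0) * (⟪h a, v⟫ * ψ y) := by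
        rw [inner_sub_left, inner_sub_right, inner_smul_right]
        ring
      have e1 : |integrand φ p.2 * ⟪h p.1 - h a, g p.1⟫| ≤ Fm * Cg * ‖h p.1 - h a‖ := by
        have h1 : |⟪h p.1 - h a, g p.1⟫| ≤ ‖h p.1 - h a‖ * Cg :=
          (abs_real_inner_le_norm _ _).trans
            (mul_le_mul_of_nonneg_left (hCg a r hr0 hr1 p.1).2 (norm_nonneg _))
        rw [abs_mul]
        calc _ ≤ Fm * (‖h p.1 - h a‖ * Cg) :=
              mul_le_mul (hFle p.2) h1 (abs_nonneg _) hFm0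
          _ = _ := by ring
      have e2 : |integrand φ p.2 * ⟪h a, g p.1 - ψ y • v⟫| ≤ Fm * ‖h a‖ * Cg * r := by
        have h1 : |⟪h a, g p.1 - ψ y • v⟫| ≤ ‖h a‖ * (Cg * r) :=
          (abs_real_inner_le_norm _ _).trans
            (mul_le_mul_of_nonneg_left (hCg a r hr0 hr1 p.1).1 (norm_nonneg _))
        rw [abs_mul]
        calc _ ≤ Fm * (‖h a‖ * (Cg * r)) := mul_le_mul (hFle p.2) h1 (abs_nonneg _) hFm0
          _ = _ := by ring
      have e3 : |(integrand φ p.2 - F0) * (⟪h a, v⟫ * ψ y)| ≤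
          CF * ‖h a‖ * ‖v‖ * Cψ * ‖p.2.proj - T.proj‖ := by
        have h1 : |⟪h a, v⟫ * ψ y| ≤ ‖h a‖ * ‖v‖ * Cψ := by
          rw [abs_mul]
          exact mul_le_mul (abs_real_inner_le_norm _ _) (hCψ y).1 (abs_nonneg _) (by positivity)
        rw [abs_mul]
        calc _ ≤ CF * ‖p.2.proj - T.proj‖ * (‖h a‖ * ‖v‖ * Cψ) :=
              mul_le_mul (hCF p.2 T) h1 (abs_nonneg _) (by positivity)
          _ = _ := by ring
      have ht := le_mul_one_add_sq_div_sq ‖p.2.proj - T.proj‖ hr0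
      have e4 : Fm * ‖h a‖ * Cg * r ≤
          Fm * ‖h a‖ * Cg * (r * (1 + ‖p.2.proj - T.proj‖ ^ 2 / r ^ 2)) := by
        refine mul_le_mul_of_nonneg_left (le_mul_of_one_le_right hr0.le ?_) (by positivity)
        have : 0 ≤ ‖p.2.proj - T.proj‖ ^ 2 / r ^ 2 := by positivity
        linarith
      have e5 := mul_le_mul_of_nonneg_left ht (show 0 ≤ CF * ‖h a‖ * ‖v‖ * Cψ by positivity)
      rw [hsplit]
      refine (abs_add_three _ _ _).trans ?_
      rw [hC1]
      linarith)
  rw [integral_add (hlebW.const_mul _) (hti.const_mul _), integral_const_mul, integral_const_mul,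
    hte, hlebE, ← hdiff] at hbound
  rw [Real.norm_eq_abs]
  refine hbound.trans ?_
  have h1 : C1 * r * ((weight W).real (Metric.closedBall a r) + tilt W a r T / r ^ 2) ≤
      C1 * r * (A * r ^ n) := by gcongr
  have h2 : C1 * r * (A * r ^ n) ≤ c / 2 * r ^ n := by
    calc C1 * r * (A * r ^ n) = C1 * r * A * r ^ n := by ring
      _ ≤ _ := by gcongr
  have h3 : Fm * Cg * ∫ x in Metric.closedBall a r, ‖h x - h a‖ ∂(weight W) ≤ c / 2 * r ^ n := by
    calc _ ≤ (Fm * Cg + 1) * (c / (2 * (Fm * Cg + 1)) * r ^ n) := by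
          refine mul_le_mul (by linarith) hlr (integral_nonneg fun _ => norm_nonneg _)
            (by positivity)
      _ = c / 2 * r ^ n := by field_simp
  linarith

/-- Asymptotics of the singular part on the test fields. -/
theorem integral_singular_testField_isLittleO {n : ℕ} {a u : E n} {ψ : E n → ℝ} {β : ℝ → ℝ}
    (hψ : ContDiff ℝ ∞ ψ) (hψs : tsupport ψ ⊆ Metric.closedBall 0 1) (hβ : ContDiff ℝ ∞ β)
    (hβs : HasCompactSupport β) (Λ : (E n →L[ℝ] ℝ) →L[ℝ] E n) (v : E n) {σ : Measure (E n)}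
    (hσ : ∃ ρ > 0, σ (Metric.closedBall a ρ) < ⊤)
    (hsing : (fun r => σ.real (Metric.closedBall a r)) =o[𝓝[>] 0] fun r => r ^ n)
    {ζ : E n → E n} (hζ : ∀ᵐ x ∂σ, ‖ζ x‖ = 1) :
    (fun r => ∫ x, ⟪ζ x, testField a u ψ β Λ v r x⟫ ∂σ) =o[𝓝[>] 0] fun r => r ^ n := by
  obtain ⟨Cg, hCg0, hCg⟩ := exists_abs_testField_sub_le u hψ hψs hβ hβs Λ v
  obtain ⟨ρ, hρ, hfin⟩ := hσ
  refine IsBigO.trans_isLittleO (IsBigO.of_bound Cg ?_) hsing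
  filter_upwards [self_mem_nhdsWithin, Ioc_mem_nhdsGT (zero_lt_one' ℝ), Ioc_mem_nhdsGT hρ]
    with r hr0 hr1 hrρ
  have hr0 : 0 < r := hr0
  have hfr : σ (Metric.closedBall a r) < ⊤ :=
    (measure_mono (Metric.closedBall_subset_closedBall hrρ.2)).trans_lt hfin
  rw [Real.norm_of_nonneg measureReal_nonneg,
    ← setIntegral_eq_integral_of_forall_compl_eq_zero (s := Metric.closedBall a r) fun x hx => by
      rw [testField_eq_zero a u β hψs Λ v hr0 hx, inner_zero_right]]
  refine norm_setIntegral_le_of_norm_le_const_ae hfr ?_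
  filter_upwards [ae_restrict_of_ae hζ] with x hx
  refine (norm_inner_le_norm _ _).trans ?_
  rw [hx, one_mul]
  exact (hCg a r hr0 hr1.2 x).2

/-- The behaviour at `a` of a mean curvature `h` of `W`: it has `a` as a Lebesgue point, and the
singular part of the first variation has vanishing density at `a`. -/
structure IsCurvaturePoint {n : ℕ} (F : Gr n → ℝ) (W : Measure (E n × Gr n)) (h : E n → E n)
    (a : E n) : Prop where
  measurable : AEStronglyMeasurable h (weight W)
  integrable : ∃ ρ > 0, IntegrableOn h (Metric.closedBall a ρ) (weight W)
  lebesgue : (fun r => ∫ x in Metric.closedBall a r, ‖h x - h a‖ ∂(weight W))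
      =o[𝓝[>] 0] fun r => r ^ n
  representation : ∃ (σ : Measure (E n)) (ζ : E n → E n) (U : Set (E n)), IsOpen U ∧ a ∈ U ∧
    (∃ ρ > 0, σ (Metric.closedBall a ρ) < ⊤) ∧
    ((fun r => σ.real (Metric.closedBall a r)) =o[𝓝[>] 0] fun r => r ^ n) ∧
    (∀ᵐ x ∂σ, ‖ζ x‖ = 1) ∧
    ∀ g, IsTestField U g → firstVariation F W g =
      -(∫ x, ⟪h x, g x⟫ ∂(weight (energy F W))) + ∫ x, ⟪ζ x, g x⟫ ∂σ

/-- The component of the mean curvature in the direction `v`, computed from the heights of `W`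
over the tangent plane. -/
theorem curvature_isLittleO {n : ℕ} {φ : E n → ℝ} (hφ : IsUniformlyConvexNorm φ)
    {W : Measure (E n × Gr n)} {M : Set (E n)} (hM : MeasurableSet M) {a : E n} {T : Gr n}
    (hW : IsSecondOrderPoint W M a T) {h : E n → E n}
    (hh : IsCurvaturePoint (integrand φ) W h a) {u : E n} (hu : T.IsNormal u) {ψ : E n → ℝ}
    {β : ℝ → ℝ} (hψ : ContDiff ℝ ∞ ψ) (hψs : tsupport ψ ⊆ Metric.closedBall 0 1)
    (hβ : ContDiff ℝ ∞ β) (hβs : HasCompactSupport β) (hβM : IsAdmissibleCutoff β M a u)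
    {Λ : (E n →L[ℝ] ℝ) →L[ℝ] E n} {v : E n} (hΛT : ∀ l, Λ l ∈ T.carrier)
    (hΛ : ∀ w ∈ T.carrier, ∀ l : E n →L[ℝ] ℝ, dStress φ u w (l.smulRight v) = φ u * ⟪w, Λ l⟫) :
    (fun r => integrand φ T * ⟪h a, v⟫ * ∫ x, ψ (r⁻¹ • (x - a)) ∂(weight W) +
      ∫ x, mainTerm φ u ψ β Λ v r (r⁻¹ • (x - a)) ∂(weight W)) =o[𝓝[>] 0] fun r => r ^ n := by
  obtain ⟨σ, ζ, U, hUo, haU, hσ, hsing, hζ, hrep⟩ := hh.representation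
  have h1 := firstVariation_testField_isLittleO hφ hM hW hu hψ hψs hβ hβs hβM hΛT hΛ
  have h2 := integral_inner_testField_isLittleO hφ hW (u := u) hψ hψs hβ hβs Λ v hh.measurable
    hh.integrable hh.lebesgue
  have h3 := integral_singular_testField_isLittleO (u := u) hψ hψs hβ hβs Λ v hσ hsing hζ
  refine ((h3.sub h2).sub h1).congr' ?_ EventuallyEq.rfl
  obtain ⟨ρ, hρ, hρU⟩ := Metric.isOpen_iff.1 hUo a haU
  filter_upwards [self_mem_nhdsWithin, Ioo_mem_nhdsGT hρ] with r hr0 hrρ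
  rw [hrep _ (isTestField_testField a u hψ hβ hψs Λ v hr0
    ((Metric.closedBall_subset_ball hrρ.2).trans hρU))]
  ring

/-! ### Hypersurfaces of class `C²` near a point -/

/-- Near its point `a`, the set `M` is to second order a graph over `a + T`, in the direction of
the unit normal `u` of `T`: secants of `M` in `B(a, s)` have slope at most `K s`, and there are
points of `M` over all points of a neighbourhood of the origin in `T`. -/
structure IsGraphAt {n : ℕ} (M : Set (E n)) (a : E n) (T : Gr n) (u : E n) (K ρ : ℝ) : Prop where
  mem : a ∈ M
  normal : T.IsNormal u
  nonneg : 0 ≤ K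
  pos : 0 < ρ
  height : ∀ s ≤ ρ, ∀ x ∈ M ∩ Metric.closedBall a s, ∀ y ∈ M ∩ Metric.closedBall a s,
    |⟪u, x - y⟫| ≤ K * s * ‖x - y‖
  cover : ∀ z ∈ T.carrier, 2 * ‖z‖ ≤ ρ → ∃ t : ℝ, |t| ≤ ‖z‖ ∧ a + z + t • u ∈ M

theorem IsGraphAt.abs_height_le {n : ℕ} {M : Set (E n)} {a : E n} {T : Gr n} {u : E n} {K ρ : ℝ}
    (h : IsGraphAt M a T u K ρ) {x : E n} (hx : x ∈ M) (hxρ : ‖x - a‖ ≤ ρ) :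
    |⟪u, x - a⟫| ≤ K * ‖x - a‖ ^ 2 := by
  have := h.height ‖x - a‖ hxρ x ⟨hx, by simp [dist_eq_norm]⟩ a
    ⟨h.mem, by simp⟩
  linarith [pow_two ‖x - a‖, mul_assoc K ‖x - a‖ ‖x - a‖]

/-- A regular level set of a function of class `C²` is to second order a graph. -/
theorem exists_isGraphAt {n : ℕ} {M U : Set (E n)} {f : E n → ℝ} (hU : IsOpen U)
    (hf : ContDiffOn ℝ 2 f U) (hMU : M ∩ U = {x ∈ U | f x = 0}) {a : E n} (ha : a ∈ M)
    (haU : a ∈ U) (hfa : fderiv ℝ f a ≠ 0) :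
    ∃ (T : Gr n) (K ρ : ℝ), IsGraphAt M a T (‖gradient f a‖⁻¹ • gradient f a) K ρ := by
  have hfc : ContDiffAt ℝ 2 f a := hf.contDiffAt (hU.mem_nhds haU)
  have hg : gradient f a ≠ 0 := by
    intro h
    refine hfa (ContinuousLinearMap.ext fun w => ?_)
    rw [fderiv_apply_eq_inner_gradient, h, inner_zero_left, zero_apply]
  set c := ‖gradient f a‖ with hc
  have hc0 : 0 < c := norm_pos_iff.2 hg
  set u := c⁻¹ • gradient f a with hu
  have hu1 : ‖u‖ = 1 := by rw [hu, norm_smul, norm_inv, norm_norm, inv_mul_cancel₀ hc0.ne']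
  have hDf : ∀ w, fderiv ℝ f a w = c * ⟪u, w⟫ := by
    intro w
    rw [fderiv_apply_eq_inner_gradient, hu, inner_smul_left]
    simp only [conj_trivial]
    field_simp
  have hu0 : u ≠ 0 := by
    intro h
    rw [h, norm_zero] at hu1
    exact zero_ne_one hu1
  have : Fact (Module.finrank ℝ (E n) = n + 1) := ⟨by simp⟩
  let T : Gr n := ⟨_, Submodule.finrank_orthogonal_span_singleton (n := n) hu0⟩
  have hT : T.IsNormal u := by
    refine ⟨?_, hu1⟩
    rw [show T.carrier = (Submodule.span ℝ {u})ᗮ from rfl, Submodule.orthogonal_orthogonal]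
    exact Submodule.mem_span_singleton_self u
  -- the derivative of `f` is Lipschitz at `a`
  have h1 : ContDiffAt ℝ 1 (fderiv ℝ f) a := hfc.fderiv_right (by norm_num)
  obtain ⟨C, hC0, hC⟩ := (h1.differentiableAt (by norm_num)).hasFDerivAt.isBigO_sub.exists_pos
  have hdiff : ∀ᶠ x in 𝓝 a, DifferentiableAt ℝ f x := by
    filter_upwards [hU.mem_nhds haU] with x hx
    exact ((hf.contDiffAt (hU.mem_nhds hx)).differentiableAt (by norm_num))
  obtain ⟨ρ₀, hρ₀, hball⟩ := Metric.nhds_basis_closedBall.eventually_iff.1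
    ((hC.bound.and hdiff).and (hU.eventually_mem haU))
  -- the linear approximation of `f`
  have hlin : ∀ s ≤ ρ₀, ∀ x ∈ Metric.closedBall a s, ∀ y ∈ Metric.closedBall a s,
      |f x - f y - c * ⟪u, x - y⟫| ≤ C * s * ‖x - y‖ := by
    intro s hs x hx y hy
    have h2 := (convex_closedBall a s).norm_image_sub_le_of_norm_fderiv_le' (𝕜 := ℝ) (f := f)
      (φ := fderiv ℝ f a) (C := C * s)
      (fun z hz => (hball (Metric.closedBall_subset_closedBall hs hz)).1.2) (fun z hz => by
        refine (hball (Metric.closedBall_subset_closedBall hs hz)).1.1.trans ?_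
        refine mul_le_mul_of_nonneg_left ?_ hC0.le
        rwa [← dist_eq_norm]) hy hx
    rwa [hDf, Real.norm_eq_abs] at h2
  have hfM : ∀ x ∈ M, x ∈ Metric.closedBall a ρ₀ → f x = 0 := fun x hx hxρ =>
    (hMU.subset ⟨hx, (hball hxρ).2⟩).2
  refine ⟨T, C / c, min ρ₀ (c / (4 * C)), ha, hT, by positivity, by positivity, ?_, ?_⟩
  · intro s hs x hx y hy
    have hsρ := hs.trans (min_le_left _ _)
    have h2 := hlin s hsρ x hx.2 y hy.2
    rw [hfM x hx.1 (Metric.closedBall_subset_closedBall hsρ hx.2),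
      hfM y hy.1 (Metric.closedBall_subset_closedBall hsρ hy.2), sub_zero, zero_sub, abs_neg,
      abs_mul, abs_of_pos hc0] at h2
    rw [div_mul_eq_mul_div, div_mul_eq_mul_div, le_div_iff₀ hc0]
    linarith
  · intro z hz hzρ
    have hz1 := hzρ.trans (min_le_left _ _)
    have hz2 := hzρ.trans (min_le_right _ _)
    rw [le_div_iff₀ (by positivity)] at hz2
    have hzn := norm_nonneg z
    have huz : ⟪u, z⟫ = 0 := (hT.mem_iff z).1 hz
    have hin : ∀ t ∈ Icc (-‖z‖) ‖z‖, a + z + t • u ∈ Metric.closedBall a (2 * ‖z‖) := by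
      intro t ht
      rw [Metric.mem_closedBall, dist_eq_norm, add_assoc, add_sub_cancel_left]
      refine (norm_add_le _ _).trans ?_
      rw [norm_smul, hu1, mul_one, Real.norm_eq_abs]
      linarith [abs_le.2 ht]
    have hval : ∀ t ∈ Icc (-‖z‖) ‖z‖, |f (a + z + t • u) - c * t| ≤ c * ‖z‖ := by
      intro t ht
      have h2 := hlin _ hz1 _ (hin t ht) a (Metric.mem_closedBall_self (by positivity))
      have h3 := hin t ht
      rw [hfM a ha (Metric.mem_closedBall_self hρ₀.le), sub_zero, add_assoc, add_sub_cancel_left,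
        inner_add_right, huz, inner_smul_right, real_inner_self_eq_norm_sq, hu1] at h2
      rw [Metric.mem_closedBall, dist_eq_norm, add_assoc, add_sub_cancel_left] at h3
      rw [add_assoc]
      have h4 : C * (2 * ‖z‖) * ‖z + t • u‖ ≤ C * (2 * ‖z‖) * (2 * ‖z‖) := by gcongr
      have h5 : C * (2 * ‖z‖) * (2 * ‖z‖) ≤ c * ‖z‖ := by nlinarith
      have h6 : c * (0 + t * 1 ^ 2) = c * t := by ring
      rw [h6] at h2
      linarith
    -- along the normal segment over `z` the function `f` changes its sign
    have hcont : ContinuousOn (fun t : ℝ => f (a + z + t • u)) (Icc (-‖z‖) ‖z‖) := by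
      intro t ht
      have h2 : ContinuousAt f (a + z + t • u) :=
        (hball (Metric.closedBall_subset_closedBall hz1 (hin t ht))).1.2.continuousAt
      exact (ContinuousAt.comp (f := fun t : ℝ => a + z + t • u) h2
        (by fun_prop)).continuousWithinAt
    have hneg : -‖z‖ ≤ ‖z‖ := by linarith
    have hl := (abs_le.1 (hval _ (left_mem_Icc.2 hneg))).2
    have hr := (abs_le.1 (hval _ (right_mem_Icc.2 hneg))).1
    obtain ⟨t, ht, hft⟩ := intermediate_value_Icc hneg hcont
      (show (0 : ℝ) ∈ Icc _ _ from ⟨by linarith, by linarith⟩)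
    refine ⟨t, abs_le.2 ht, ?_⟩
    have := hMU.superset ⟨(hball (Metric.closedBall_subset_closedBall hz1 (hin t ht))).2, hft⟩
    exact this.1

theorem IsGraphAt.tangentCone_eq {n : ℕ} {M : Set (E n)} {a : E n} {T : Gr n} {u : E n} {K ρ : ℝ}
    (h : IsGraphAt M a T u K ρ) : tangentCone M a = T.carrier := by
  have hu := h.normal.2
  ext v
  constructor
  · intro hv
    rw [SetLike.mem_coe, h.normal.mem_iff]
    by_contra hne
    set d := |⟪u, v⟫| with hd
    have hd0 : 0 < d := abs_pos.2 hne
    -- a secant vector close to `v` has height of order `‖x - a‖` over `T`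
    obtain ⟨x, hx, r, hr, h1, h2⟩ := hv (min (d / 2) (min ρ (d / (4 * (K + 1) * (‖v‖ + d)))))
      (by have := h.pos; have := h.nonneg; positivity)
    have hK := h.nonneg
    have h3 := h.abs_height_le hx (h1.le.trans ((min_le_right _ _).trans (min_le_left _ _)))
    have h4 := h1.le.trans ((min_le_right _ _).trans (min_le_right _ _))
    have h5 := h2.trans_le (min_le_left _ _)
    have h6 : |⟪u, r • (x - a) - v⟫| ≤ ‖r • (x - a) - v‖ := by
      have := abs_real_inner_le_norm u (r • (x - a) - v)
      rwa [hu, one_mul] at this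
    rw [inner_sub_right, inner_smul_right] at h6
    have h7 : ‖r • (x - a)‖ ≤ ‖v‖ + d / 2 := by
      have := norm_le_norm_add_norm_sub' (r • (x - a)) v
      linarith
    rw [norm_smul, Real.norm_of_nonneg hr.le] at h7
    have h8 : |r * ⟪u, x - a⟫| ≤ (K + 1) * ((‖v‖ + d) * ‖x - a‖) := by
      rw [abs_mul, abs_of_pos hr]
      have hx0 := norm_nonneg (x - a)
      calc r * |⟪u, x - a⟫| ≤ r * (K * ‖x - a‖ ^ 2) := by gcongr
        _ = K * ((r * ‖x - a‖) * ‖x - a‖) := by ring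
        _ ≤ (K + 1) * ((‖v‖ + d) * ‖x - a‖) := by
          gcongr
          · linarith
          · linarith
    have h9 : (K + 1) * ((‖v‖ + d) * ‖x - a‖) ≤ d / 4 := by
      rw [le_div_iff₀ (by positivity)] at h4
      linarith
    have h10 : d ≤ |r * ⟪u, x - a⟫| + |r * ⟪u, x - a⟫ - ⟪u, v⟫| := by
      have := abs_sub_abs_le_abs_sub ⟪u, v⟫ (r * ⟪u, x - a⟫)
      rw [abs_sub_comm] at this
      linarith
    linarith
  · intro hv ε hε
    by_cases hv0 : v = 0
    · exact ⟨a, h.mem, 1, one_pos, by simpa using hε, by simpa [hv0] using hε⟩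
    have hvn : 0 < ‖v‖ := norm_pos_iff.2 hv0
    have hK := h.nonneg
    have hρ := h.pos
    -- the point of `M` over `s v` is at distance of order `s²` from `a + s v`
    set s := min (ε / (4 * ‖v‖)) (min (ρ / (2 * ‖v‖)) (ε / (8 * (K + 1) * ‖v‖ ^ 2))) with hs
    have hs0 : 0 < s := by positivity
    have hs1 : s ≤ ε / (4 * ‖v‖) := min_le_left _ _
    have hs2 : s ≤ ρ / (2 * ‖v‖) := (min_le_right _ _).trans (min_le_left _ _)
    have hs3 : s ≤ ε / (8 * (K + 1) * ‖v‖ ^ 2) := (min_le_right _ _).trans (min_le_right _ _)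
    rw [le_div_iff₀ (by positivity)] at hs1 hs2 hs3
    have hsv : ‖s • v‖ = s * ‖v‖ := by rw [norm_smul, Real.norm_of_nonneg hs0.le]
    obtain ⟨t, ht, hmem⟩ := h.cover (s • v) (T.carrier.smul_mem s hv) (by rw [hsv]; linarith)
    rw [hsv] at ht
    have hxa : a + s • v + t • u - a = s • v + t • u := by rw [add_assoc, add_sub_cancel_left]
    have hxn : ‖s • v + t • u‖ ≤ 2 * (s * ‖v‖) := by
      refine (norm_add_le _ _).trans ?_
      rw [hsv, norm_smul, hu, mul_one, Real.norm_eq_abs]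
      linarith
    have ht2 : |t| ≤ K * ‖s • v + t • u‖ ^ 2 := by
      have := h.abs_height_le hmem (by rw [hxa]; linarith)
      rw [hxa, inner_add_right, inner_smul_right, inner_smul_right, (h.normal.mem_iff v).1 hv,
        real_inner_self_eq_norm_sq, hu] at this
      simpa using this
    refine ⟨_, hmem, s⁻¹, inv_pos.2 hs0, ?_, ?_⟩
    · rw [hxa]
      linarith
    · rw [hxa, smul_add, smul_smul, inv_mul_cancel₀ hs0.ne', one_smul, add_sub_cancel_left,
        norm_smul, norm_smul, hu, mul_one, norm_inv, Real.norm_of_nonneg hs0.le,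
        Real.norm_eq_abs, inv_mul_lt_iff₀ hs0]
      have h1 : ‖s • v + t • u‖ ^ 2 ≤ (2 * (s * ‖v‖)) ^ 2 := by gcongr
      have h2 : K * ‖s • v + t • u‖ ^ 2 ≤ (K + 1) * (2 * (s * ‖v‖)) ^ 2 := by
        gcongr
        linarith
      have h3 : (K + 1) * (2 * (s * ‖v‖)) ^ 2 = s * (s * (8 * (K + 1) * ‖v‖ ^ 2)) / 2 := by ring
      nlinarith

theorem tangentPlane_eq {n : ℕ} {M : Set (E n)} {a : E n} {T : Gr n}
    (h : tangentCone M a = T.carrier) : tangentPlane M a = T := by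
  have hex : ∃ T : Gr n, (T.carrier : Set (E n)) = tangentCone M a := ⟨T, h.symm⟩
  rw [tangentPlane, dif_pos hex]
  exact Gr.ext (SetLike.coe_injective (hex.choose_spec.trans h))

/-- The tangent planes of a hypersurface are locally the values of a map which is
differentiable. -/
theorem exists_proj_tangentPlane_eq {n : ℕ} {M : Set (E n)} (hM : IsHypersurface 2 M) {a : E n}
    (ha : a ∈ M) : ∃ Q : E n → (E n →L[ℝ] E n), DifferentiableAt ℝ Q a ∧
      ∀ᶠ x in 𝓝 a, x ∈ M → (tangentPlane M x).proj = Q x := by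
  obtain ⟨U, f, hU, haU, hf, hf0, hMU⟩ := hM a ha
  have hf : ContDiffOn ℝ 2 f U := hf
  have h1 : ContDiffAt ℝ 1 (fderiv ℝ f) a :=
    (hf.contDiffAt (hU.mem_nhds haU)).fderiv_right (by norm_num)
  have h2 : DifferentiableAt ℝ (gradient f) a :=
    (InnerProductSpace.toDual ℝ (E n)).symm.differentiable.differentiableAt.comp a
      (h1.differentiableAt (by norm_num))
  have hne : gradient f a ≠ 0 := by
    intro h
    refine hf0 a haU (ContinuousLinearMap.ext fun w => ?_)
    rw [fderiv_apply_eq_inner_gradient, h, inner_zero_left, zero_apply]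
  set N : E n → E n := fun x => ‖gradient f x‖⁻¹ • gradient f x with hN
  have hNd : DifferentiableAt ℝ N a :=
    ((h2.norm ℝ hne).inv (norm_ne_zero_iff.2 hne)).smul h2
  refine ⟨fun x => ContinuousLinearMap.id ℝ (E n) -
    ContinuousLinearMap.smulRightL ℝ (E n) (E n) (innerSL ℝ (N x)) (N x), ?_, ?_⟩
  · refine (differentiableAt_const _).sub ?_
    refine DifferentiableAt.clm_apply ?_ hNd
    exact (ContinuousLinearMap.differentiableAt _).comp a
      ((ContinuousLinearMap.differentiableAt (innerSL ℝ)).comp a hNd)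
  · filter_upwards [hU.mem_nhds haU] with x hxU hxM
    obtain ⟨T, K, ρ, h⟩ := exists_isGraphAt hU hf hMU hxM hxU (hf0 x hxU)
    rw [tangentPlane_eq h.tangentCone_eq]
    ext1 w
    rw [h.normal.proj_apply]
    rfl

theorem IsHypersurface.exists_isGraphAt {n : ℕ} {M : Set (E n)} (hM : IsHypersurface 2 M)
    {a : E n} (ha : a ∈ M) {u : E n} (hu : (tangentPlane M a).IsNormal u) :
    ∃ K ρ : ℝ, IsGraphAt M a (tangentPlane M a) u K ρ := by
  obtain ⟨U, f, hU, haU, hf, hf0, hMU⟩ := hM a ha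
  obtain ⟨T, K, ρ, h⟩ := AnisotropicVarifold.exists_isGraphAt hU hf hMU ha haU (hf0 a haU)
  have hT := tangentPlane_eq h.tangentCone_eq
  rw [hT] at hu ⊢
  rcases hu.eq_or_eq_neg h.normal with h1 | h1
  · exact ⟨K, ρ, h1 ▸ h⟩
  · refine ⟨K, ρ, h.mem, hu, h.nonneg, h.pos, fun s hs x hx y hy => ?_, fun z hz hzρ => ?_⟩
    · have h2 := h.height s hs x hx y hy
      rwa [h1, inner_neg_left, abs_neg] at h2
    · obtain ⟨t, ht, hm⟩ := h.cover z hz hzρ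
      exact ⟨-t, by rwa [abs_neg], by rwa [h1, smul_neg, ← neg_smul] at hm⟩

theorem IsHypersurface.tangentCone_eq {n : ℕ} {M : Set (E n)} (hM : IsHypersurface 2 M)
    {a : E n} (ha : a ∈ M) : tangentCone M a = (tangentPlane M a).carrier := by
  obtain ⟨K, ρ, h⟩ := hM.exists_isGraphAt ha (Gr.isNormal_unitNormal _)
  exact h.tangentCone_eq

theorem IsHypersurface.continuousOn_tangentPlane {n : ℕ} {M : Set (E n)}
    (hM : IsHypersurface 2 M) : ContinuousOn (tangentPlane M) M := by
  intro a ha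
  obtain ⟨Q, hQ, hev⟩ := exists_proj_tangentPlane_eq hM ha
  have hind : IsInducing (Gr.proj (n := n)) := ⟨rfl⟩
  rw [hind.continuousWithinAt_iff]
  refine hQ.continuousAt.continuousWithinAt.congr_of_eventuallyEq ?_ (hev.self_of_nhds ha)
  filter_upwards [self_mem_nhdsWithin, nhdsWithin_le_nhds hev] with x h1 h2
  exact h2 h1

theorem IsHypersurface.exists_norm_proj_tangentPlane_sub_le {n : ℕ} {M : Set (E n)}
    (hM : IsHypersurface 2 M) {a : E n} (ha : a ∈ M) : ∃ C, 0 < C ∧ ∀ᶠ x in 𝓝 a, x ∈ M →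
      ‖(tangentPlane M x).proj - (tangentPlane M a).proj‖ ≤ C * ‖x - a‖ := by
  obtain ⟨Q, hQ, hev⟩ := exists_proj_tangentPlane_eq hM ha
  obtain ⟨C, hC0, hC⟩ := hQ.hasFDerivAt.isBigO_sub.exists_pos
  refine ⟨C, hC0, ?_⟩
  filter_upwards [hC.bound, hev] with x h1 h2 hx
  rwa [h2 hx, hev.self_of_nhds ha]

theorem IsHypersurface.measurableSet {n j : ℕ} {M : Set (E n)} (hM : IsHypersurface j M) :
    MeasurableSet M := by
  have h : IsLocallyClosed M := by
    refine ((isLocallyClosed_tfae M).out 0 2 rfl rfl).2 fun a ha => ?_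
    obtain ⟨U, f, hU, haU, hf, -, hMU⟩ := hM a ha
    refine ⟨U, hU.mem_nhds haU, ?_⟩
    have h1 : (Subtype.val ⁻¹' M : Set U) = (U.domRestrict f) ⁻¹' {0} := by
      ext x
      have := Set.ext_iff.1 hMU x
      simpa using this
    rw [h1]
    exact isClosed_singleton.preimage hf.continuousOn.domRestrict
  obtain ⟨O, Z, hO, hZ, rfl⟩ := h
  exact hO.measurableSet.inter hZ.measurableSet

theorem IsHypersurface.inter {n j : ℕ} {M : Set (E n)} (hM : IsHypersurface j M) {O : Set (E n)}
    (hO : IsOpen O) : IsHypersurface j (M ∩ O) := by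
  intro a ha
  obtain ⟨U, f, hU, haU, hf, hf0, hMU⟩ := hM a ha.1
  refine ⟨U ∩ O, f, hU.inter hO, ⟨haU, ha.2⟩, hf.mono inter_subset_left,
    fun x hx => hf0 x hx.1, ?_⟩
  ext x
  have := Set.ext_iff.1 hMU x
  simp only [mem_inter_iff, mem_ofPred_eq] at this ⊢
  tauto

/-! ### Projection of a hypersurface to its tangent plane -/

theorem euclideanHausdorffMeasure_image_le {X Y : Type*} [EMetricSpace X] [EMetricSpace Y]
    [MeasurableSpace X] [BorelSpace X] [MeasurableSpace Y] [BorelSpace Y] {K : NNReal} {f : X → Y}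
    {s : Set X} (h : LipschitzOnWith K f s) (d : ℕ) :
    Measure.euclideanHausdorffMeasure d (f '' s) ≤
      (K : ℝ≥0∞) ^ d * Measure.euclideanHausdorffMeasure d s := by
  have h1 := h.hausdorffMeasure_image_le (d := d) (Nat.cast_nonneg d)
  rw [ENNReal.rpow_natCast] at h1
  simp only [Measure.euclideanHausdorffMeasure_def, Measure.smul_apply, ENNReal.smul_def,
    smul_eq_mul]
  rw [mul_left_comm]
  gcongr

theorem Gr.volume_eq {n : ℕ} (T : Gr n) :
    (Measure.euclideanHausdorffMeasure n : Measure T.carrier) = volume := by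
  have h := InnerProductSpace.euclideanHausdorffMeasure_eq_volume (V := T.carrier)
  rwa [T.finrank_eq] at h

/-- The orthogonal projection of `x - a` to `T`, as a point of the plane `T`. -/
noncomputable def Gr.coord {n : ℕ} (T : Gr n) (a x : E n) : T.carrier :=
  T.carrier.orthogonalProjectionOnto (x - a)

theorem Gr.coe_coord {n : ℕ} (T : Gr n) (a x : E n) : (T.coord a x : E n) = T.proj (x - a) := rfl

theorem Gr.continuous_coord {n : ℕ} (T : Gr n) (a : E n) : Continuous (T.coord a) :=
  T.carrier.orthogonalProjectionOnto.continuous.comp (continuous_id.sub continuous_const)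

theorem Gr.norm_coord_sub_le {n : ℕ} (T : Gr n) (a x y : E n) :
    ‖T.coord a x - T.coord a y‖ ≤ ‖x - y‖ := by
  have h : ((T.coord a x - T.coord a y : T.carrier) : E n) = T.proj (x - y) := by
    rw [Submodule.coe_sub, Gr.coe_coord, Gr.coe_coord, ← map_sub, sub_sub_sub_cancel_right]
  rw [Submodule.coe_norm, h]
  exact T.norm_proj_apply_le _

theorem Gr.IsNormal.norm_sq_eq {n : ℕ} {T : Gr n} {u : E n} (h : T.IsNormal u) (x : E n) :
    ‖x‖ ^ 2 = ‖T.proj x‖ ^ 2 + ⟪u, x⟫ ^ 2 := by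
  have h1 : x = T.proj x + ⟪u, x⟫ • u := by rw [h.proj_apply, sub_add_cancel]
  have h2 : ⟪T.proj x, ⟪u, x⟫ • u⟫ = 0 := by
    rw [inner_smul_right, real_inner_comm u (T.proj x), (h.mem_iff _).1 (T.proj_mem x), mul_zero]
  have h3 := norm_add_sq_eq_norm_sq_add_norm_sq_of_inner_eq_zero _ _ h2
  rw [← h1, norm_smul, h.2, mul_one, Real.norm_eq_abs] at h3
  rw [pow_two, h3, ← pow_two, ← pow_two, sq_abs]

/-- On a graph with small slope the projection to the plane hardly decreases distances; the
defect is of second order. -/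
theorem IsGraphAt.norm_sub_le {n : ℕ} {M : Set (E n)} {a : E n} {T : Gr n} {u : E n} {K ρ : ℝ}
    (h : IsGraphAt M a T u K ρ) {s : ℝ} (hs : s ≤ ρ) (hKs : (K * s) ^ 2 ≤ 1 / 2) {x y : E n}
    (hx : x ∈ M ∩ Metric.closedBall a s) (hy : y ∈ M ∩ Metric.closedBall a s) :
    ‖x - y‖ ≤ (1 + (K * s) ^ 2) * ‖T.coord a x - T.coord a y‖ := by
  have h1 := h.height s hs x hx y hy
  have h2 := h.normal.norm_sq_eq (x - y)
  have h3 : ‖T.coord a x - T.coord a y‖ = ‖T.proj (x - y)‖ := by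
    rw [Submodule.coe_norm, Submodule.coe_sub, Gr.coe_coord, Gr.coe_coord, ← map_sub,
      sub_sub_sub_cancel_right]
  rw [h3]
  have h4 : ⟪u, x - y⟫ ^ 2 ≤ (K * s * ‖x - y‖) ^ 2 := by
    rw [← sq_abs]
    gcongr
  set t := (K * s) ^ 2 with ht
  have ht0 : 0 ≤ t := sq_nonneg _
  rw [mul_pow, ← ht] at h4
  refine le_of_sq_le_sq ?_ (by positivity)
  rw [mul_pow]
  have h5 : (1 - t) * ‖x - y‖ ^ 2 ≤ ‖T.proj (x - y)‖ ^ 2 := by linarith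
  have h6 : 1 ≤ (1 + t) ^ 2 * (1 - t) := by nlinarith [mul_nonneg ht0 ht0]
  calc ‖x - y‖ ^ 2 ≤ (1 + t) ^ 2 * (1 - t) * ‖x - y‖ ^ 2 :=
        le_mul_of_one_le_left (sq_nonneg _) h6
    _ = (1 + t) ^ 2 * ((1 - t) * ‖x - y‖ ^ 2) := by ring
    _ ≤ _ := by gcongr

/-- The image under the projection to `T` of the measure of `M` in the ball `B(a, s)`. -/
noncomputable def projectedMeasure {n : ℕ} (M : Set (E n)) (a : E n) (T : Gr n) (s : ℝ) :
    Measure T.carrier :=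
  ((Measure.euclideanHausdorffMeasure n).restrict (M ∩ Metric.closedBall a s)).map (T.coord a)

/-- The projection is Lipschitz with constant one, and onto the ball of half the radius. -/
theorem IsGraphAt.le_projectedMeasure {n : ℕ} {M : Set (E n)} {a : E n} {T : Gr n} {u : E n}
    {K ρ : ℝ} (h : IsGraphAt M a T u K ρ) {s : ℝ} (hs : s ≤ ρ) :
    (volume : Measure T.carrier).restrict (Metric.closedBall 0 (s / 2)) ≤
      projectedMeasure M a T s := by
  refine Measure.le_iff.2 fun A hA => ?_
  have hq := T.continuous_coord a
  rw [Measure.restrict_apply hA, projectedMeasure, Measure.map_apply hq.measurable hA,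
    Measure.restrict_apply (hq.measurable hA), ← T.volume_eq]
  set S := T.coord a ⁻¹' A ∩ (M ∩ Metric.closedBall a s) with hS
  have hl : LipschitzOnWith 1 (T.coord a) S := by
    refine LipschitzOnWith.of_dist_le_mul fun x _ y _ => ?_
    rw [dist_eq_norm, dist_eq_norm, NNReal.coe_one, one_mul]
    exact T.norm_coord_sub_le a x y
  have h1 := euclideanHausdorffMeasure_image_le hl n
  rw [ENNReal.coe_one, one_pow, one_mul] at h1
  refine (measure_mono ?_).trans h1
  rintro z ⟨hzA, hz⟩
  replace hz : ‖(z : E n)‖ ≤ s / 2 := mem_closedBall_zero_iff.1 hz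
  obtain ⟨t, ht, hm⟩ := h.cover z z.2 (by linarith)
  have hsub : a + z + t • u - a = z + t • u := by rw [add_assoc, add_sub_cancel_left]
  have hc : T.coord a (a + z + t • u) = z := by
    refine Subtype.ext ?_
    rw [Gr.coe_coord, hsub, h.normal.proj_apply, inner_add_right, (h.normal.mem_iff _).1 z.2,
      inner_smul_right, real_inner_self_eq_norm_sq, h.normal.2]
    simp
  refine ⟨_, ⟨?_, hm, ?_⟩, hc⟩
  · rw [mem_preimage, hc]
    exact hzA
  · rw [Metric.mem_closedBall, dist_eq_norm, hsub]
    refine (norm_add_le _ _).trans ?_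
    rw [norm_smul, h.normal.2, mul_one, Real.norm_eq_abs]
    linarith

/-- The inverse of the projection is Lipschitz with a constant close to one. -/
theorem IsGraphAt.projectedMeasure_le {n : ℕ} {M : Set (E n)} {a : E n} {T : Gr n} {u : E n}
    {K ρ : ℝ} (h : IsGraphAt M a T u K ρ) {s : ℝ} (hs : s ≤ ρ) (hKs : (K * s) ^ 2 ≤ 1 / 2) :
    projectedMeasure M a T s ≤
      ENNReal.ofReal ((1 + (K * s) ^ 2) ^ n) • (volume : Measure T.carrier) := by
  refine Measure.le_iff.2 fun A hA => ?_
  have hq := T.continuous_coord a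
  rw [projectedMeasure, Measure.map_apply hq.measurable hA,
    Measure.restrict_apply (hq.measurable hA), Measure.smul_apply, ← T.volume_eq, smul_eq_mul]
  set S := T.coord a ⁻¹' A ∩ (M ∩ Metric.closedBall a s) with hS
  set L : NNReal := Real.toNNReal (1 + (K * s) ^ 2) with hL
  have hL0 : (0 : ℝ) ≤ 1 + (K * s) ^ 2 := by positivity
  have hLc : (L : ℝ) = 1 + (K * s) ^ 2 := Real.coe_toNNReal _ hL0
  have hinj : InjOn (T.coord a) S := by
    intro x hx y hy hxy
    have h1 := h.norm_sub_le hs hKs hx.2 hy.2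
    rw [hxy, sub_self, norm_zero, mul_zero] at h1
    exact sub_eq_zero.1 (norm_le_zero_iff.1 h1)
  have hinv : ∀ x ∈ S, Function.invFunOn (T.coord a) S (T.coord a x) = x := fun x hx =>
    hinj.leftInvOn_invFunOn hx
  have hl : LipschitzOnWith L (Function.invFunOn (T.coord a) S) (T.coord a '' S) := by
    refine LipschitzOnWith.of_dist_le_mul ?_
    rintro _ ⟨x, hx, rfl⟩ _ ⟨y, hy, rfl⟩
    rw [hinv x hx, hinv y hy, dist_eq_norm, dist_eq_norm, hLc]
    exact h.norm_sub_le hs hKs hx.2 hy.2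
  have h1 := euclideanHausdorffMeasure_image_le hl n
  have h2 : Function.invFunOn (T.coord a) S '' (T.coord a '' S) = S := by
    rw [image_image]
    exact (image_congr hinv).trans (image_id' S)
  rw [h2] at h1
  have h3 : (L : ℝ≥0∞) ^ n = ENNReal.ofReal ((1 + (K * s) ^ 2) ^ n) := by
    rw [ENNReal.ofReal_pow hL0]
    rfl
  rw [h3] at h1
  refine h1.trans (mul_le_mul_right (measure_mono ?_) _)
  rintro _ ⟨x, hx, rfl⟩
  exact hx.1

/-- Two measures which are comparable with a constant close to one have almost the same
integrals. -/
theorem abs_integral_sub_integral_le {X : Type*} [MeasurableSpace X] {μ ν : Measure X} {B : Set X}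
    {c : ℝ} (hc : 0 ≤ c) (h1 : μ.restrict B ≤ ν) (h2 : ν ≤ ENNReal.ofReal c • μ) {k : X → ℝ}
    (hk : Integrable k μ) (hB : ∀ x ∉ B, k x = 0) :
    |∫ x, k x ∂ν - ∫ x, k x ∂μ| ≤ (c - 1) * ∫ x, |k x| ∂μ := by
  have hkν : Integrable k ν := (hk.smul_measure ENNReal.ofReal_ne_top).mono_measure h2
  -- nonnegative functions, applied below to `|k| + k` and `|k| - k`
  have key : ∀ f : X → ℝ, (∀ x, 0 ≤ f x) → Integrable f μ → (∀ x ∉ B, f x = 0) →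
      ∫ x, f x ∂μ ≤ ∫ x, f x ∂ν ∧ ∫ x, f x ∂ν ≤ c * ∫ x, f x ∂μ := by
    intro f hf0 hf hfB
    have hfc := hf.smul_measure (c := ENNReal.ofReal c) ENNReal.ofReal_ne_top
    constructor
    · rw [← setIntegral_eq_integral_of_forall_compl_eq_zero hfB]
      exact integral_mono_measure h1 (Eventually.of_forall hf0) (hfc.mono_measure h2)
    · have h3 := integral_mono_measure h2 (Eventually.of_forall hf0) hfc
      rwa [integral_smul_measure, ENNReal.toReal_ofReal hc, smul_eq_mul] at h3
  have hp := key (fun x => |k x| + k x) (fun x => by linarith [neg_abs_le (k x)])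
    (hk.abs.add hk) (fun x hx => by rw [hB x hx]; simp)
  have hm := key (fun x => |k x| - k x) (fun x => by linarith [le_abs_self (k x)])
    (hk.abs.sub hk) (fun x hx => by rw [hB x hx]; simp)
  rw [integral_add hk.abs hk, integral_add hkν.abs hkν] at hp
  rw [integral_sub hk.abs hk, integral_sub hkν.abs hkν] at hm
  rw [abs_le]
  constructor <;> nlinarith

theorem IsGraphAt.eventually {n : ℕ} {M : Set (E n)} {a : E n} {T : Gr n} {u : E n}
    {K ρ : ℝ} (h : IsGraphAt M a T u K ρ) :
    ∀ᶠ r : ℝ in 𝓝[>] 0, 0 < r ∧ r ≤ 1 ∧ r ≤ ρ ∧ (K * r) ^ 2 ≤ 1 / 2 := by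
  have h1 : Tendsto (fun r : ℝ => (K * r) ^ 2) (𝓝 0) (𝓝 ((K * 0) ^ 2)) :=
    ((tendsto_id.const_mul K).pow 2)
  rw [mul_zero, zero_pow two_ne_zero] at h1
  filter_upwards [self_mem_nhdsWithin, Ioc_mem_nhdsGT (zero_lt_one' ℝ), Ioc_mem_nhdsGT h.pos,
    (h1.mono_left nhdsWithin_le_nhds).eventually (ge_mem_nhds (show (0 : ℝ) < 1 / 2 by norm_num))]
    with r h1 h2 h3 h4
  exact ⟨h1, h2.2, h3.2, h4⟩

theorem one_add_sq_pow_sub_one_le (n : ℕ) {K r : ℝ} (hKr : (K * r) ^ 2 ≤ 1 / 2) :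
    (1 + (K * r) ^ 2) ^ n - 1 ≤ 2 ^ n * K ^ 2 * r ^ 2 * n := by
  set t := (K * r) ^ 2 with ht
  have ht0 : 0 ≤ t := sq_nonneg _
  induction n with
  | zero => simp
  | succ n ih =>
    have h1 : (1 + t) ^ n ≤ 2 ^ n := by gcongr; linarith
    have h2 : (2 : ℝ) ^ n * K ^ 2 * r ^ 2 = 2 ^ n * t := by rw [ht]; ring
    have h3 : (2 : ℝ) ^ (n + 1) * K ^ 2 * r ^ 2 * (n + 1 : ℕ) = 2 ^ (n + 1) * t * (n + 1) := by
      rw [ht]; push_cast; ring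
    rw [h2] at ih
    rw [h3, pow_succ, pow_succ]
    have h4 : (0 : ℝ) ≤ 2 ^ n * t * n := by positivity
    have h5 : (1 + t) ^ n * t ≤ 2 ^ n * t := by gcongr
    have h6 : (0 : ℝ) ≤ 2 ^ n * t := by positivity
    nlinarith

/-- Integrals over `M` of functions of the projection to the tangent plane, at the scale `r`, agree
with the integrals over the plane up to an error of relative order `r²`. -/
theorem IsGraphAt.integral_sub_isBigO {n : ℕ} {M : Set (E n)} {a : E n} {T : Gr n} {u : E n}
    {K ρ : ℝ} (h : IsGraphAt M a T u K ρ) {k : T.carrier → ℝ} (hk : Continuous k)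
    (hk0 : ∀ z ∉ Metric.closedBall (0 : T.carrier) (1 / 2), k z = 0) :
    (fun r => ∫ x in M ∩ Metric.closedBall a r, k (r⁻¹ • T.coord a x)
        ∂Measure.euclideanHausdorffMeasure n - r ^ n * ∫ z, k z) =O[𝓝[>] 0]
      fun r => r ^ (n + 2) := by
  refine IsBigO.of_bound (2 ^ n * K ^ 2 * n * ∫ z, |k z|) ?_
  filter_upwards [h.eventually] with r hr
  obtain ⟨hr0, hr1, hrρ, hKr⟩ := hr
  have hkc : HasCompactSupport k := HasCompactSupport.intro (isCompact_closedBall 0 (1 / 2)) hk0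
  have hki := hk.integrable_of_hasCompactSupport hkc (μ := volume)
  have hkr : Integrable (fun z : T.carrier => k (r⁻¹ • z)) := hki.comp_smul (inv_ne_zero hr0.ne')
  have h1 := abs_integral_sub_integral_le (k := fun z : T.carrier => k (r⁻¹ • z))
    (c := (1 + (K * r) ^ 2) ^ n) (by positivity)
    (h.le_projectedMeasure hrρ) (h.projectedMeasure_le hrρ hKr) hkr (fun z hz => hk0 _ ?_)
  · have h2 : ∫ z, k (r⁻¹ • z) ∂(projectedMeasure M a T r) =
        ∫ x in M ∩ Metric.closedBall a r, k (r⁻¹ • T.coord a x)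
          ∂Measure.euclideanHausdorffMeasure n := by
      rw [projectedMeasure, integral_map (T.continuous_coord a).aemeasurable]
      exact (hk.comp (continuous_const_smul r⁻¹)).aestronglyMeasurable
    have h3 : ∫ z : T.carrier, k (r⁻¹ • z) = r ^ n * ∫ z, k z := by
      rw [Measure.integral_comp_inv_smul, T.finrank_eq, abs_of_pos (by positivity), smul_eq_mul]
    have h4 : ∫ z : T.carrier, |k (r⁻¹ • z)| = r ^ n * ∫ z, |k z| := by
      rw [Measure.integral_comp_inv_smul volume (fun z => |k z|), T.finrank_eq,
        abs_of_pos (by positivity), smul_eq_mul]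
    rw [h2, h3, h4] at h1
    rw [Real.norm_eq_abs, Real.norm_of_nonneg (by positivity)]
    refine h1.trans ?_
    have h5 := one_add_sq_pow_sub_one_le n hKr
    have h6 : 0 ≤ ∫ z, |k z| := integral_nonneg fun _ => abs_nonneg _
    calc _ ≤ (2 ^ n * K ^ 2 * r ^ 2 * n) * (r ^ n * ∫ z, |k z|) := by gcongr
      _ = _ := by ring
  · rw [mem_closedBall_zero_iff, not_le] at hz ⊢
    rw [norm_smul, norm_inv, Real.norm_of_nonneg hr0.le, inv_mul_eq_div, lt_div_iff₀ hr0]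
    linarith

/-- The density ratios of `M` at `a` are bounded. -/
theorem IsGraphAt.measure_le {n : ℕ} {M : Set (E n)} {a : E n} {T : Gr n} {u : E n}
    {K ρ : ℝ} (h : IsGraphAt M a T u K ρ) : ∃ C : ℝ, 0 ≤ C ∧ ∀ᶠ r : ℝ in 𝓝[>] 0,
      Measure.euclideanHausdorffMeasure n (M ∩ Metric.closedBall a r) ≤
        ENNReal.ofReal (C * r ^ n) := by
  refine ⟨2 ^ n * (volume (Metric.closedBall (0 : T.carrier) 1)).toReal, by positivity, ?_⟩
  filter_upwards [h.eventually] with r hr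
  obtain ⟨hr0, hr1, hrρ, hKr⟩ := hr
  have h1 := h.projectedMeasure_le hrρ hKr (Metric.closedBall 0 r)
  have hm := (T.continuous_coord a).measurable
    (Metric.isClosed_closedBall (x := (0 : T.carrier)) (ε := r)).measurableSet
  rw [projectedMeasure, Measure.map_apply (T.continuous_coord a).measurable
    Metric.isClosed_closedBall.measurableSet, Measure.restrict_apply hm, Measure.smul_apply,
    Measure.addHaar_closedBall' _ _ hr0.le, T.finrank_eq, smul_eq_mul] at h1
  have h2 : T.coord a ⁻¹' Metric.closedBall 0 r ∩ (M ∩ Metric.closedBall a r) =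
      M ∩ Metric.closedBall a r := by
    refine inter_eq_self_of_subset_right fun x hx => ?_
    have h3 := T.norm_coord_sub_le a x a
    have h4 : T.coord a a = 0 := by simp [Gr.coord]
    rw [h4, sub_zero] at h3
    rw [mem_preimage, mem_closedBall_zero_iff]
    have h5 := hx.2
    rw [Metric.mem_closedBall, dist_eq_norm] at h5
    linarith
  rw [h2] at h1
  refine h1.trans ?_
  have hfin : volume (Metric.closedBall (0 : T.carrier) 1) ≠ ⊤ := measure_closedBall_lt_top.ne
  rw [mul_right_comm, ENNReal.ofReal_mul (by positivity), ENNReal.ofReal_mul (by positivity),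
    ENNReal.ofReal_toReal hfin, ← mul_assoc]
  gcongr
  linarith

/-! ### Cutoff functions adapted to a tangent plane -/

theorem Gr.inv_smul_coord {n : ℕ} (T : Gr n) (a x : E n) (r : ℝ) :
    r⁻¹ • T.coord a x = T.carrier.orthogonalProjectionOnto (r⁻¹ • (x - a)) := by
  rw [map_smul]
  rfl

theorem Gr.IsNormal.orthogonalProjectionOnto_eq_zero {n : ℕ} {T : Gr n} {u : E n}
    (hu : T.IsNormal u) : T.carrier.orthogonalProjectionOnto u = 0 :=
  Submodule.orthogonalProjectionOnto_eq_zero_iff.2 hu.1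

/-- A cutoff function which, near the plane `T`, depends only on the projection to `T`. -/
structure IsPlaneCutoff {n : ℕ} (T : Gr n) (u : E n) (ψ : E n → ℝ) (k : T.carrier → ℝ) : Prop where
  contDiff : ContDiff ℝ ∞ ψ
  tsupport_subset : tsupport ψ ⊆ Metric.closedBall 0 1
  contDiff_plane : ContDiff ℝ ∞ k
  tsupport_plane_subset : tsupport k ⊆ Metric.closedBall 0 (1 / 2)
  integral_pos : 0 < ∫ z, k z
  eventually_eq : ∀ y, |⟪u, y⟫| < 1 / 4 →
    ψ =ᶠ[𝓝 y] fun y' => k (T.carrier.orthogonalProjectionOnto y')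

theorem Gr.IsNormal.exists_isPlaneCutoff {n : ℕ} {T : Gr n} {u : E n} (hu : T.IsNormal u) :
    ∃ ψ k, IsPlaneCutoff T u ψ k := by
  let k : ContDiffBump (0 : T.carrier) := ⟨1 / 4, 1 / 2, by norm_num, by norm_num⟩
  let b : ContDiffBump (0 : ℝ) := ⟨1 / 4, 1 / 2, by norm_num, by norm_num⟩
  have hin : ContDiff ℝ ∞ fun y : E n => ⟪u, y⟫ := contDiff_const.inner ℝ contDiff_id
  refine ⟨fun y => k (T.carrier.orthogonalProjectionOnto y) * b ⟪u, y⟫, k, ?_, ?_, k.contDiff, ?_,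
    k.integral_pos, ?_⟩
  · exact (k.contDiff.comp (ContinuousLinearMap.contDiff _)).mul (b.contDiff.comp hin)
  · refine closure_minimal (fun y hy => ?_) Metric.isClosed_closedBall
    rw [Function.mem_support] at hy
    have h1 : T.carrier.orthogonalProjectionOnto y ∈ Function.support k := left_ne_zero_of_mul hy
    have h2 : ⟪u, y⟫ ∈ Function.support b := right_ne_zero_of_mul hy
    rw [k.support_eq, mem_ball_zero_iff] at h1
    rw [b.support_eq, mem_ball_zero_iff, Real.norm_eq_abs] at h2
    replace h1 : ‖T.proj y‖ < 1 / 2 := h1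
    replace h2 : |⟪u, y⟫| < 1 / 2 := h2
    have h3 := hu.norm_sq_eq y
    rw [mem_closedBall_zero_iff]
    rw [← sq_abs ⟪u, y⟫] at h3
    nlinarith [norm_nonneg (T.proj y), abs_nonneg ⟪u, y⟫, norm_nonneg y]
  · rw [k.tsupport_eq]
  · intro y hy
    have h1 : ∀ᶠ y' : E n in 𝓝 y, |⟪u, y'⟫| < 1 / 4 :=
      hin.continuous.abs.continuousAt.eventually (gt_mem_nhds hy)
    filter_upwards [h1] with y' hy'
    rw [b.one_of_mem_closedBall (by
      rw [mem_closedBall_zero_iff, Real.norm_eq_abs]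
      exact hy'.le), mul_one]

theorem IsPlaneCutoff.apply_eq_zero {n : ℕ} {T : Gr n} {u : E n} {ψ : E n → ℝ}
    {k : T.carrier → ℝ} (h : IsPlaneCutoff T u ψ k) {z : T.carrier}
    (hz : z ∉ Metric.closedBall (0 : T.carrier) (1 / 2)) : k z = 0 :=
  image_eq_zero_of_notMem_tsupport fun hz' => hz (h.tsupport_plane_subset hz')

theorem IsPlaneCutoff.fderiv_apply {n : ℕ} {T : Gr n} {u : E n} {ψ : E n → ℝ} {k : T.carrier → ℝ}
    (h : IsPlaneCutoff T u ψ k) {y : E n} (hy : |⟪u, y⟫| < 1 / 4) (w : E n) :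
    fderiv ℝ ψ y w = fderiv ℝ k (T.carrier.orthogonalProjectionOnto y)
      (T.carrier.orthogonalProjectionOnto w) := by
  rw [(h.eventually_eq y hy).fderiv_eq]
  have h1 : HasFDerivAt k (fderiv ℝ k (T.carrier.orthogonalProjectionOnto y))
      (T.carrier.orthogonalProjectionOnto y) :=
    ((h.contDiff_plane.differentiable (by simp)) _).hasFDerivAt
  have h2 := h1.comp y (ContinuousLinearMap.hasFDerivAt (T.carrier.orthogonalProjectionOnto))
  have h3 : fderiv ℝ (fun y' => k (T.carrier.orthogonalProjectionOnto y')) y =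
      (fderiv ℝ k (T.carrier.orthogonalProjectionOnto y)) ∘L T.carrier.orthogonalProjectionOnto :=
    h2.fderiv
  rw [h3]
  rfl

theorem IsPlaneCutoff.fderiv_fderiv_apply_normal {n : ℕ} {T : Gr n} {u : E n} {ψ : E n → ℝ}
    {k : T.carrier → ℝ} (h : IsPlaneCutoff T u ψ k) (hu : T.IsNormal u) {y : E n}
    (hy : |⟪u, y⟫| < 1 / 4) (w : E n) : fderiv ℝ (fderiv ℝ ψ) y w u = 0 := by
  have hψ' : ContDiff ℝ ∞ (fderiv ℝ ψ) := h.contDiff.fderiv_right (by simp)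
  have h1 : HasFDerivAt (fun y => fderiv ℝ ψ y u)
      ((ContinuousLinearMap.apply ℝ ℝ u) ∘L fderiv ℝ (fderiv ℝ ψ) y) y :=
    (ContinuousLinearMap.apply ℝ ℝ u).hasFDerivAt.comp y
      ((hψ'.differentiable (by simp)) y).hasFDerivAt
  have h2 : (fun y => fderiv ℝ ψ y u) =ᶠ[𝓝 y] fun _ => 0 := by
    have h3 : ∀ᶠ y' : E n in 𝓝 y, |⟪u, y'⟫| < 1 / 4 :=
      (continuous_const.inner continuous_id).abs.continuousAt.eventually (gt_mem_nhds hy)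
    filter_upwards [h3] with y' hy'
    rw [h.fderiv_apply hy', hu.orthogonalProjectionOnto_eq_zero, map_zero]
  have h4 := h1.fderiv.symm.trans h2.fderiv_eq
  rw [fderiv_fun_const] at h4
  exact congrArg (fun L : E n →L[ℝ] ℝ => L w) h4

/-- The integral of a directional derivative of a compactly supported function vanishes. -/
theorem integral_fderiv_apply_eq_zero {V : Type*} [NormedAddCommGroup V] [InnerProductSpace ℝ V]
    [FiniteDimensional ℝ V] [MeasurableSpace V] [BorelSpace V] {k : V → ℝ} (hk : ContDiff ℝ ∞ k)
    (hc : HasCompactSupport k) (e : V) : ∫ z, fderiv ℝ k z e = 0 := by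
  have h1 : Integrable fun z => fderiv ℝ k z e :=
    ((hk.continuous_fderiv (by simp)).clm_apply continuous_const).integrable_of_hasCompactSupport
      (hc.fderiv_apply ℝ e)
  have h2 := integral_mul_fderiv_eq_neg_fderiv_mul_of_integrable (μ := volume)
    (f := fun _ : V => (1 : ℝ)) (g := k) (v := e) (by simp) (by simpa using h1)
    (by simpa using hk.continuous.integrable_of_hasCompactSupport hc)
    (fun _ _ => differentiableAt_const _) (fun x _ => hk.differentiable (by simp) x)
  simpa using h2

theorem IsGraphAt.eventually_abs_inner_le {n : ℕ} {M : Set (E n)} {a : E n} {T : Gr n} {u : E n}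
    {K ρ : ℝ} (h : IsGraphAt M a T u K ρ) : ∀ᶠ r : ℝ in 𝓝[>] 0, 0 < r ∧ r ≤ 1 ∧
      ∀ x ∈ M ∩ Metric.closedBall a r, |r⁻¹ * ⟪u, r⁻¹ • (x - a)⟫| ≤ K ∧
        |⟪u, r⁻¹ • (x - a)⟫| < 1 / 4 := by
  have h1 : Tendsto (fun r : ℝ => K * r) (𝓝 0) (𝓝 (K * 0)) := tendsto_id.const_mul K
  rw [mul_zero] at h1
  filter_upwards [h.eventually, (h1.mono_left nhdsWithin_le_nhds).eventually
    (gt_mem_nhds (show (0 : ℝ) < 1 / 4 by norm_num))] with r hr hKr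
  obtain ⟨hr0, hr1, hrρ, -⟩ := hr
  refine ⟨hr0, hr1, fun x hx => ?_⟩
  have hxr : ‖x - a‖ ≤ r := by simpa [dist_eq_norm] using hx.2
  have h2 := h.abs_height_le hx.1 (hxr.trans hrρ)
  have hK := h.nonneg
  have h3 : |⟪u, x - a⟫| ≤ K * r ^ 2 := h2.trans (by gcongr)
  rw [inner_smul_right, abs_mul, abs_mul, abs_of_pos (inv_pos.2 hr0)]
  have h4 : r⁻¹ * |⟪u, x - a⟫| ≤ K * r := by
    rw [inv_mul_le_iff₀ hr0]
    linarith [show r * (K * r) = K * r ^ 2 by ring]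
  constructor
  · rw [inv_mul_le_iff₀ hr0]
    linarith
  · linarith

/-- A truncation of the identity which is admissible on `M`. -/
theorem IsGraphAt.exists_isAdmissibleCutoff {n : ℕ} {M : Set (E n)} {a : E n} {T : Gr n} {u : E n}
    {K ρ : ℝ} (h : IsGraphAt M a T u K ρ) :
    ∃ β : ℝ → ℝ, ContDiff ℝ ∞ β ∧ HasCompactSupport β ∧ IsAdmissibleCutoff β M a u := by
  have hK := h.nonneg
  let b : ContDiffBump (0 : ℝ) := ⟨K + 1, K + 2, by positivity, by linarith⟩
  refine ⟨fun t => t * b t, contDiff_id.mul b.contDiff, b.hasCompactSupport.mul_left, ?_⟩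
  filter_upwards [h.eventually_abs_inner_le] with r hr x hx
  have h1 := (hr.2.2 x ⟨hx.2, hx.1⟩).1
  set t := r⁻¹ * ⟪u, r⁻¹ • (x - a)⟫
  have h2 : (fun t => t * b t) =ᶠ[𝓝 t] fun t => t := by
    filter_upwards [b.eventuallyEq_one_of_mem_ball (x := t) (by
      rw [mem_ball_zero_iff, Real.norm_eq_abs]
      exact h1.trans_lt (by linarith [show b.rIn = K + 1 from rfl]))] with s hs
    rw [hs, Pi.one_apply, mul_one]
  rw [h2.deriv_eq]
  exact deriv_id t

theorem eq_zero_of_mul_pow_isLittleO {n : ℕ} {c : ℝ}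
    (h : (fun r : ℝ => c * r ^ n) =o[𝓝[>] 0] fun r => r ^ n) : c = 0 := by
  by_contra hc
  have h1 := h.def (c := |c| / 2) (by positivity)
  obtain ⟨r, h2, hr⟩ := (h1.and self_mem_nhdsWithin).exists
  have hr0 : 0 < r := hr
  have hrn : 0 < r ^ n := by positivity
  rw [norm_mul, Real.norm_of_nonneg hrn.le, Real.norm_eq_abs] at h2
  have h3 : 0 < |c| := abs_pos.2 hc
  nlinarith [mul_pos h3 hrn]

theorem pow_add_two_isLittleO (n : ℕ) :
    (fun r : ℝ => r ^ (n + 2)) =o[𝓝[>] 0] fun r => r ^ n :=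
  (isLittleO_pow_pow (by lia)).mono nhdsWithin_le_nhds

theorem inv_mul_pow_add_two_isLittleO (n : ℕ) {g : ℝ → ℝ}
    (h : g =O[𝓝[>] 0] fun r : ℝ => r ^ (n + 2)) :
    (fun r => r⁻¹ * g r) =o[𝓝[>] 0] fun r => r ^ n := by
  have h1 : (fun r => r⁻¹ * g r) =O[𝓝[>] 0] fun r : ℝ => r ^ (n + 1) := by
    refine ((isBigO_refl (fun r : ℝ => r⁻¹) _).mul h).congr' EventuallyEq.rfl ?_
    filter_upwards [self_mem_nhdsWithin] with r hr
    have hr0 : r ≠ 0 := ne_of_gt hr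
    field_simp
    ring
  exact h1.trans_isLittleO ((isLittleO_pow_pow (by lia)).mono nhdsWithin_le_nhds)

theorem setIntegral_inter_closedBall_eq {n : ℕ} {m : Measure (E n)} {M : Set (E n)}
    (hM : MeasurableSet M) {a : E n} {r : ℝ} {f g : E n → ℝ}
    (hf : ∀ x ∉ Metric.closedBall a r, f x = 0)
    (hfg : ∀ x ∈ M ∩ Metric.closedBall a r, g x = f x) :
    ∫ x in M ∩ Metric.closedBall a r, g x ∂m = ∫ x in M, f x ∂m := by
  rw [setIntegral_congr_fun (hM.inter Metric.isClosed_closedBall.measurableSet) hfg]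
  exact (setIntegral_eq_of_subset_of_forall_sdiff_eq_zero hM inter_subset_left
    fun x hx => hf x fun hxr => hx.2 ⟨hx.1, hxr⟩).symm

/-- Integrals of cutoff functions over `M`. -/
theorem IsPlaneCutoff.integral_isLittleO {n : ℕ} {M : Set (E n)} (hM : MeasurableSet M) {a : E n}
    {T : Gr n} {u : E n} {K ρ : ℝ} (hG : IsGraphAt M a T u K ρ) {ψ : E n → ℝ} {k : T.carrier → ℝ}
    (h : IsPlaneCutoff T u ψ k) :
    (fun r => ∫ x in M, ψ (r⁻¹ • (x - a)) ∂Measure.euclideanHausdorffMeasure n -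
      r ^ n * ∫ z, k z) =o[𝓝[>] 0] fun r => r ^ n := by
  have h1 := hG.integral_sub_isBigO h.contDiff_plane.continuous fun z => h.apply_eq_zero
  refine (h1.trans_isLittleO (pow_add_two_isLittleO n)).congr' ?_ EventuallyEq.rfl
  filter_upwards [hG.eventually_abs_inner_le] with r hr
  congr 1
  refine setIntegral_inter_closedBall_eq hM (fun x hx => ?_) fun x hx => ?_
  · exact image_eq_zero_of_notMem_tsupport (notMem_tsupport_of_one_lt h.tsupport_subset
      (one_lt_norm_of_notMem_closedBall hr.1 hx))
  · rw [(h.eventually_eq _ (hr.2.2 x hx).2).self_of_nhds, T.inv_smul_coord]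

/-! ### The mean curvature of a hypersurface is normal -/

/-- The correction field associated with a tangential direction. -/
theorem exists_tangential_correction {n : ℕ} {φ : E n → ℝ} (hφ : IsUniformlyConvexNorm φ)
    {T : Gr n} {u : E n} (hu : T.IsNormal u) {e : E n} (he : e ∈ T.carrier) :
    ∃ Λ : (E n →L[ℝ] ℝ) →L[ℝ] E n, (∀ l, Λ l ∈ T.carrier) ∧
      (∀ w ∈ T.carrier, ∀ l : E n →L[ℝ] ℝ,
        dStress φ u w (l.smulRight e) = φ u * ⟪w, Λ l⟫) ∧
      ∀ l, Λ l = (φ u)⁻¹ • (l e • T.proj (gradient φ u) - l (gradient φ u) • e) := by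
  have hφu : φ u ≠ 0 := (hφ.pos u hu.ne_zero).ne'
  set p := gradient φ u with hp
  let Λ : (E n →L[ℝ] ℝ) →L[ℝ] E n := (φ u)⁻¹ •
    ((ContinuousLinearMap.apply ℝ ℝ e).smulRight (T.proj p) -
      (ContinuousLinearMap.apply ℝ ℝ p).smulRight e)
  have hΛ : ∀ l, Λ l = (φ u)⁻¹ • (l e • T.proj p - l p • e) := fun l => rfl
  refine ⟨Λ, fun l => ?_, fun w hw l => ?_, hΛ⟩
  · rw [hΛ]
    exact T.carrier.smul_mem _ (T.carrier.sub_mem (T.carrier.smul_mem _ (T.proj_mem p))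
      (T.carrier.smul_mem _ he))
  · rw [dStress_apply hφ hu.ne_zero, traceL_smulRight, ← hp, hΛ, inner_smul_right, ← mul_assoc,
      mul_inv_cancel₀ hφu, one_mul, ContinuousLinearMap.smulRight_apply,
      ContinuousLinearMap.smulRight_apply, inner_smul_right, inner_smul_right, inner_sub_right,
      inner_smul_right, inner_smul_right, (hu.mem_iff e).1 he, hu.proj_apply, inner_sub_right,
      inner_smul_right, real_inner_comm u w, (hu.mem_iff w).1 hw, real_inner_comm w p]
    ring

theorem traceL_tangential_correction {n : ℕ} {φ : E n → ℝ} {T : Gr n} {u : E n}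
    (hu : T.IsNormal u) {ψ : E n → ℝ} {k : T.carrier → ℝ} (h : IsPlaneCutoff T u ψ k) {e : E n}
    {Λ : (E n →L[ℝ] ℝ) →L[ℝ] E n}
    (hΛ : ∀ l, Λ l = (φ u)⁻¹ • (l e • T.proj (gradient φ u) - l (gradient φ u) • e)) {y : E n}
    (hy : |⟪u, y⟫| < 1 / 4) : traceL n (Λ ∘L fderiv ℝ (fderiv ℝ ψ) y) = 0 := by
  set p := gradient φ u with hp
  set H := fderiv ℝ (fderiv ℝ ψ) y with hH
  have h1 : Λ ∘L H = (φ u)⁻¹ • (((ContinuousLinearMap.apply ℝ ℝ e) ∘L H).smulRight (T.proj p) -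
      ((ContinuousLinearMap.apply ℝ ℝ p) ∘L H).smulRight e) := by
    ext1 w
    rw [ContinuousLinearMap.comp_apply, hΛ]
    rfl
  have hsymm : ∀ v w, H v w = H w v :=
    (h.contDiff.contDiffAt (x := y)).isSymmSndFDerivAt (by
      rw [minSmoothness_of_isRCLikeNormedField]
      exact WithTop.coe_le_coe.2 (le_top : (2 : ℕ∞) ≤ ⊤))
  have h2 : H (T.proj p) e = H e p := by
    rw [hu.proj_apply, map_sub, map_smul, sub_apply, smul_apply, hsymm u e,
      h.fderiv_fderiv_apply_normal hu hy, hsymm p e, smul_zero, sub_zero]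
  rw [h1, map_smul, map_sub, traceL_smulRight, traceL_smulRight]
  change (φ u)⁻¹ • (H (T.proj p) e - H e p) = 0
  rw [h2, sub_self, smul_zero]

/-- The mean curvature of the varifold of a hypersurface is normal. -/
theorem inner_curvature_eq_zero {n : ℕ} {φ : E n → ℝ} (hφ : IsUniformlyConvexNorm φ)
    {W : Measure (E n × Gr n)} {M : Set (E n)} (hM : MeasurableSet M) {a : E n} {T : Gr n}
    (hW : IsSecondOrderPoint W M a T)
    (hWM : weight W = (Measure.euclideanHausdorffMeasure n).restrict M) {h : E n → E n}
    (hh : IsCurvaturePoint (integrand φ) W h a) {u : E n} {K ρ : ℝ} (hG : IsGraphAt M a T u K ρ)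
    {e : E n} (he : e ∈ T.carrier) : ⟪h a, e⟫ = 0 := by
  have hu := hG.normal
  obtain ⟨ψ, k, hψ⟩ := hu.exists_isPlaneCutoff
  obtain ⟨β, hβ, hβs, hβM⟩ := hG.exists_isAdmissibleCutoff
  obtain ⟨Λ, hΛT, hΛ, hΛe⟩ := exists_tangential_correction hφ hu he
  have key := curvature_isLittleO hφ hM hW hh hu hψ.contDiff hψ.tsupport_subset hβ hβs hβM hΛT hΛ
  rw [hWM] at key
  set e' := T.carrier.orthogonalProjectionOnto e with he'
  have hkc : HasCompactSupport k :=
    (isCompact_closedBall _ _).of_isClosed_subset (isClosed_tsupport _) hψ.tsupport_plane_subset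
  have h1 := hG.integral_sub_isBigO (k := fun z => fderiv ℝ k z e')
    ((hψ.contDiff_plane.continuous_fderiv (by simp)).clm_apply continuous_const) fun z hz => by
      have h2 : fderiv ℝ k z = 0 := image_eq_zero_of_notMem_tsupport fun h3 =>
        hz (hψ.tsupport_plane_subset (tsupport_fderiv_subset ℝ h3))
      rw [h2, zero_apply]
  rw [integral_fderiv_apply_eq_zero hψ.contDiff_plane hkc e'] at h1
  simp only [mul_zero, sub_zero] at h1
  have h2 := (inv_mul_pow_add_two_isLittleO n h1).const_mul_left (φ u)
  have h3 : (fun r => ∫ x in M, mainTerm φ u ψ β Λ e r (r⁻¹ • (x - a))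
      ∂Measure.euclideanHausdorffMeasure n) =o[𝓝[>] 0] fun r => r ^ n := by
    refine h2.congr' ?_ EventuallyEq.rfl
    filter_upwards [hG.eventually_abs_inner_le] with r hr
    rw [← mul_assoc, ← integral_const_mul]
    refine setIntegral_inter_closedBall_eq hM (fun x hx => ?_) fun x hx => ?_
    · exact mainTerm_eq_zero φ u β hψ.tsupport_subset Λ e r
        (one_lt_norm_of_notMem_closedBall hr.1 hx)
    · have hy := (hr.2.2 x hx).2
      rw [mainTerm, traceL_tangential_correction hu hψ hΛe hy, (hu.mem_iff e).1 he, zero_smul,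
        sub_zero, map_smul, hψ.fderiv_apply hy, T.inv_smul_coord, smul_eq_mul]
      ring
  have h4 := (hψ.integral_isLittleO hM hG).const_mul_left (integrand φ T * ⟪h a, e⟫)
  have h5 : (fun r : ℝ => (integrand φ T * ⟪h a, e⟫ * ∫ z, k z) * r ^ n) =o[𝓝[>] 0]
      fun r => r ^ n := by
    refine ((key.sub h3).sub h4).congr_left fun r => ?_
    ring
  have h6 := eq_zero_of_mul_pow_isLittleO h5
  have h7 := hφ.integrand_pos T
  have h8 := hψ.integral_pos
  rcases mul_eq_zero.1 h6 with h9 | h9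
  · exact (mul_eq_zero.1 h9).resolve_left h7.ne'
  · exact absurd h9 h8.ne'

/-! ### Comparison of the mean curvatures -/

/-- The measure `μ` has at `a` the density `θ` with respect to `m`, in the sense of integrals of
uniformly bounded functions supported in the balls `B(a, r)`, up to errors `o(r^n)`. -/
def HasDensityAt {n : ℕ} (μ m : Measure (E n)) (a : E n) (θ : ℝ) : Prop :=
  ∀ (g : ℝ → E n → ℝ) (C : ℝ), (∀ r, Continuous (g r)) → (∀ r x, |g r x| ≤ C) →
    (∀ r, 0 < r → ∀ x ∉ Metric.closedBall a r, g r x = 0) →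
    (fun r => ∫ x, g r x ∂μ - θ * ∫ x, g r x ∂m) =o[𝓝[>] 0] fun r => r ^ n

/-- The pointwise comparison: where `V` and the varifold `W` of `M` have proportional weights to
leading order, the main terms of their first variations in the direction `∇φ(u)` agree. -/
theorem curvature_eq {n : ℕ} {φ : E n → ℝ} (hφ : IsUniformlyConvexNorm φ)
    {V W : Measure (E n × Gr n)} {M : Set (E n)} (hM : MeasurableSet M) {a : E n} {T : Gr n}
    (hV : IsSecondOrderPoint V M a T) (hW : IsSecondOrderPoint W M a T)
    (hWM : weight W = (Measure.euclideanHausdorffMeasure n).restrict M) {θ : ℝ} (hθ0 : θ ≠ 0)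
    (hθ : HasDensityAt (weight V) (weight W) a θ) {hFV hFM : E n → E n}
    (hhV : IsCurvaturePoint (integrand φ) V hFV a)
    (hhM : IsCurvaturePoint (integrand φ) W hFM a) {u : E n} {K ρ : ℝ}
    (hG : IsGraphAt M a T u K ρ) (hVT : ∀ e ∈ T.carrier, ⟪hFV a, e⟫ = 0) : hFV a = hFM a := by
  have hu := hG.normal
  obtain ⟨ψ, k, hψ⟩ := hu.exists_isPlaneCutoff
  obtain ⟨β, hβ, hβs, hβM⟩ := hG.exists_isAdmissibleCutoff
  set p := gradient φ u with hp
  have hpu : ⟪u, p⟫ = φ u := by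
    rw [real_inner_comm, hφ.inner_gradient_self hu.ne_zero]
  obtain ⟨Λ, hΛT, hΛ⟩ := exists_correction hφ hu p
  have keyV := curvature_isLittleO hφ hM hV hhV hu hψ.contDiff hψ.tsupport_subset hβ hβs hβM hΛT hΛ
  have keyM := curvature_isLittleO hφ hM hW hhM hu hψ.contDiff hψ.tsupport_subset hβ hβs hβM hΛT hΛ
  -- the integrands are bounded, as the terms of order `r⁻¹` cancel for the direction `p`
  obtain ⟨Cψ, hCψ0, hCψ⟩ := exists_norm_fderiv_le hψ.contDiff hψ.tsupport_subset
  obtain ⟨Cβ, hCβ0, hCβ⟩ := exists_abs_deriv_le hβ hβs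
  have hmain : ∀ r y, |mainTerm φ u ψ β Λ p r y| ≤
      |φ u| * Cβ * (‖traceL n‖ * (‖Λ‖ * Cψ)) := by
    intro r y
    rw [mainTerm, ← hp, hpu, sub_self, map_zero, mul_zero, zero_add, abs_mul, abs_mul]
    have h1 : |traceL n (Λ ∘L fderiv ℝ (fderiv ℝ ψ) y)| ≤ ‖traceL n‖ * (‖Λ‖ * Cψ) := by
      refine ((traceL n).le_opNorm _).trans (mul_le_mul_of_nonneg_left ?_ (norm_nonneg _))
      exact (ContinuousLinearMap.opNorm_comp_le _ _).trans
        (mul_le_mul_of_nonneg_left (hCψ y).2.2 (norm_nonneg _))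
    have h2 := (hCβ (r⁻¹ * ⟪u, y⟫)).1
    gcongr
  have h1 := hθ (fun r x => mainTerm φ u ψ β Λ p r (r⁻¹ • (x - a))) _
    (fun r => (continuous_mainTerm φ u hψ.contDiff hβ Λ p r).comp (continuous_rescale a r))
    (fun r x => hmain r _) (fun r hr x hx => mainTerm_eq_zero φ u β hψ.tsupport_subset Λ p r
      (one_lt_norm_of_notMem_closedBall hr hx))
  have h2 := hθ (fun r x => ψ (r⁻¹ • (x - a))) Cψ
    (fun r => hψ.contDiff.continuous.comp (continuous_rescale a r)) (fun r x => (hCψ _).1)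
    (fun r hr x hx => image_eq_zero_of_notMem_tsupport (notMem_tsupport_of_one_lt
      hψ.tsupport_subset (one_lt_norm_of_notMem_closedBall hr hx)))
  have h3 := hψ.integral_isLittleO hM hG
  rw [← hWM] at h3
  have h4 : (fun r : ℝ => (integrand φ T * θ * (⟪hFV a, p⟫ - ⟪hFM a, p⟫) * ∫ z, k z) * r ^ n)
      =o[𝓝[>] 0] fun r => r ^ n := by
    refine ((((keyV.sub h1).sub (h2.const_mul_left (integrand φ T * ⟪hFV a, p⟫))).sub
      (keyM.const_mul_left θ)).sub (h3.const_mul_left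
        (integrand φ T * θ * (⟪hFV a, p⟫ - ⟪hFM a, p⟫)))).congr_left fun r => ?_
    ring
  have h5 := eq_zero_of_mul_pow_isLittleO h4
  have h6 : ⟪hFV a, p⟫ = ⟪hFM a, p⟫ := by
    have h7 := (hφ.integrand_pos T).ne'
    have h8 := hψ.integral_pos.ne'
    simpa [h7, h8, hθ0, sub_eq_zero] using h5
  -- the difference is normal to `T`, and `∇φ(u)` is transversal to `T`
  have hMT : ∀ e ∈ T.carrier, ⟪hFM a, e⟫ = 0 := fun e he =>
    inner_curvature_eq_zero hφ hM hW hWM hhM hG he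
  have hd : ∀ e ∈ T.carrier, ⟪hFV a - hFM a, e⟫ = 0 := fun e he => by
    rw [inner_sub_left, hVT e he, hMT e he, sub_zero]
  have hdp : ⟪hFV a - hFM a, p⟫ = 0 := by rw [inner_sub_left, h6, sub_self]
  have hφu : φ u ≠ 0 := (hφ.pos u hu.ne_zero).ne'
  have hdu : ⟪hFV a - hFM a, u⟫ = 0 := by
    have h9 := hd _ (T.proj_mem p)
    rw [hu.proj_apply, inner_sub_right, hdp, inner_smul_right, hpu, zero_sub, neg_eq_zero] at h9
    exact (mul_eq_zero.1 h9).resolve_left hφu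
  rw [← sub_eq_zero, ← inner_self_eq_zero (𝕜 := ℝ)]
  have h10 := hd _ (T.proj_mem (hFV a - hFM a))
  rwa [hu.proj_apply, inner_sub_right, inner_smul_right, hdu, mul_zero, sub_zero] at h10

/-! ### Differentiation of measures -/

theorem eventually_closedBall_subset {X : Type*} [PseudoMetricSpace X] {O : Set X}
    (hO : IsOpen O) {a : X} (ha : a ∈ O) :
    ∀ᶠ r : ℝ in 𝓝[>] 0, 0 < r ∧ Metric.closedBall a r ⊆ O := by
  obtain ⟨ε, hε, h⟩ := Metric.isOpen_iff.1 hO a ha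
  filter_upwards [self_mem_nhdsWithin, Ioo_mem_nhdsGT hε] with r hr hrε
  exact ⟨hr, (Metric.closedBall_subset_ball hrε.2).trans h⟩

theorem measureReal_restrict_eq {X : Type*} [MeasurableSpace X] (μ : Measure X) {O B : Set X}
    (hO : MeasurableSet O) (hB : B ⊆ O) : (μ.restrict O).real B = μ.real B := by
  rw [measureReal_restrict_apply' hO, inter_eq_self_of_subset_left hB]

theorem eventually_real_le_of_tendsto {n : ℕ} {μ ρ : Measure (E n)} [IsFiniteMeasure μ]
    [IsFiniteMeasure ρ] {a : E n} {l : ℝ≥0∞} {c : ℝ} (hl : l < ENNReal.ofReal c)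
    (h : Tendsto (fun r => ρ (Metric.closedBall a r) / μ (Metric.closedBall a r)) (𝓝[>] 0) (𝓝 l)) :
    ∀ᶠ r in 𝓝[>] 0, ρ.real (Metric.closedBall a r) ≤ c * μ.real (Metric.closedBall a r) := by
  have hc : 0 < c := ENNReal.ofReal_pos.1 (hl.trans_le' bot_le)
  filter_upwards [h.eventually (gt_mem_nhds hl)] with r hr
  have h1 := (ENNReal.div_le_iff_le_mul (Or.inr ENNReal.ofReal_ne_top)
    (Or.inl (measure_ne_top μ _))).1 hr.le
  have h2 := ENNReal.toReal_mono (ENNReal.mul_ne_top ENNReal.ofReal_ne_top (measure_ne_top μ _)) h1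
  rwa [ENNReal.toReal_mul, ENNReal.toReal_ofReal hc.le] at h2

/-- The upper density of one measure with respect to another is finite almost everywhere. -/
theorem ae_isBigO_closedBall {n : ℕ} {μ ρ : Measure (E n)} {O : Set (E n)} (hO : IsOpen O)
    (hμ : μ O < ⊤) (hρ : ρ O < ⊤) :
    ∀ᵐ a ∂(μ.restrict O), (fun r => ρ.real (Metric.closedBall a r)) =O[𝓝[>] 0]
      fun r => μ.real (Metric.closedBall a r) := by
  have : IsFiniteMeasure (μ.restrict O) := isFiniteMeasure_restrict.2 hμ.ne
  have : IsFiniteMeasure (ρ.restrict O) := isFiniteMeasure_restrict.2 hρ.ne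
  filter_upwards [Besicovitch.ae_tendsto_rnDeriv (ρ.restrict O) (μ.restrict O),
    Measure.rnDeriv_lt_top (ρ.restrict O) (μ.restrict O), ae_restrict_mem hO.measurableSet]
    with a ha hfin haO
  set l := (ρ.restrict O).rnDeriv (μ.restrict O) a
  have hl : l < ENNReal.ofReal (l.toReal + 1) := by
    rw [ENNReal.lt_ofReal_iff_toReal_lt hfin.ne]
    linarith
  refine IsBigO.of_bound (l.toReal + 1) ?_
  filter_upwards [eventually_real_le_of_tendsto hl ha, eventually_closedBall_subset hO haO]
    with r hr hrO
  rw [measureReal_restrict_eq _ hO.measurableSet hrO.2,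
    measureReal_restrict_eq _ hO.measurableSet hrO.2] at hr
  rwa [Real.norm_of_nonneg measureReal_nonneg, Real.norm_of_nonneg measureReal_nonneg]

/-- A singular measure has density zero almost everywhere. -/
theorem ae_isLittleO_closedBall {n : ℕ} {μ ρ : Measure (E n)} {O : Set (E n)} (hO : IsOpen O)
    (hμ : μ O < ⊤) (hρ : ρ O < ⊤) (hs : ρ ⟂ₘ μ) :
    ∀ᵐ a ∂(μ.restrict O), (fun r => ρ.real (Metric.closedBall a r)) =o[𝓝[>] 0]
      fun r => μ.real (Metric.closedBall a r) := by
  have : IsFiniteMeasure (μ.restrict O) := isFiniteMeasure_restrict.2 hμ.ne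
  have : IsFiniteMeasure (ρ.restrict O) := isFiniteMeasure_restrict.2 hρ.ne
  have hs' : ρ.restrict O ⟂ₘ μ.restrict O :=
    hs.mono Measure.restrict_le_self Measure.restrict_le_self
  filter_upwards [Besicovitch.ae_tendsto_rnDeriv (ρ.restrict O) (μ.restrict O),
    hs'.rnDeriv_ae_eq_zero, ae_restrict_mem hO.measurableSet] with a ha hzero haO
  rw [hzero, Pi.zero_apply] at ha
  refine isLittleO_iff.2 fun c hc => ?_
  filter_upwards [eventually_real_le_of_tendsto (ENNReal.ofReal_pos.2 hc) ha,
    eventually_closedBall_subset hO haO] with r hr hrO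
  rw [measureReal_restrict_eq _ hO.measurableSet hrO.2,
    measureReal_restrict_eq _ hO.measurableSet hrO.2] at hr
  rwa [Real.norm_of_nonneg measureReal_nonneg, Real.norm_of_nonneg measureReal_nonneg]

/-- Almost every point is a Lebesgue point. -/
theorem ae_isLittleO_integral_norm_sub {n : ℕ} {F : Type*} [NormedAddCommGroup F]
    {μ : Measure (E n)} {O : Set (E n)} (hO : IsOpen O) (hμ : μ O < ⊤) {f : E n → F}
    (hf : IntegrableOn f O μ) :
    ∀ᵐ a ∂(μ.restrict O), (fun r => ∫ x in Metric.closedBall a r, ‖f x - f a‖ ∂μ) =o[𝓝[>] 0]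
      fun r => μ.real (Metric.closedBall a r) := by
  have : IsFiniteMeasure (μ.restrict O) := isFiniteMeasure_restrict.2 hμ.ne
  filter_upwards [(Besicovitch.vitaliFamily (μ.restrict O)).ae_tendsto_average_norm_sub
    hf.locallyIntegrable, ae_restrict_mem hO.measurableSet] with a ha haO
  have h1 := ha.comp (Besicovitch.tendsto_filterAt (μ.restrict O) a)
  refine isLittleO_iff.2 fun c hc => ?_
  filter_upwards [h1.eventually (gt_mem_nhds hc), eventually_closedBall_subset hO haO] with r hr hrO
  simp only [Function.comp_apply, setAverage_eq, smul_eq_mul] at hr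
  rw [measureReal_restrict_eq _ hO.measurableSet hrO.2, Measure.restrict_restrict_of_subset hrO.2]
    at hr
  rw [Real.norm_of_nonneg measureReal_nonneg,
    Real.norm_of_nonneg (integral_nonneg fun _ => norm_nonneg _)]
  rcases (measureReal_nonneg (μ := μ) (s := Metric.closedBall a r)).eq_or_lt with h0 | h0
  · have h2 : μ (Metric.closedBall a r) = 0 := by
      rw [Measure.real, eq_comm, ENNReal.toReal_eq_zero_iff] at h0
      exact h0.resolve_right ((measure_mono hrO.2).trans_lt hμ).ne
    rw [Measure.restrict_eq_zero.2 h2, integral_zero_measure]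
    positivity
  · rw [inv_mul_lt_iff₀ h0] at hr
    linarith

/-- A Lebesgue point of the density, at which the part off `M` has density zero. -/
theorem hasDensityAt_of_isLittleO {n : ℕ} {μ m : Measure (E n)} {M O : Set (E n)}
    (hM : MeasurableSet M) (hO : IsOpen O) (hμ : μ O < ⊤) (hm : m O < ⊤) {θ : E n → ℝ≥0∞}
    (hθm : Measurable θ) (hθ : ∀ᵐ x ∂(m.restrict O), θ x < ⊤)
    (hθi : IntegrableOn (fun x => (θ x).toReal) O m)
    (hμθ : (μ.restrict O).restrict M = (m.restrict O).withDensity θ) {a : E n} (ha : a ∈ O)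
    (hoff : (fun r => μ.real (Metric.closedBall a r \ M)) =o[𝓝[>] 0] fun r => r ^ n)
    (hleb : (fun r => ∫ x in Metric.closedBall a r, ‖(θ x).toReal - (θ a).toReal‖ ∂m) =o[𝓝[>] 0]
      fun r => r ^ n) : HasDensityAt μ m a (θ a).toReal := by
  intro g C hgc hgC hg0
  have : IsFiniteMeasure (μ.restrict O) := isFiniteMeasure_restrict.2 hμ.ne
  have : IsFiniteMeasure (m.restrict O) := isFiniteMeasure_restrict.2 hm.ne
  refine IsBigO.trans_isLittleO (IsBigO.of_bound |C| ?_) (hoff.add hleb)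
  filter_upwards [eventually_closedBall_subset hO ha] with r hr
  have hgO : ∀ x ∉ O, g r x = 0 := fun x hx => hg0 r hr.1 x fun h => hx (hr.2 h)
  have hgi : ∀ ν : Measure (E n), IsFiniteMeasure ν → Integrable (g r) ν := fun ν _ =>
    Integrable.of_bound (hgc r).aestronglyMeasurable C (Eventually.of_forall (hgC r))
  have hBm : MeasurableSet (Metric.closedBall a r) := Metric.isClosed_closedBall.measurableSet
  have hC : ∀ x, ‖g r x‖ ≤ |C| := fun x => (hgC r x).trans (le_abs_self C)
  have h1 : ∫ x, g r x ∂μ = ∫ x in M, g r x ∂(μ.restrict O) + ∫ x in Mᶜ, g r x ∂(μ.restrict O) := by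
    rw [integral_add_compl hM (hgi _ inferInstance),
      setIntegral_eq_integral_of_forall_compl_eq_zero hgO]
  have h2 : ∫ x in M, g r x ∂(μ.restrict O) = ∫ x in O, (θ x).toReal * g r x ∂m := by
    rw [hμθ, integral_withDensity_eq_integral_toReal_smul hθm hθ]
    rfl
  have h3 : ∫ x, g r x ∂m = ∫ x in O, g r x ∂m :=
    (setIntegral_eq_integral_of_forall_compl_eq_zero hgO).symm
  have hgi2 : IntegrableOn (fun x => (θ x).toReal * g r x) O m :=
    Integrable.mul_bdd (c := C) hθi (hgc r).aestronglyMeasurable (Eventually.of_forall (hgC r))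
  have h4 : ∫ x, g r x ∂μ - (θ a).toReal * ∫ x, g r x ∂m =
      ∫ x in Mᶜ, g r x ∂(μ.restrict O) + ∫ x in O, ((θ x).toReal - (θ a).toReal) * g r x ∂m := by
    have h5 : ∫ x in O, ((θ x).toReal - (θ a).toReal) * g r x ∂m =
        ∫ x in O, (θ x).toReal * g r x ∂m - (θ a).toReal * ∫ x in O, g r x ∂m := by
      rw [← integral_const_mul, ← integral_sub hgi2 ((hgi _ inferInstance).const_mul _)]
      simp only [sub_mul]
    rw [h1, h2, h3, h5]
    ring
  have h6 : ‖∫ x in Mᶜ, g r x ∂(μ.restrict O)‖ ≤ |C| * μ.real (Metric.closedBall a r \ M) := by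
    have h7 : ∫ x in Mᶜ, g r x ∂(μ.restrict O) =
        ∫ x in Metric.closedBall a r \ M, g r x ∂μ := by
      rw [Measure.restrict_restrict hM.compl]
      refine setIntegral_eq_of_subset_of_forall_sdiff_eq_zero (hM.compl.inter hO.measurableSet)
        (fun x hx => ⟨hx.2, hr.2 hx.1⟩) fun x hx => hg0 r hr.1 x fun h => hx.2 ⟨h, hx.1.1⟩
    rw [h7]
    refine norm_setIntegral_le_of_norm_le_const ?_ fun x _ => hC x
    exact (measure_mono (sdiff_subset.trans hr.2)).trans_lt hμ
  have h8 : ‖∫ x in O, ((θ x).toReal - (θ a).toReal) * g r x ∂m‖ ≤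
      |C| * ∫ x in Metric.closedBall a r, ‖(θ x).toReal - (θ a).toReal‖ ∂m := by
    have h9 : ∫ x in O, ((θ x).toReal - (θ a).toReal) * g r x ∂m =
        ∫ x in Metric.closedBall a r, ((θ x).toReal - (θ a).toReal) * g r x ∂m :=
      setIntegral_eq_of_subset_of_forall_sdiff_eq_zero hO.measurableSet hr.2 fun x hx => by
        rw [hg0 r hr.1 x hx.2, mul_zero]
    rw [h9, ← integral_const_mul]
    have hint : IntegrableOn (fun x => (θ x).toReal - (θ a).toReal) O m :=
      hθi.sub (integrable_const _)
    refine norm_integral_le_of_norm_le ((hint.mono_set hr.2).norm.const_mul _)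
      (Eventually.of_forall fun x => ?_)
    rw [norm_mul, mul_comm]
    exact mul_le_mul_of_nonneg_right (hC x) (norm_nonneg _)
  have h10 : 0 ≤ ∫ x in Metric.closedBall a r, ‖(θ x).toReal - (θ a).toReal‖ ∂m :=
    integral_nonneg fun _ => norm_nonneg _
  rw [h4, Real.norm_of_nonneg (add_nonneg measureReal_nonneg h10), mul_add]
  exact (norm_add_le _ _).trans (add_le_add h6 h8)

/-! ### The varifold of a hypersurface -/

/-- Measurability of the tangent planes; without it the image measure defining the varifold of `M`
would be zero by convention. -/
theorem IsHypersurface.aemeasurable_tangentPlane {n : ℕ} {M : Set (E n)}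
    (hM : IsHypersurface 2 M) : AEMeasurable (fun x => (x, tangentPlane M x))
      ((Measure.euclideanHausdorffMeasure n).restrict M) :=
  (continuousOn_id.prodMk hM.continuousOn_tangentPlane).aemeasurable hM.measurableSet

theorem IsHypersurface.weight_surfaceVarifold {n : ℕ} {M : Set (E n)} (hM : IsHypersurface 2 M) :
    weight (surfaceVarifold M) = (Measure.euclideanHausdorffMeasure n).restrict M := by
  rw [weight, surfaceVarifold, pieceVarifold,
    AEMeasurable.map_map_of_aemeasurable measurable_fst.aemeasurable hM.aemeasurable_tangentPlane]
  exact Measure.map_id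

theorem IsGraphAt.measureReal_isBigO {n : ℕ} {M : Set (E n)} (hM : MeasurableSet M) {a : E n}
    {T : Gr n} {u : E n} {K ρ : ℝ} (h : IsGraphAt M a T u K ρ) :
    (fun r => ((Measure.euclideanHausdorffMeasure n).restrict M).real (Metric.closedBall a r))
      =O[𝓝[>] 0] fun r => r ^ n := by
  obtain ⟨C, hC0, hC⟩ := h.measure_le
  refine IsBigO.of_bound C ?_
  filter_upwards [hC, self_mem_nhdsWithin] with r hr hr0
  have hr0 : 0 < r := hr0
  rw [Real.norm_of_nonneg measureReal_nonneg, Real.norm_of_nonneg (by positivity),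
    measureReal_restrict_apply' hM, inter_comm]
  exact ENNReal.toReal_le_of_le_ofReal (by positivity) hr

/-- The tangent planes of a hypersurface of class `C²` are Lipschitz functions of the point, whence
the decay of the tilt-excess. -/
theorem IsHypersurface.isSecondOrderPoint {n : ℕ} {M : Set (E n)} (hM : IsHypersurface 2 M)
    {a : E n} (ha : a ∈ M) :
    IsSecondOrderPoint (surfaceVarifold M) M a (tangentPlane M a) := by
  obtain ⟨K, ρ, hG⟩ := hM.exists_isGraphAt ha (Gr.isNormal_unitNormal _)
  have hMm := hM.measurableSet
  have hgrowth := hG.measureReal_isBigO hMm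
  obtain ⟨C, hC0, hC⟩ := hG.measure_le
  have hfin : ∀ᶠ r in 𝓝[>] 0, weight (surfaceVarifold M) (Metric.closedBall a r) < ⊤ := by
    filter_upwards [hC] with r hr
    rw [hM.weight_surfaceVarifold, Measure.restrict_apply' hMm, inter_comm]
    exact hr.trans_lt ENNReal.ofReal_lt_top
  refine ⟨?_, ?_, ?_, ?_⟩
  · obtain ⟨r, hr, hr0⟩ := (hfin.and self_mem_nhdsWithin).exists
    exact ⟨r, hr0, hr⟩
  · rwa [hM.weight_surfaceVarifold]
  · obtain ⟨D, hD0, hD⟩ := hM.exists_norm_proj_tangentPlane_sub_le ha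
    obtain ⟨ε, hε, hball⟩ := Metric.nhds_basis_closedBall.eventually_iff.1 hD
    have h1 : (fun r => AnisotropicVarifold.tilt (surfaceVarifold M) a r (tangentPlane M a))
        =O[𝓝[>] 0] fun r =>
          r ^ 2 *
            ((Measure.euclideanHausdorffMeasure n).restrict M).real (Metric.closedBall a r) := by
      refine IsBigO.of_bound (D ^ 2) ?_
      filter_upwards [hfin, self_mem_nhdsWithin, Ioc_mem_nhdsGT hε] with r hrfin hr0 hrε
      have hr0 : 0 < r := hr0
      set S : Set (E n × Gr n) := {p | ‖p.2.proj - (tangentPlane M a).proj‖ ^ 2 ≤ D ^ 2 * r ^ 2}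
      have hS : MeasurableSet S :=
        (isClosed_le (continuous_tilt_integrand _) continuous_const).measurableSet
      have hae : ∀ᵐ p ∂(surfaceVarifold M), p ∈ cyl a r →
          ‖‖p.2.proj - (tangentPlane M a).proj‖ ^ 2‖ ≤ D ^ 2 * r ^ 2 := by
        have hm : MeasurableSet {p : E n × Gr n | p ∈ cyl a r → p ∈ S} := by
          have : {p : E n × Gr n | p ∈ cyl a r → p ∈ S} = (cyl a r)ᶜ ∪ S := by
            ext p
            simp [imp_iff_not_or]
          rw [this]
          exact (measurableSet_cyl a r).compl.union hS
        have h2 : ∀ᵐ p ∂(surfaceVarifold M), p ∈ cyl a r → p ∈ S := by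
          rw [surfaceVarifold, pieceVarifold, ae_map_iff hM.aemeasurable_tangentPlane hm]
          filter_upwards [ae_restrict_mem hMm] with x hxM hx
          have hx1 : x ∈ Metric.closedBall a r := hx.1
          have h3 := hball (Metric.closedBall_subset_closedBall hrε.2 hx1) hxM
          rw [Metric.mem_closedBall, dist_eq_norm] at hx1
          change ‖(tangentPlane M x).proj - _‖ ^ 2 ≤ _
          rw [← mul_pow]
          gcongr
          exact h3.trans (by gcongr)
        filter_upwards [h2] with p hp hpc
        rw [Real.norm_of_nonneg (by positivity)]
        exact hp hpc
      have h4 := norm_setIntegral_le_of_norm_le_const_ae' (by rwa [measure_cyl]) hae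
      rw [measureReal_cyl, hM.weight_surfaceVarifold] at h4
      rw [Real.norm_of_nonneg (mul_nonneg (by positivity) measureReal_nonneg)]
      refine h4.trans_eq ?_
      ring
    refine h1.trans (((isBigO_refl (fun r : ℝ => r ^ 2) _).mul hgrowth).congr_right fun r => ?_)
    ring
  · have h1 : ∀ r, (weight (surfaceVarifold M)).real (Metric.closedBall a r \ M) = 0 := by
      intro r
      rw [hM.weight_surfaceVarifold, measureReal_restrict_apply' hMm, sdiff_inter_self,
        measureReal_empty]
    simp only [h1]
    exact isLittleO_zero _ _

/-! ### Integral varifolds on a hypersurface -/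

/-- The only consequence of integrality that matters is that the weight does not charge sets of
Hausdorff measure zero. -/
theorem IsIntegralVarifold.weight_absolutelyContinuous {n : ℕ} {Ω : Set (E n)}
    {V : Measure (E n × Gr n)} (hV : IsIntegralVarifold Ω V) :
    weight V ≪ Measure.euclideanHausdorffMeasure n := by
  obtain ⟨-, N, S, c, -, rfl⟩ := hV
  refine Measure.AbsolutelyContinuous.mk fun A hA h0 => ?_
  have hp : MeasurableSet ((Prod.fst : E n × Gr n → E n) ⁻¹' A) := measurable_fst hA
  rw [weight, Measure.map_apply measurable_fst hA, Measure.sum_apply _ hp, ENNReal.tsum_eq_zero]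
  intro i
  rw [Measure.smul_apply, smul_eq_mul, mul_eq_zero]
  right
  rw [pieceVarifold]
  by_cases hm : AEMeasurable (fun x => (x, tangentPlane (N i) x))
      ((Measure.euclideanHausdorffMeasure n).restrict (S i))
  · rw [Measure.map_apply_of_aemeasurable hm hp]
    exact nonpos_iff_eq_zero.1 ((Measure.restrict_apply_le _ _).trans h0.le)
  -- the image measure under a function which is not measurable is zero by convention
  · rw [Measure.map_of_not_aemeasurable hm]
    rfl

theorem tendsto_div_ofReal_pow_of_isLittleO {n : ℕ} {f : ℝ → ℝ≥0∞}
    (hf : ∀ᶠ r in 𝓝[>] 0, f r ≠ ⊤) (h : (fun r => (f r).toReal) =o[𝓝[>] 0] fun r : ℝ => r ^ n) :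
    Tendsto (fun r => f r / ENNReal.ofReal (r ^ n)) (𝓝[>] 0) (𝓝 0) := by
  have h1 := h.tendsto_div_nhds_zero
  have h2 := ENNReal.tendsto_ofReal h1
  rw [ENNReal.ofReal_zero] at h2
  refine h2.congr' ?_
  filter_upwards [hf, self_mem_nhdsWithin] with r hr hr0
  have hr0 : 0 < r := hr0
  rw [ENNReal.ofReal_div_of_pos (by positivity), ENNReal.ofReal_toReal hr]

/-- An approximate tangent plane at a point of a hypersurface which carries most of the measure is
the tangent plane of the hypersurface. -/
theorem IsApproxTangentPlane.eq_tangentPlane {n : ℕ} {V : Measure (E n × Gr n)} {M : Set (E n)}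
    (hM : IsHypersurface 2 M) {a : E n} (ha : a ∈ M) {T : Gr n} (hT : IsApproxTangentPlane V a T)
    (h : Tendsto (fun r : ℝ => weight V (Metric.closedBall a r \ M) / ENNReal.ofReal (r ^ n))
      (𝓝[>] 0) (𝓝 0)) : T = tangentPlane M a := by
  have h1 : T.carrier ≤ (tangentPlane M a).carrier := by
    intro v hv
    have h2 : v ∈ approxTangentCone (weight V) a := hT.subset hv
    rw [← SetLike.mem_coe, ← hM.tangentCone_eq ha]
    exact h2 M h
  exact Gr.ext (Submodule.eq_of_le_of_finrank_eq h1 (T.finrank_eq.trans (Gr.finrank_eq _).symm))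

theorem tilt_isBigO_of_limsup_lt_top {n : ℕ} {V : Measure (E n × Gr n)} {a : E n} {T : Gr n}
    (h : limsup (fun r : ℝ => tiltExcess V a r T / ENNReal.ofReal (r ^ (n + 2))) (𝓝[>] 0) < ⊤) :
    (fun r => tilt V a r T) =O[𝓝[>] 0] fun r => r ^ (n + 2) := by
  obtain ⟨C, hC, hCtop⟩ := exists_between h
  refine IsBigO.of_bound C.toReal ?_
  filter_upwards [eventually_lt_of_limsup_lt hC, self_mem_nhdsWithin] with r hr hr0
  have hr0 : 0 < r := hr0
  have h1 := (ENNReal.div_le_iff_le_mul (Or.inr hCtop.ne) (Or.inl ENNReal.ofReal_ne_top)).1 hr.le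
  have h2 := ENNReal.toReal_mono (ENNReal.mul_ne_top hCtop.ne ENNReal.ofReal_ne_top) h1
  rw [ENNReal.toReal_mul, ENNReal.toReal_ofReal (by positivity), ← tilt_eq_toReal] at h2
  rwa [Real.norm_of_nonneg (tilt_nonneg V a r T), Real.norm_of_nonneg (by positivity)]

/-! ### Lebesgue points of the mean curvature -/

theorem IsMeanCurvature.ae_isLittleO {n : ℕ} {F : Gr n → ℝ} {U : Set (E n)}
    {W : Measure (E n × Gr n)} {h : E n → E n} (hh : IsMeanCurvature F U W h) {O : Set (E n)}
    (hO : IsOpen O) (hOc : IsCompact (closure O)) (hOU : closure O ⊆ U) (hW : weight W O < ⊤) :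
    ∀ᵐ a ∂((weight W).restrict O),
      (fun r => ∫ x in Metric.closedBall a r, ‖h x - h a‖ ∂(weight W)) =o[𝓝[>] 0]
        (fun r => (weight W).real (Metric.closedBall a r)) ∧
      (fun r => ((totalVariation F U W).singularPart (weight W)).real (Metric.closedBall a r))
        =o[𝓝[>] 0] fun r => (weight W).real (Metric.closedBall a r) := by
  have h1 : IntegrableOn h O (weight W) :=
    (hh.integrable _ hOc hOU).mono_set subset_closure
  have h2 : (totalVariation F U W).singularPart (weight W) O < ⊤ :=
    ((Measure.singularPart_le _ _ O).trans (measure_mono subset_closure)).trans_lt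
      (hh.radon.compact _ hOc hOU)
  exact (ae_isLittleO_integral_norm_sub hO hW h1).and
    (ae_isLittleO_closedBall hO hW h2 (Measure.mutuallySingular_singularPart _ _))

/-- A Lebesgue point of the mean curvature at which the singular part of the first variation has
density zero, both relative to a weight of bounded density ratio. -/
theorem IsMeanCurvature.isCurvaturePoint {n : ℕ} {F : Gr n → ℝ} {U : Set (E n)} (hU : IsOpen U)
    {W : Measure (E n × Gr n)} {h : E n → E n} (hh : IsMeanCurvature F U W h) {a : E n}
    (ha : a ∈ U)
    (hgrowth : (fun r => (weight W).real (Metric.closedBall a r)) =O[𝓝[>] 0] fun r => r ^ n)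
    (hleb : (fun r => ∫ x in Metric.closedBall a r, ‖h x - h a‖ ∂(weight W)) =o[𝓝[>] 0]
        (fun r => (weight W).real (Metric.closedBall a r)))
    (hsing : (fun r => ((totalVariation F U W).singularPart (weight W)).real
      (Metric.closedBall a r)) =o[𝓝[>] 0] fun r => (weight W).real (Metric.closedBall a r)) :
    IsCurvaturePoint F W h a := by
  obtain ⟨η, -, hη, hrep⟩ := hh.representation
  obtain ⟨ρ, hρ, hρU⟩ := (eventually_closedBall_subset hU ha).exists
  refine ⟨hh.measurable, ⟨ρ, hρ, hh.integrable _ (isCompact_closedBall a ρ) hρU⟩,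
    hleb.trans_isBigO hgrowth, (totalVariation F U W).singularPart (weight W), η, U, hU, ha,
    ⟨ρ, hρ, ?_⟩, hsing.trans_isBigO hgrowth, ?_, fun g hg => (hrep g hg).1⟩
  · exact (Measure.singularPart_le _ _ _).trans_lt
      (hh.radon.compact _ (isCompact_closedBall a ρ) hρU)
  · exact ae_mono (Measure.singularPart_le _ _) hη

/-- The comparison of mean curvatures, in a bounded open set in which the first variations and
the measures are finite. -/
theorem ae_curvature_eq {n : ℕ} {φ : E n → ℝ} (hφ : IsUniformlyConvexNorm φ)
    {Ω U O M : Set (E n)} (hΩ : IsOpen Ω) (hU : IsOpen U) (hO : IsOpen O)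
    (hOc : IsCompact (closure O)) (hOΩ : closure O ⊆ Ω) (hOU : closure O ⊆ U)
    {V : Measure (E n × Gr n)} (hV : IsIntegralVarifold Ω V) (hM : IsHypersurface 2 M)
    (hMfin : Measure.euclideanHausdorffMeasure n M < ⊤) {hFV hFM : E n → E n}
    (hhV : IsMeanCurvature (integrand φ) Ω V hFV)
    (hhM : IsMeanCurvature (integrand φ) U (surfaceVarifold M) hFM) :
    ∀ᵐ a ∂((weight V).restrict O), a ∈ M →
      (∃ T : Gr n, IsApproxTangentPlane V a T ∧ (∀ v ∈ T.carrier, inner ℝ (hFV a) v = 0) ∧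
        limsup (fun r : ℝ => tiltExcess V a r T / ENNReal.ofReal (r ^ (n + 2))) (𝓝[>] 0) < ⊤) →
      hFV a = hFM a := by
  have hMm := hM.measurableSet
  have hWM := hM.weight_surfaceVarifold
  set m := weight (surfaceVarifold M) with hm
  set μ := weight V with hμ
  have hμO : μ O < ⊤ := (measure_mono subset_closure).trans_lt (hV.1.compact _ hOc hOΩ)
  have hmfin : IsFiniteMeasure m := ⟨by rw [hWM, Measure.restrict_apply_univ]; exact hMfin⟩
  have hmO : m O < ⊤ := measure_lt_top m O
  have : IsFiniteMeasure (μ.restrict O) := isFiniteMeasure_restrict.2 hμO.ne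
  have : IsFiniteMeasure (m.restrict O) := isFiniteMeasure_restrict.2 hmO.ne
  have : IsFiniteMeasure ((μ.restrict O).restrict M) := inferInstance
  have : ((μ.restrict O).restrict M).HaveLebesgueDecomposition (m.restrict O) :=
    Measure.haveLebesgueDecomposition_of_sigmaFinite _ _
  -- decomposition of the weight into the parts on and off the hypersurface
  have hac : (μ.restrict O).restrict M ≪ m.restrict O := by
    rw [hWM, Measure.restrict_restrict hMm, Measure.restrict_restrict hO.measurableSet, inter_comm]
    exact hV.weight_absolutelyContinuous.restrict _
  set θ := ((μ.restrict O).restrict M).rnDeriv (m.restrict O) with hθ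
  have hθe : (μ.restrict O).restrict M = (m.restrict O).withDensity θ :=
    (Measure.withDensity_rnDeriv_eq _ _ hac).symm
  have hθpos : ∀ᵐ a ∂((μ.restrict O).restrict M), 0 < θ a := Measure.rnDeriv_pos hac
  have hθtop : ∀ᵐ a ∂(m.restrict O), θ a < ⊤ := Measure.rnDeriv_lt_top _ _
  have hθi : IntegrableOn (fun x => (θ x).toReal) O m := Measure.integrable_toReal_rnDeriv
  have hsing : μ.restrict Mᶜ ⟂ₘ m := by
    refine Measure.MutuallySingular.mk (s := M) (t := Mᶜ) ?_ ?_ (union_compl_self M).superset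
    · rw [Measure.restrict_apply hMm, inter_compl_self, measure_empty]
    · rw [hWM, Measure.restrict_apply hMm.compl, compl_inter_self, measure_empty]
  have hoffO : μ.restrict Mᶜ O < ⊤ := (Measure.restrict_apply_le _ _).trans_lt hμO
  -- properties which hold almost everywhere with respect to the surface measure also hold almost
  -- everywhere with respect to the part of the weight on `M`
  have hbase := (((((ae_isBigO_closedBall hO hmO hμO).and
    (ae_isLittleO_closedBall hO hmO hoffO hsing)).and
    (ae_isLittleO_integral_norm_sub hO hmO hθi)).and hθtop).and
    (hhM.ae_isLittleO hO hOc hOU hmO))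
  have hbaseV := hac.ae_le hbase
  have hVae := hhV.ae_isLittleO hO hOc hOΩ hμO
  have key : ∀ᵐ a ∂((μ.restrict O).restrict M),
      (∃ T : Gr n, IsApproxTangentPlane V a T ∧ (∀ v ∈ T.carrier, inner ℝ (hFV a) v = 0) ∧
        limsup (fun r : ℝ => tiltExcess V a r T / ENNReal.ofReal (r ^ (n + 2))) (𝓝[>] 0) < ⊤) →
      hFV a = hFM a := by
    filter_upwards [hbaseV, hθpos, ae_restrict_of_ae hVae, ae_restrict_mem hMm,
      ae_restrict_of_ae (ae_restrict_mem hO.measurableSet)] with a hab hθa hVa haM haO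
    rintro ⟨T, hT, hTperp, htilt⟩
    obtain ⟨⟨⟨⟨hgr, hoff⟩, hleb⟩, hθat⟩, hMleb, hMsing⟩ := hab
    obtain ⟨K, ρ, hG⟩ := hM.exists_isGraphAt haM (Gr.isNormal_unitNormal _)
    have hmgr : (fun r => m.real (Metric.closedBall a r)) =O[𝓝[>] 0] fun r => r ^ n := by
      rw [hWM]
      exact hG.measureReal_isBigO hMm
    have hμgr := hgr.trans hmgr
    have hoff' : (fun r => μ.real (Metric.closedBall a r \ M)) =o[𝓝[>] 0] fun r => r ^ n := by
      refine (hoff.trans_isBigO hmgr).congr_left fun r => ?_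
      rw [measureReal_restrict_apply' hMm.compl]
      rfl
    have hsmall : ∀ᶠ r : ℝ in 𝓝[>] 0, μ (Metric.closedBall a r \ M) ≠ ⊤ := by
      filter_upwards [eventually_closedBall_subset hO haO] with r hr
      exact ((measure_mono (sdiff_subset.trans hr.2)).trans_lt hμO).ne
    -- as the part off `M` has density zero, `M` competes in the definition of the approximate
    -- tangent cone
    have hTM : T = tangentPlane M a :=
      hT.eq_tangentPlane hM haM (tendsto_div_ofReal_pow_of_isLittleO hsmall hoff')
    subst hTM
    obtain ⟨ρ', hρ', hρO⟩ := (eventually_closedBall_subset hO haO).exists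
    have hVso : IsSecondOrderPoint V M a (tangentPlane M a) :=
      ⟨⟨ρ', hρ', (measure_mono hρO).trans_lt hμO⟩, hμgr, tilt_isBigO_of_limsup_lt_top htilt, hoff'⟩
    have hden : HasDensityAt μ m a (θ a).toReal :=
      hasDensityAt_of_isLittleO hMm hO hμO hmO (Measure.measurable_rnDeriv _ _) hθtop hθi hθe haO
        hoff' (hleb.trans_isBigO hmgr)
    exact curvature_eq hφ hMm hVso (hM.isSecondOrderPoint haM) hWM
      (ENNReal.toReal_pos hθa.ne' hθat.ne).ne' hden
      (hhV.isCurvaturePoint hΩ (hOΩ (subset_closure haO)) hμgr hVa.1 hVa.2)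
      (hhM.isCurvaturePoint hU (hOU (subset_closure haO)) hmgr hMleb hMsing) hG hTperp
  rw [ae_restrict_iff' hMm] at key
  exact key

end AnisotropicVarifold

open AnisotropicVarifold
theorem mainTheorem3 (n : ℕ) (φ : E n → ℝ) (hφ : IsUniformlyConvexNorm φ)
    (Ω : Set (E n)) (hΩ : IsOpen Ω)
    (V : Measure (E n × Gr n)) (hV : IsIntegralVarifold Ω V)
    (hδV : IsRadonOn Ω (totalVariation (integrand φ) Ω V))
    (M : Set (E n)) (hM : IsHypersurface 2 M) (hMΩ : M ⊆ Ω)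
    (hMfin : Measure.euclideanHausdorffMeasure n M < ⊤)
    (hFV hFM : E n → E n)
    (hhFV : IsMeanCurvature (integrand φ) Ω V hFV)
    (hhFM : IsHypersurfaceMeanCurvature (integrand φ) M hFM) :
    ∀ᵐ a ∂(weight V), a ∈ M →
      (∃ T : Gr n, IsApproxTangentPlane V a T ∧ (∀ v ∈ T.carrier, inner ℝ (hFV a) v = 0) ∧
        limsup (fun r : ℝ => tiltExcess V a r T / ENNReal.ofReal (r ^ (n + 2))) (𝓝[>] 0) < ⊤) →
      hFV a = hFM a := by
  -- the null set is covered by small balls, in each of which `hFM` is a mean curvature of `M ∩ U`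
  rw [ae_iff]
  refine measure_null_of_locally_null _ fun a ha => ?_
  have haM : a ∈ M := by
    by_contra h
    exact ha fun h' => absurd h' h
  obtain ⟨U, hU, haU, hhU⟩ := hhFM a haM
  obtain ⟨ε, hε, hεs⟩ := (eventually_closedBall_subset (hΩ.inter hU) ⟨hMΩ haM, haU⟩).exists
  have hcl : closure (Metric.ball a ε) ⊆ Ω ∩ U := Metric.closure_ball_subset_closedBall.trans hεs
  have h1 := ae_curvature_eq hφ hΩ hU Metric.isOpen_ball
    ((isCompact_closedBall a ε).of_isClosed_subset isClosed_closure
      Metric.closure_ball_subset_closedBall) (hcl.trans inter_subset_left)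
    (hcl.trans inter_subset_right) hV (hM.inter hU)
    ((measure_mono inter_subset_left).trans_lt hMfin) hhFV hhU
  rw [ae_restrict_iff' Metric.isOpen_ball.measurableSet, ae_iff] at h1
  refine ⟨_, inter_mem_nhdsWithin _ (Metric.ball_mem_nhds a hε), ?_⟩
  refine measure_mono_null ?_ h1
  rintro x ⟨hx, hxε⟩ h
  refine hx fun hxM => h hxε ⟨hxM, ?_⟩
  exact (hεs (Metric.ball_subset_closedBall hxε)).2
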